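/- **Theorem.** For an array $A=(a_1,\dots,a_n)$ of $n\ge 1$ integers let $\mathrm{lis}(A)$ be the largest number of positions $i_1<\dots<i_m$ with $a_{i_1}<\dots<a_{i_m}$. There is a universal constant $\alpha>0$ such that for every $c\in\mathbb N$ there is a randomized algorithm (a single word RAM program for all input lengths) with the following property. Given $n$ and random access to an array $A$ of $n\ge1$ integers with $\mathrm{lis}(A)=n\lambda$, where $\lambda$ is not known to the algorithm, it halts, for every outcome of its random choices, within $\tilde O(n^{17/20})$ steps, that is, within $C\,n^{17/20}\,(\log(n+2))^{k}$ steps where the constants $C,k$ depend only on $c$ (in particular not on $\lambda$), and with probability at least $1-n^{-c}$ its output is an integer $\mathrm{est}$ with $$\alpha\,\lambda^{3}\,\mathrm{lis}(A)\ \le\ \mathrm{est}\ \le\ \mathrm{lis}(A).$$ Here the word RAM works with signed $w$-bit words (arithmetic modulo $2^w$), where $w$ may be any integer with $w\ge K(\lfloor\log_2 n\rfloor+1)$ for a constant $K$ depending only on $c$, and the entries of $A$ may be any $w$-bit integers; each of the following takes one step: setting a register to a constant or to another register, $+,-,\times$ or integer division of two registers, reading or writing a memory cell, reading an entry of $A$,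 drawing a uniformly random element of $\{0,\dots,m\}$ for a number $m \geq 0$ in a register, comparing two registers for a branch or a loop, and sequencing two subprograms. -/

import Mathlib

/-- The length of a longest (strictly) increasing subsequence of the array `A`: the largest
number of positions on which `A` is strictly increasing. -/
noncomputable def lis {n : ℕ} (A : Fin n → ℤ) : ℕ := by
  classical
  exact ((Finset.univ : Finset (Finset (Fin n))).filter
    (fun s : Finset (Fin n) => StrictMonoOn A (s : Set (Fin n)))).sup Finset.card

/-! ## Randomized word RAM

A word is a signed `w`-bit integer, i.e. an integer in `[-2^(w-1), 2^(w-1))`; arithmetic wraps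
around modulo `2^w`. The machine has registers, a random access memory of words, random access
to a read-only input array, and a source of uniform random integers. Programs are structured
(sequencing, branching, loops); every elementary instruction, every sequencing and every
evaluation of a branch or loop condition takes one step. -/

namespace WordRAM

/-- Reduction of an integer to its representative modulo `2^w` in `[-2^(w-1), 2^(w-1))`. -/
def wrap (w : ℕ) (x : ℤ) : ℤ := x.bmod (2 ^ w)

/-- The integer `x` is a signed `w`-bit word. -/
def IsWord (w : ℕ) (x : ℤ) : Prop := -2 ^ (w - 1) ≤ x ∧ x < 2 ^ (w - 1)

/-- Arithmetic operations; `quot` is integer division rounded down for a positive divisor,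
with value `0` for the divisor `0`. -/
inductive Arith
  | plus | minus | times | quot

def Arith.eval : Arith → ℤ → ℤ → ℤ
  | .plus, x, y => x + y
  | .minus, x, y => x - y
  | .times, x, y => x * y
  | .quot, x, y => x / y

/-- Elementary instructions. Natural numbers are names of registers. -/
inductive Instr
  /-- `r[d] := v` -/
  | const (d : ℕ) (v : ℤ)
  /-- `r[d] := r[a]` -/
  | copy (d a : ℕ)
  /-- `r[d] := r[a] o r[b]` -/
  | arith (o : Arith) (d a b : ℕ)
  /-- `r[d] := mem[r[a]]` -/
  | load (d a : ℕ)
  /-- `mem[r[a]] := r[b]` -/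
  | store (a b : ℕ)
  /-- `r[d] :=` the entry of the input array at position `r[a]` (counted from `0`),
  and `0` if there is no such position -/
  | input (d a : ℕ)
  /-- `r[d] :=` a fresh uniformly random element of `{0, 1, …, r[a]}` (of `{0}` if `r[a] < 0`) -/
  | random (d a : ℕ)

/-- Structured programs. -/
inductive Prog
  | instr (i : Instr)
  | seq (p q : Prog)
  /-- if `r[a] < r[b]` then `p` else `q` -/
  | ifLt (a b : ℕ) (p q : Prog)
  /-- while `r[a] < r[b]` do `p` -/
  | whileLt (a b : ℕ) (p : Prog)

/-- The contents of the registers and of the working memory. -/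
structure Store where
  reg : ℕ → ℤ
  mem : ℤ → ℤ

def Store.setReg (s : Store) (d : ℕ) (v : ℤ) : Store :=
  { s with reg := Function.update s.reg d v }

def Store.setMem (s : Store) (a v : ℤ) : Store :=
  { s with mem := Function.update s.mem a v }

/-- The entry of the input array at position `x`, counted from `0`; out of range it is `0`. -/
def entry {n : ℕ} (A : Fin n → ℤ) (x : ℤ) : ℤ :=
  if h : 0 ≤ x ∧ x.toNat < n then A ⟨x.toNat, h.2⟩ else 0

/-- The (random) effect of an elementary instruction, for word length `w` and input `A`. -/
noncomputable def exec (w : ℕ) {n : ℕ} (A : Fin n → ℤ) (s : Store) : Instr → PMF Store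
  | .const d v => PMF.pure (s.setReg d (wrap w v))
  | .copy d a => PMF.pure (s.setReg d (s.reg a))
  | .arith o d a b => PMF.pure (s.setReg d (wrap w (o.eval (s.reg a) (s.reg b))))
  | .load d a => PMF.pure (s.setReg d (s.mem (s.reg a)))
  | .store a b => PMF.pure (s.setMem (s.reg a) (s.reg b))
  | .input d a => PMF.pure (s.setReg d (entry A (s.reg a)))
  | .random d a =>
      (PMF.uniformOfFintype (Fin ((s.reg a).toNat + 1))).map
        fun v => s.setReg d ((v : ℕ) : ℤ)

/-- A configuration: the list of programs still to be carried out, in this order, and the store.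
The machine has halted when the list is empty. -/
structure Config where
  todo : List Prog
  store : Store

def Config.Halted (c : Config) : Prop := c.todo = []

/-- The result of the computation is found in register `0`. -/
def Config.output (c : Config) : ℤ := c.store.reg 0

/-- One step of the machine. A halted machine remains as it is. -/
noncomputable def step (w : ℕ) {n : ℕ} (A : Fin n → ℤ) : Config → PMF Config
  | ⟨[], s⟩ => PMF.pure ⟨[], s⟩
  | ⟨.instr i :: k, s⟩ => (exec w A s i).map fun s' => ⟨k, s'⟩
  | ⟨.seq p q :: k, s⟩ => PMF.pure ⟨p :: q :: k, s⟩
  | ⟨.ifLt a b p q :: k, s⟩ =>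
      PMF.pure (if s.reg a < s.reg b then ⟨p :: k, s⟩ else ⟨q :: k, s⟩)
  | ⟨.whileLt a b p :: k, s⟩ =>
      PMF.pure (if s.reg a < s.reg b then ⟨p :: .whileLt a b p :: k, s⟩ else ⟨k, s⟩)

/-- The distribution of the configuration after `t` steps. -/
noncomputable def runFrom (w : ℕ) {n : ℕ} (A : Fin n → ℤ) : ℕ → Config → PMF Config
  | 0, c => PMF.pure c
  | t + 1, c => (step w A c).bind (runFrom w A t)

/-- Initially register `0` holds the length `n` of the input array; all other registers and all
memory cells are `0`. -/
def initial (p : Prog) (n : ℕ) : Config :=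
  ⟨[p], ⟨Function.update (fun _ => 0) 0 (n : ℤ), fun _ => 0⟩⟩

/-- The distribution of the configuration of the program `p` after `t` steps on input `A`. -/
noncomputable def run (p : Prog) (w : ℕ) {n : ℕ} (A : Fin n → ℤ) (t : ℕ) : PMF Config :=
  runFrom w A t (initial p n)

/-- On input `A`, the program `p` halts after at most `t` steps, whatever the random choices. -/
def HaltsWithin (p : Prog) (w : ℕ) {n : ℕ} (A : Fin n → ℤ) (t : ℕ) : Prop :=
  ∀ c ∈ (run p w A t).support, c.Halted

/-- The probability that the program `p`, run on input `A` for `t` steps, has halted by then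
with an output in `S`. -/
noncomputable def outputProb (p : Prog) (w : ℕ) {n : ℕ} (A : Fin n → ℤ) (t : ℕ)
    (S : Set ℤ) : ENNReal :=
  (run p w A t).toOuterMeasure {c | c.Halted ∧ c.output ∈ S}

end WordRAM

/-! Write L for the length sought, so that λ = L/n and the lower bound asked for is a constant times
L^4/n^3. Let x be the twentieth root of n, rounded down. Two estimators cover the two ranges of λ;
neither may exceed L, up to a tiny failure probability, so the larger result is returned.

If λ < 1/x, it is enough to draw one random entry from each block of length x^3 and to solve the
sample of about x^17 entries exactly. The sample is a subsequence of the array, so its answer is at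
most L (`lisOn_sample_le`). A fixed optimal subsequence is met in about L/x^3 blocks, which is more
than λ^3 L (`exists_thin_potential`).

If λ ≥ 1/x, the array is cut into N = x^10 blocks of length B, and every q ≤ x is tried as a guess
of 1/λ. For each block k = 36q^2 items are drawn: an item is the interval between the values at two
random positions of the block. Fix an optimal subsequence. In a block where it has at least B/(2q)
entries, an item has probability at least 1/k to start in the first third and to end in the last
third of these entries. Such a hit captures a third of the share of the block, and hits in different
blocks form a chain of increasing intervals (`exists_hits`). So an unknown chain carries a constant
fraction of L. Scores of items are too expensive to be computed for all of them; instead R = 64kq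
chains, longest in cardinality, are removed one after the other (`rounds_run`). A chain that avoids
the set D of removed items has at most Nk/R members, worth at most NB/(64q) ≤ L/64, so the total
score of D is at least a constant times L (`Hits.mul_sum_le`, `extracted_score_bound`). On the other
hand D is a union of R chains, and the score of a chain is at most L because subsequences inside its
intervals can be concatenated (`ItemChain.sum_blockLis_le`). Hence score(D)/R is at most L and at
least of order L/R; as R is proportional to q^3, this is where λ^3 comes from. The total score is
estimated from about q^3 x random items (`exists_upper_potential`, `exists_lower_potential`).

Up to logarithms a phase costs RNk + SB, which is at most of order x^15, where S is the number of
sampled items; there are x phases, and thinning costs x^17, that is n^(17/20).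

Each probability bound is given by an exponential potential: its average over the next draw does not
exceed its present value, it starts at or below 2^(-x), and it ends at or above 1 in every bad
outcome. Accordingly the program logic `ExpLe` bounds expected penalties. A computation that has not
halted counts as an infinite penalty, so finite bounds also prove that all runs halt. The total
failure probability (x+2)2^(-x) is below n^(-c) once x ≥ x₀; shorter inputs are solved exactly. -/

open scoped ENNReal

namespace WordRAM

/-! ## Expected values of the final store -/

section Expect

variable (w : ℕ) {n : ℕ} (A : Fin n → ℤ)

/-- The expected value of `F` at the store reached after `T` steps, where a configuration that has
not halted by then counts as `⊤`. -/
noncomputable def expect : ℕ → Config → (Store → ℝ≥0∞) → ℝ≥0∞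
  | 0, c, F => open Classical in if c.todo = [] then F c.store else ⊤
  | T + 1, c, F => ∑' c', step w A c c' * expect T c' F

theorem tsum_pure_mul {α : Type*} (a : α) (h : α → ℝ≥0∞) :
    ∑' a', PMF.pure a a' * h a' = h a := by
  rw [tsum_eq_single a]
  · simp
  · intro b hb
    simp [PMF.pure_apply, hb]

theorem tsum_map_mul {α β : Type*} (p : PMF α) (f : α → β) (h : β → ℝ≥0∞) :
    ∑' b, p.map f b * h b = ∑' a, p a * h (f a) := by
  have : ∀ b, p.map f b * h b = ∑' a, p a * (PMF.pure (f a) b * h b) := by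
    intro b
    rw [← PMF.bind_pure_comp, PMF.bind_apply, ← ENNReal.tsum_mul_right]
    simp
  simp_rw [this]
  rw [ENNReal.tsum_comm]
  simp_rw [ENNReal.tsum_mul_left, tsum_pure_mul]

theorem expect_halted (T : ℕ) (s : Store) (F : Store → ℝ≥0∞) :
    expect w A T ⟨[], s⟩ F = F s := by
  induction T with
  | zero => simp [expect]
  | succ T ih => simp [expect, step, ih]

theorem expect_succ_le (T : ℕ) (c : Config) (F : Store → ℝ≥0∞) :
    expect w A (T + 1) c F ≤ expect w A T c F := by
  induction T generalizing c with
  | zero =>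
    rcases c with ⟨_ | ⟨p, k⟩, s⟩
    · simp [expect_halted]
    · simp [expect]
  | succ T ih =>
    rw [expect, expect]
    exact ENNReal.tsum_le_tsum fun c' => by gcongr; exact ih c'

theorem expect_anti {T T' : ℕ} (h : T ≤ T') (c : Config) (F : Store → ℝ≥0∞) :
    expect w A T' c F ≤ expect w A T c F := by
  induction T', h using Nat.le_induction with
  | base => exact le_rfl
  | succ T' _ ih => exact (expect_succ_le w A T' c F).trans ih

/-- A reachable configuration has positive probability and a positive multiple of `⊤` is `⊤`, so a
single run that has not halted would make the expectation infinite. -/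
theorem halted_of_expect_ne_top (T : ℕ) (c : Config) (F : Store → ℝ≥0∞)
    (h : expect w A T c F ≠ ⊤) : ∀ c' ∈ (runFrom w A T c).support, c'.Halted := by
  induction T generalizing c with
  | zero =>
    intro c' hc'
    simp only [runFrom, PMF.mem_support_pure_iff] at hc'
    subst hc'
    by_contra hn
    exact h (by simp only [expect]; exact if_neg hn)
  | succ T ih =>
    intro c' hc'
    simp only [runFrom, PMF.mem_support_bind_iff] at hc'
    obtain ⟨d, hd, hc'⟩ := hc'
    refine ih d ?_ c' hc'
    intro ht
    refine h (top_le_iff.1 ?_)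
    rw [expect]
    refine le_trans ?_ (ENNReal.le_tsum d)
    rw [ht, ENNReal.mul_top ((PMF.mem_support_iff _ _).1 hd)]

/-- Markov's inequality: the penalty is at least 1 on every failure, including configurations that
have not halted, where it is `⊤`. -/
theorem toOuterMeasure_runFrom_le (T : ℕ) (c : Config) (S : Set ℤ) (F : Store → ℝ≥0∞)
    (hF : ∀ s : Store, s.reg 0 ∉ S → 1 ≤ F s) :
    (runFrom w A T c).toOuterMeasure {c | c.Halted ∧ c.output ∈ S}ᶜ ≤ expect w A T c F := by
  classical
  induction T generalizing c with
  | zero =>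
    rw [runFrom, PMF.toOuterMeasure_pure_apply, expect]
    split_ifs with h1 h2
    · refine hF _ fun h => h1 ⟨h2, h⟩
    · simp
    · simp
    · simp
  | succ T ih =>
    rw [runFrom, PMF.toOuterMeasure_bind_apply, expect]
    exact ENNReal.tsum_le_tsum fun c' => by gcongr; exact ih c'

theorem outputProb_ge (p : Prog) (T : ℕ) (S : Set ℤ) (F : Store → ℝ≥0∞) (δ : ℝ≥0∞)
    (hF : ∀ s : Store, s.reg 0 ∉ S → 1 ≤ F s) (h : expect w A T (initial p n) F ≤ δ) :
    1 - δ ≤ outputProb p w A T S := by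
  rw [tsub_le_iff_right]
  have h1 := (toOuterMeasure_runFrom_le w A T (initial p n) S F hF).trans h
  refine le_trans ?_ (add_le_add le_rfl h1)
  have h2 : (runFrom w A T (initial p n)).toOuterMeasure Set.univ = 1 := by
    rw [PMF.toOuterMeasure_apply_eq_one_iff]
    exact Set.subset_univ _
  rw [← h2, outputProb, run, ← Set.union_compl_self {c : Config | c.Halted ∧ c.output ∈ S}]
  exact MeasureTheory.measure_union_le _ _

/-- The program `p` deterministically takes the store `σ` to `σ'` in at most `T` steps. -/
def Leads (p : Prog) (σ σ' : Store) (T : ℕ) : Prop :=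
  ∀ k T' F, expect w A (T + T') ⟨p :: k, σ⟩ F ≤ expect w A T' ⟨k, σ'⟩ F

variable {w A}

theorem Leads.seq {p q : Prog} {σ σ' σ'' : Store} {T T' : ℕ} (hp : Leads w A p σ σ' T)
    (hq : Leads w A q σ' σ'' T') : Leads w A (.seq p q) σ σ'' (T + T' + 1) := by
  intro k t F
  rw [show T + T' + 1 + t = (T + (T' + t)) + 1 by ring, expect, step, tsum_pure_mul]
  exact (hp _ _ _).trans (hq _ _ _)

theorem Leads.instr {i : Instr} {σ σ' : Store} (h : exec w A σ i = PMF.pure σ') :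
    Leads w A (.instr i) σ σ' 1 := by
  intro k t F
  rw [add_comm, expect, step, h, tsum_map_mul, tsum_pure_mul]

end Expect

/-! ## Word bounds -/

/-- The number of non-negative words. -/
def wmax (w : ℕ) : ℤ := 2 ^ (w - 1)

theorem wrap_eq {w : ℕ} (hw : 1 ≤ w) {x : ℤ} (h1 : -wmax w ≤ x) (h2 : x < wmax w) :
    wrap w x = x := by
  have h : (2 : ℕ) ^ w = 2 * 2 ^ (w - 1) := by
    rw [← pow_succ', Nat.sub_add_cancel hw]
  unfold wrap wmax at *
  have h3 : ((2 ^ (w - 1) : ℕ) : ℤ) = 2 ^ (w - 1) := by push_cast; rfl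
  apply Int.bmod_eq_of_le_mul_two <;> rw [h] <;> push_cast <;> linarith

/-! ## Expressions -/

inductive Expr
  | rg (r : ℕ)
  | ct (v : ℤ)
  | op (o : Arith) (a b : Expr)

namespace Expr

instance : Add Expr := ⟨op .plus⟩
instance : Sub Expr := ⟨op .minus⟩
instance : Mul Expr := ⟨op .times⟩
instance : Div Expr := ⟨op .quot⟩

end Expr

/-- A store seen as registers together with sixteen interleaved arrays; the registers from `100`
on hold intermediate results and are not part of the view. -/
@[ext] structure St where
  reg : ℕ → ℤ
  arr : ℕ → ℕ → ℤ

namespace St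

def setReg (s : St) (d : ℕ) (v : ℤ) : St := { s with reg := Function.update s.reg d v }

def setArr (s : St) (c t : ℕ) (v : ℤ) : St :=
  { s with arr := Function.update s.arr c (Function.update (s.arr c) t v) }

theorem setReg_reg (s : St) (d : ℕ) (v : ℤ) (r : ℕ) :
    (s.setReg d v).reg r = if r = d then v else s.reg r := by
  simp [setReg, Function.update_apply]

@[simp] theorem setReg_arr (s : St) (d : ℕ) (v : ℤ) : (s.setReg d v).arr = s.arr := rfl

@[simp] theorem setArr_reg (s : St) (c t : ℕ) (v : ℤ) : (s.setArr c t v).reg = s.reg := rfl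

theorem setArr_arr (s : St) (c t : ℕ) (v : ℤ) (c' : ℕ) :
    (s.setArr c t v).arr c' = if c' = c then Function.update (s.arr c) t v else s.arr c' := by
  simp only [setArr, Function.update_apply]

end St

/-- Invisible parts are set to zero, so that stores which differ only in scratch registers have
equal views and evaluating an expression does not change the view. -/
def view (σ : Store) : St where
  reg r := if r < 100 then σ.reg r else 0
  arr c t := if c < 16 then σ.mem (16 * t + c) else 0

theorem view_reg {σ : Store} {r : ℕ} (h : r < 100) : (view σ).reg r = σ.reg r := if_pos h

theorem view_setReg (σ : Store) {d : ℕ} (hd : d < 100) (v : ℤ) :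
    view (σ.setReg d v) = (view σ).setReg d v := by
  ext r t
  · simp only [view, Store.setReg, St.setReg, Function.update_apply]
    split_ifs <;> first | rfl | omega
  · rfl

theorem view_setMem (σ : Store) {c : ℕ} (hc : c < 16) (t : ℕ) (v : ℤ) :
    view (σ.setMem (16 * t + c) v) = (view σ).setArr c t v := by
  ext r t'
  · rfl
  · simp only [view, Store.setMem, St.setArr, Function.update_apply]
    by_cases h : r = c
    · subst h
      simp only [hc, if_true, Function.update_apply]
      by_cases h' : t' = t
      · simp [h']
      · rw [if_neg (by omega), if_neg h']
    · simp only [h, if_false]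
      by_cases h' : r < 16
      · simp only [h', if_true]
        rw [if_neg (by omega)]
      · simp only [h', if_false]

theorem view_eq {σ σ' : Store} (hm : σ'.mem = σ.mem) (hr : ∀ r < 100, σ'.reg r = σ.reg r) :
    view σ' = view σ := by
  ext r t
  · simp only [view]
    split_ifs with h
    · exact hr r h
    · rfl
  · simp only [view, hm]

namespace Expr

def eval : Expr → St → ℤ
  | rg r, s => s.reg r
  | ct v, _ => v
  | op o a b, s => o.eval (a.eval s) (b.eval s)

/-- Only visible registers are read, and no intermediate result overflows. -/
def ok (w : ℕ) : Expr → St → Prop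
  | rg r, _ => r < 100
  | ct v, _ => -wmax w ≤ v ∧ v < wmax w
  | op o a b, s => a.ok w s ∧ b.ok w s ∧ -wmax w ≤ o.eval (a.eval s) (b.eval s) ∧
      o.eval (a.eval s) (b.eval s) < wmax w

/-- Counts steps: besides its operands an operation costs two sequencings and one instruction. -/
def size : Expr → ℕ
  | rg _ => 1
  | ct _ => 1
  | op _ a b => a.size + b.size + 3

/-- The scratch registers act as a stack: the value of `a` waits in `d` while `b` is evaluated in `d
+ 1` and beyond. -/
def compile : Expr → ℕ → Prog
  | rg r, d => .instr (.copy d r)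
  | ct v, d => .instr (.const d v)
  | op o a b, d => .seq (a.compile d) (.seq (b.compile (d + 1)) (.instr (.arith o d d (d + 1))))

section simps
variable (w : ℕ) (a b : Expr) (s : St) (r : ℕ) (v : ℤ)

@[simp] theorem eval_rg : (rg r).eval s = s.reg r := rfl
@[simp] theorem eval_ct : (ct v).eval s = v := rfl
@[simp] theorem eval_add : (a + b).eval s = a.eval s + b.eval s := rfl
@[simp] theorem eval_sub : (a - b).eval s = a.eval s - b.eval s := rfl
@[simp] theorem eval_mul : (a * b).eval s = a.eval s * b.eval s := rfl
@[simp] theorem eval_div : (a / b).eval s = a.eval s / b.eval s := rfl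

@[simp] theorem ok_rg : (rg r).ok w s ↔ r < 100 := Iff.rfl
@[simp] theorem ok_ct : (ct v).ok w s ↔ -wmax w ≤ v ∧ v < wmax w := Iff.rfl
@[simp] theorem ok_add : (a + b).ok w s ↔ a.ok w s ∧ b.ok w s ∧
    -wmax w ≤ a.eval s + b.eval s ∧ a.eval s + b.eval s < wmax w := Iff.rfl
@[simp] theorem ok_sub : (a - b).ok w s ↔ a.ok w s ∧ b.ok w s ∧
    -wmax w ≤ a.eval s - b.eval s ∧ a.eval s - b.eval s < wmax w := Iff.rfl
@[simp] theorem ok_mul : (a * b).ok w s ↔ a.ok w s ∧ b.ok w s ∧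
    -wmax w ≤ a.eval s * b.eval s ∧ a.eval s * b.eval s < wmax w := Iff.rfl
@[simp] theorem ok_div : (a / b).ok w s ↔ a.ok w s ∧ b.ok w s ∧
    -wmax w ≤ a.eval s / b.eval s ∧ a.eval s / b.eval s < wmax w := Iff.rfl

@[simp] theorem size_rg : (rg r).size = 1 := rfl
@[simp] theorem size_ct : (ct v).size = 1 := rfl
@[simp] theorem size_add : (a + b).size = a.size + b.size + 3 := rfl
@[simp] theorem size_sub : (a - b).size = a.size + b.size + 3 := rfl
@[simp] theorem size_mul : (a * b).size = a.size + b.size + 3 := rfl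
@[simp] theorem size_div : (a / b).size = a.size + b.size + 3 := rfl

end simps

variable {w n : ℕ} {A : Fin n → ℤ}

theorem compile_spec (hw : 1 ≤ w) (e : Expr) {d : ℕ} (hd : 100 ≤ d) (σ : Store)
    (h : e.ok w (view σ)) :
    ∃ σ', Leads w A (e.compile d) σ σ' e.size ∧ σ'.reg d = e.eval (view σ) ∧
      (∀ r < d, σ'.reg r = σ.reg r) ∧ σ'.mem = σ.mem := by
  induction e generalizing d σ with
  | rg r =>
    refine ⟨σ.setReg d (σ.reg r), Leads.instr rfl, ?_, ?_, rfl⟩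
    · simp [Store.setReg, view_reg (show r < 100 from h)]
    · intro r' hr'
      simp [Store.setReg, hr'.ne]
  | ct v =>
    refine ⟨σ.setReg d v, Leads.instr ?_, ?_, ?_, rfl⟩
    · simp only [exec, wrap_eq hw h.1 h.2]
    · simp [Store.setReg]
    · intro r' hr'
      simp [Store.setReg, hr'.ne]
  | op o a b iha ihb =>
    obtain ⟨ha, hb, h1, h2⟩ := h
    obtain ⟨σ₁, l₁, e₁, r₁, m₁⟩ := iha hd σ ha
    have v₁ : view σ₁ = view σ := view_eq m₁ fun r hr => r₁ r (by omega)
    obtain ⟨σ₂, l₂, e₂, r₂, m₂⟩ := ihb (d := d + 1) (by omega) σ₁ (by rwa [v₁])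
    rw [v₁] at e₂
    have e₃ : σ₂.reg d = a.eval (view σ) := by rw [r₂ d (by omega), e₁]
    refine ⟨σ₂.setReg d (o.eval (a.eval (view σ)) (b.eval (view σ))),
      (l₁.seq (l₂.seq (Leads.instr ?_))), ?_, ?_, ?_⟩
    · simp only [exec, e₂, e₃, wrap_eq hw h1 h2]
    · simp [Store.setReg, eval]
    · intro r hr
      simp [Store.setReg, hr.ne, r₂ r (by omega), r₁ r hr]
    · simp [Store.setReg, m₂, m₁]

end Expr

/-! ## Commands -/

/-- `d := e` -/
def asg (d : ℕ) (e : Expr) : Prog := .seq (e.compile 100) (.instr (.copy d 100))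
/-- `d := arr c [e]` -/
def lda (d c : ℕ) (e : Expr) : Prog :=
  .seq ((Expr.ct 16 * e + Expr.ct c).compile 100) (.instr (.load d 100))
/-- `arr c [e] := v` -/
def sta (c : ℕ) (e v : Expr) : Prog :=
  .seq ((Expr.ct 16 * e + Expr.ct c).compile 100) (.seq (v.compile 101) (.instr (.store 100 101)))
/-- `d := A[e]` -/
def inp (d : ℕ) (e : Expr) : Prog := .seq (e.compile 100) (.instr (.input d 100))
/-- `d :=` a uniformly random element of `{0, …, e}` -/
def rnd (d : ℕ) (e : Expr) : Prog := .seq (e.compile 100) (.instr (.random d 100))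
def skip : Prog := .instr (.copy 100 100)
/-- if `e < e'` then `p` else `q` -/
def ifL (e e' : Expr) (p q : Prog) : Prog :=
  .seq (e.compile 100) (.seq (e'.compile 101) (.ifLt 100 101 p q))
/-- for `i` from `0` below the value of register `b` do `p` -/
def forL (i b : ℕ) (p : Prog) : Prog :=
  .seq (asg i (.ct 0)) (.whileLt i b (.seq p (asg i (.rg i + .ct 1))))

infixr:60 " ;; " => Prog.seq

/-! ### A program logic for expected penalties -/

section Logic

variable (w : ℕ) {n : ℕ} (A : Fin n → ℤ)

/-- Started with view `s`, the program `p` halts within `T` steps, and the expected value of `G` at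
the resulting view is at most `r`. -/
def ExpLe (p : Prog) (s : St) (T : ℕ) (G : St → ℝ≥0∞) (r : ℝ≥0∞) : Prop :=
  ∀ σ, view σ = s → ∀ k T' F, (∀ σ', expect w A T' ⟨k, σ'⟩ F ≤ G (view σ')) →
    expect w A (T + T') ⟨p :: k, σ⟩ F ≤ r

open Classical in
/-- Started with view `s`, the program `p` halts within `T` steps with a view satisfying `Q`,
whatever the random choices. -/
def Run (p : Prog) (s : St) (T : ℕ) (Q : St → Prop) : Prop :=
  ∀ r, ExpLe w A p s T (fun s' => if Q s' then r else ⊤) r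

variable {w A}

theorem ExpLe.weaken {p : Prog} {s : St} {T T' : ℕ} {G G' : St → ℝ≥0∞} {r r' : ℝ≥0∞}
    (h : ExpLe w A p s T G r) (hT : T ≤ T') (hG : ∀ s', G' s' ≤ G s' ∨ r' = ⊤) (hr : r ≤ r') :
    ExpLe w A p s T' G' r' := by
  intro σ hσ k t F hF
  by_cases ht : r' = ⊤
  · simp [ht]
  · refine le_trans (expect_anti w A (by omega) _ _) ((h σ hσ k t F fun σ' => ?_).trans hr)
    exact (hF σ').trans ((hG _).resolve_right ht)

theorem ExpLe.top {p : Prog} {s : St} {T : ℕ} {G : St → ℝ≥0∞} : ExpLe w A p s T G ⊤ :=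
  fun _ _ _ _ _ _ => le_top

/-- `ExpLe` quantifies over all continuations, so `q` followed by the rest can serve as the
continuation of `p`, and the guarantee for `q` is the bound that `p` needs there. -/
theorem ExpLe.seq {p q : Prog} {s : St} {T T' : ℕ} {G H : St → ℝ≥0∞} {r : ℝ≥0∞}
    (hp : ExpLe w A p s T H r) (hq : ∀ s', ExpLe w A q s' T' G (H s')) :
    ExpLe w A (p ;; q) s (T + T' + 1) G r := by
  intro σ hσ k t F hF
  rw [show T + T' + 1 + t = (T + (T' + t)) + 1 by ring, expect, step, tsum_pure_mul]
  exact hp σ hσ _ _ _ fun σ' => hq _ σ' rfl _ _ _ hF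

theorem ExpLe.of_leads {p : Prog} {s s' : St} {T : ℕ} {G : St → ℝ≥0∞}
    (h : ∀ σ, view σ = s → ∃ σ', Leads w A p σ σ' T ∧ view σ' = s') :
    ExpLe w A p s T G (G s') := by
  intro σ hσ k t F hF
  obtain ⟨σ', hl, hv⟩ := h σ hσ
  exact (hl k t F).trans (hv ▸ hF σ')

theorem Run.weaken {p : Prog} {s : St} {T T' : ℕ} {Q Q' : St → Prop}
    (h : Run w A p s T Q) (hT : T ≤ T') (hQ : ∀ s', Q s' → Q' s') : Run w A p s T' Q' := by
  intro r
  refine (h r).weaken hT (fun s' => ?_) le_rfl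
  left
  by_cases h1 : Q s'
  · simp [h1, hQ s' h1]
  · simp [h1]

theorem Run.time {p : Prog} {s : St} {T T' : ℕ} {Q : St → Prop}
    (h : Run w A p s T Q) (hT : T ≤ T') : Run w A p s T' Q := h.weaken hT fun _ => id

theorem Run.post {p : Prog} {s : St} {T : ℕ} {Q Q' : St → Prop}
    (h : Run w A p s T Q) (hQ : ∀ s', Q s' → Q' s') : Run w A p s T Q' := h.weaken le_rfl hQ

theorem Run.expLe {p : Prog} {s : St} {T : ℕ} {Q : St → Prop} (h : Run w A p s T Q)
    {G : St → ℝ≥0∞} {r : ℝ≥0∞} (hG : ∀ s', Q s' → G s' ≤ r) : ExpLe w A p s T G r := by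
  refine (h r).weaken le_rfl (fun s' => ?_) le_rfl
  left
  by_cases h1 : Q s'
  · simp [h1, hG s' h1]
  · simp [h1]

theorem Run.of_leads {p : Prog} {s s' : St} {T : ℕ} {Q : St → Prop}
    (h : ∀ σ, view σ = s → ∃ σ', Leads w A p σ σ' T ∧ view σ' = s') (hQ : Q s') :
    Run w A p s T Q := by
  intro r
  have := ExpLe.of_leads (G := fun s' => open Classical in if Q s' then r else ⊤) h
  rwa [if_pos hQ] at this

theorem Run.seq {p q : Prog} {s : St} {T T' : ℕ} {Q : St → Prop}
    (h : Run w A p s T fun s' => Run w A q s' T' Q) : Run w A (p ;; q) s (T + T' + 1) Q := by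
  intro r
  refine ExpLe.seq (h r) fun s' => ?_
  dsimp only
  split_ifs with h1
  · exact h1 r
  · exact ExpLe.top

theorem ExpLe.run_seq {p q : Prog} {s : St} {T T' : ℕ} {G : St → ℝ≥0∞} {r : ℝ≥0∞}
    (h : Run w A p s T fun s' => ExpLe w A q s' T' G r) : ExpLe w A (p ;; q) s (T + T' + 1) G r := by
  refine ExpLe.seq (h r) fun s' => ?_
  dsimp only
  split_ifs with h1
  · exact h1
  · exact ExpLe.top

theorem ExpLe.seq_run {p q : Prog} {s : St} {T T' : ℕ} {G H : St → ℝ≥0∞} {r : ℝ≥0∞}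
    (hp : ExpLe w A p s T H r)
    (hq : ∀ s', H s' ≠ ⊤ → Run w A q s' T' fun s'' => G s'' ≤ H s') :
    ExpLe w A (p ;; q) s (T + T' + 1) G r := by
  refine ExpLe.seq hp fun s' => ?_
  by_cases h : H s' = ⊤
  · rw [h]; exact ExpLe.top
  · exact (hq s' h).expLe fun _ => id

theorem Run.skip {s : St} {Q : St → Prop} (h : Q s) : Run w A skip s 1 Q :=
  Run.of_leads (fun σ hσ => ⟨_, Leads.instr rfl, by
    rw [← hσ]; exact view_eq rfl fun r hr => by
      simp only [Store.setReg]; rw [Function.update_of_ne hr.ne]⟩) h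

theorem tsum_uniform_mul (m : ℕ) (h : ℕ → ℝ≥0∞) :
    ∑' a : ℕ, ((do
      let a ← PMF.uniformOfFintype (Fin (m + 1))
      pure (a : ℕ)) : PMF ℕ) a * h a = (∑ v ∈ Finset.range (m + 1), h v) / ((m + 1 : ℕ) : ℝ≥0∞) := by
  have := tsum_map_mul (PMF.uniformOfFintype (Fin (m + 1))) (fun v => (v : ℕ)) h
  refine (Eq.trans ?_ this).trans ?_
  · rfl
  · rw [tsum_fintype]
    simp only [PMF.uniformOfFintype_apply, Fintype.card_fin]
    rw [← Finset.mul_sum, mul_comm, ← div_eq_mul_inv, Finset.sum_range]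

variable (hw : 1 ≤ w)
include hw

theorem Run.asg {d : ℕ} {e : Expr} {s : St} {Q : St → Prop} (h : e.ok w s) (hd : d < 100)
    (hQ : Q (s.setReg d (e.eval s))) : Run w A (asg d e) s (e.size + 2) Q := by
  refine Run.of_leads (fun σ hσ => ?_) hQ
  subst hσ
  obtain ⟨σ₁, l₁, e₁, r₁, m₁⟩ := e.compile_spec (A := A) hw le_rfl σ h
  refine ⟨_, l₁.seq (Leads.instr rfl), ?_⟩
  rw [view_setReg _ hd, e₁, view_eq m₁ r₁]

theorem Run.lda {d c : ℕ} {e : Expr} {s : St} {Q : St → Prop} (t : ℕ) (ht : e.eval s = t)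
    (hc : c < 16) (h : e.ok w s) (hw' : 16 * (t : ℤ) + 16 < wmax w) (hd : d < 100)
    (hQ : Q (s.setReg d (s.arr c t))) : Run w A (lda d c e) s (e.size + 10) Q := by
  refine Run.of_leads (fun σ hσ => ?_) hQ
  subst hσ
  obtain ⟨σ₁, l₁, e₁, r₁, m₁⟩ := (Expr.ct 16 * e + Expr.ct c).compile_spec (A := A) hw le_rfl σ
    (by simp [ht, h]; omega)
  have l := l₁.seq (Leads.instr (A := A) (w := w) (i := .load d 100) (σ := σ₁) rfl)
  refine ⟨_, fun k T' F => (expect_anti w A ?_ _ _).trans (l k T' F), ?_⟩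
  · simp; omega
  · rw [view_setReg _ hd, e₁, view_eq m₁ r₁]
    congr 1
    rw [m₁]
    simp [ht]
    simp [view, hc]

theorem Run.sta {c : ℕ} {e v : Expr} {s : St} {Q : St → Prop} (t : ℕ) (ht : e.eval s = t)
    (hc : c < 16) (h : e.ok w s) (hw' : 16 * (t : ℤ) + 16 < wmax w) (hv : v.ok w s)
    (hQ : Q (s.setArr c t (v.eval s))) : Run w A (sta c e v) s (e.size + v.size + 11) Q := by
  refine Run.of_leads (fun σ hσ => ?_) hQ
  subst hσ
  obtain ⟨σ₁, l₁, e₁, r₁, m₁⟩ := (Expr.ct 16 * e + Expr.ct c).compile_spec (A := A) hw le_rfl σ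
    (by simp [ht, h]; omega)
  have v₁ : view σ₁ = view σ := view_eq m₁ r₁
  obtain ⟨σ₂, l₂, e₂, r₂, m₂⟩ := v.compile_spec (A := A) hw (show 100 ≤ 101 by norm_num) σ₁
    (by rwa [v₁])
  have v₂ : view σ₂ = view σ := by rw [← v₁]; exact view_eq m₂ fun r hr => r₂ r (by omega)
  have l := l₁.seq (l₂.seq (Leads.instr (A := A) (w := w) (i := .store 100 101) (σ := σ₂) rfl))
  refine ⟨σ₂.setMem (16 * t + c) (v.eval (view σ)), fun k T' F => ?_, ?_⟩
  · refine le_trans (expect_anti w A ?_ _ _) (le_trans (l k T' F) (le_of_eq ?_))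
    · simp; omega
    · rw [e₂, r₂ 100 (by norm_num), e₁, v₁]; simp [ht]
  · rw [view_setMem _ hc, v₂]

theorem Run.inp {d : ℕ} {e : Expr} {s : St} {Q : St → Prop} (h : e.ok w s) (hd : d < 100)
    (hQ : Q (s.setReg d (entry A (e.eval s)))) : Run w A (inp d e) s (e.size + 2) Q := by
  refine Run.of_leads (fun σ hσ => ?_) hQ
  subst hσ
  obtain ⟨σ₁, l₁, e₁, r₁, m₁⟩ := e.compile_spec (A := A) hw le_rfl σ h
  refine ⟨_, l₁.seq (Leads.instr rfl), ?_⟩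
  rw [view_setReg _ hd, e₁, view_eq m₁ r₁]

theorem ExpLe.rnd {d : ℕ} {e : Expr} {s : St} {G : St → ℝ≥0∞} (m : ℕ) (hm : e.eval s = m)
    (h : e.ok w s) (hd : d < 100) :
    ExpLe w A (rnd d e) s (e.size + 2) G
      ((∑ v ∈ Finset.range (m + 1), G (s.setReg d v)) / ((m + 1 : ℕ) : ℝ≥0∞)) := by
  intro σ hσ k t F hF
  subst hσ
  obtain ⟨σ₁, l₁, e₁, r₁, m₁⟩ := e.compile_spec (A := A) hw le_rfl σ h
  rw [WordRAM.rnd, show e.size + 2 + t = (e.size + (1 + t)) + 1 by ring, expect, step,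
    tsum_pure_mul]
  refine (l₁ _ _ _).trans ?_
  have h1 : (σ₁.reg 100).toNat = m := by rw [e₁, hm]; simp
  rw [add_comm 1 t, expect, step, tsum_map_mul, exec, tsum_map_mul]
  refine (tsum_uniform_mul _ _).le.trans ?_
  rw [h1]
  gcongr with v
  refine (hF _).trans (le_of_eq ?_)
  rw [view_setReg _ hd, view_eq m₁ r₁]

theorem ExpLe.ifL {e e' : Expr} {p q : Prog} {s : St} {T T' : ℕ} {G : St → ℝ≥0∞} {r : ℝ≥0∞}
    (h : e.ok w s) (h' : e'.ok w s) (hp : e.eval s < e'.eval s → ExpLe w A p s T G r)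
    (hq : e'.eval s ≤ e.eval s → ExpLe w A q s T' G r) :
    ExpLe w A (ifL e e' p q) s (e.size + e'.size + 3 + T + T') G r := by
  intro σ hσ k t F hF
  subst hσ
  obtain ⟨σ₁, l₁, e₁, r₁, m₁⟩ := e.compile_spec (A := A) hw le_rfl σ h
  have v₁ : view σ₁ = view σ := view_eq m₁ r₁
  obtain ⟨σ₂, l₂, e₂, r₂, m₂⟩ := e'.compile_spec (A := A) hw (show 100 ≤ 101 by norm_num) σ₁
    (by rwa [v₁])
  have v₂ : view σ₂ = view σ := by rw [← v₁]; exact view_eq m₂ fun r hr => r₂ r (by omega)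
  rw [WordRAM.ifL, show e.size + e'.size + 3 + T + T' + t =
    (e.size + ((e'.size + ((T + T' + t) + 1)) + 1)) + 1 by ring, expect, step, tsum_pure_mul]
  refine (l₁ _ _ _).trans ?_
  rw [expect, step, tsum_pure_mul]
  refine (l₂ _ _ _).trans ?_
  rw [expect, step, tsum_pure_mul, r₂ 100 (by norm_num), e₁, e₂, v₁]
  split_ifs with hlt
  · exact (expect_anti w A (by omega) _ _).trans (hp hlt σ₂ v₂ k t F hF)
  · exact (expect_anti w A (by omega) _ _).trans (hq (not_lt.1 hlt) σ₂ v₂ k t F hF)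

theorem Run.ifL {e e' : Expr} {p q : Prog} {s : St} {T T' : ℕ} {Q : St → Prop}
    (h : e.ok w s) (h' : e'.ok w s) (hp : e.eval s < e'.eval s → Run w A p s T Q)
    (hq : e'.eval s ≤ e.eval s → Run w A q s T' Q) :
    Run w A (ifL e e' p q) s (e.size + e'.size + 3 + T + T') Q :=
  fun r => ExpLe.ifL hw h h' (fun hl => hp hl r) (fun hl => hq hl r)

omit hw in
-- `Φ j` is the potential before iteration `j` of exactly `J`. The value `⊤` stands for a violated
-- invariant, so nothing has to be shown for such states.
theorem ExpLe.whileLt {a b : ℕ} {p : Prog} (ha : a < 100) (hb : b < 100) (J Tb : ℕ)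
    (Φ : ℕ → St → ℝ≥0∞)
    (hstep : ∀ j < J, ∀ s, Φ j s ≠ ⊤ →
      s.reg a < s.reg b ∧ ExpLe w A p s Tb (Φ (j + 1)) (Φ j s))
    (hend : ∀ s, Φ J s ≠ ⊤ → s.reg b ≤ s.reg a) (s : St) :
    ExpLe w A (.whileLt a b p) s (J * (Tb + 1) + 1) (Φ J) (Φ 0 s) := by
  suffices h : ∀ m j, j + m = J → ∀ s,
      ExpLe w A (.whileLt a b p) s (m * (Tb + 1) + 1) (Φ J) (Φ j s) from h J 0 (zero_add J) s
  intro m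
  induction m with
  | zero =>
    intro j hj s σ hσ k t F hF
    subst hσ
    obtain rfl : j = J := by simpa using hj
    by_cases ht : Φ j (view σ) = ⊤
    · simp [ht]
    have h1 := hend _ ht
    rw [view_reg ha, view_reg hb] at h1
    rw [show 0 * (Tb + 1) + 1 + t = t + 1 by ring, expect, step, tsum_pure_mul, if_neg h1.not_gt]
    exact hF σ
  | succ m ih =>
    intro j hj s σ hσ k t F hF
    subst hσ
    by_cases ht : Φ j (view σ) = ⊤
    · simp [ht]
    obtain ⟨h1, h2⟩ := hstep j (by omega) _ ht
    rw [view_reg ha, view_reg hb] at h1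
    rw [show (m + 1) * (Tb + 1) + 1 + t = (Tb + ((m * (Tb + 1) + 1) + t)) + 1 by ring, expect, step,
      tsum_pure_mul, if_pos h1]
    exact h2 σ rfl _ _ _ fun σ' => ih (j + 1) (by omega) _ σ' rfl _ _ _ hF

omit hw in
theorem Run.whileLt {a b : ℕ} {p : Prog} (ha : a < 100) (hb : b < 100) (J Tb : ℕ)
    (I : ℕ → St → Prop)
    (hstep : ∀ j < J, ∀ s, I j s → s.reg a < s.reg b ∧ Run w A p s Tb (I (j + 1)))
    (hend : ∀ s, I J s → s.reg b ≤ s.reg a) {s : St} (h0 : I 0 s) :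
    Run w A (.whileLt a b p) s (J * (Tb + 1) + 1) (I J) := by
  intro r
  have := ExpLe.whileLt (w := w) (A := A) (p := p) ha hb J Tb
    (fun j s => open Classical in if I j s then r else ⊤) (fun j hj s hs => ?_) (fun s hs => ?_) s
  · rwa [if_pos h0] at this
  · split_ifs at hs with h
    · rw [if_pos h]
      exact ⟨(hstep j hj s h).1, (hstep j hj s h).2 r⟩
    · simp at hs
  · split_ifs at hs with h
    · exact hend s h
    · simp at hs

omit hw in
-- For loops with an upper bound only on the number of iterations: the index of the invariant is a
-- variant which decreases each time.
theorem Run.whileLt_le {a b : ℕ} {p : Prog} (ha : a < 100) (hb : b < 100) (Tb : ℕ)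
    (I : ℕ → St → Prop)
    (hstep : ∀ m s, I (m + 1) s → s.reg a < s.reg b → Run w A p s Tb (I m))
    (hend : ∀ s, I 0 s → s.reg b ≤ s.reg a) (m : ℕ) {s : St} (h0 : I m s) :
    Run w A (.whileLt a b p) s (m * (Tb + 1) + 1) fun s' => s'.reg b ≤ s'.reg a ∧ ∃ m, I m s' := by
  induction m generalizing s with
  | zero =>
    intro r σ hσ k t F hF
    subst hσ
    have h1 := hend _ h0
    have h2 := h1
    rw [view_reg ha, view_reg hb] at h2
    rw [show 0 * (Tb + 1) + 1 + t = t + 1 by ring, expect, step, tsum_pure_mul, if_neg h2.not_gt]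
    refine (hF σ).trans ?_
    exact (if_pos ⟨h1, _, h0⟩).le
  | succ m ih =>
    intro r σ hσ k t F hF
    subst hσ
    rw [show (m + 1) * (Tb + 1) + 1 + t = (Tb + ((m * (Tb + 1) + 1) + t)) + 1 by ring, expect, step,
      tsum_pure_mul]
    split_ifs with h1
    · rw [← view_reg ha, ← view_reg hb] at h1
      refine (hstep m _ h0 h1) r σ rfl _ _ _ fun σ' => ?_
      dsimp only
      split_ifs with h2
      · exact ih h2 r σ' rfl _ _ _ hF
      · exact le_top
    · rw [← view_reg ha, ← view_reg hb] at h1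
      refine (expect_anti w A (by omega) _ _).trans ((hF σ).trans ?_)
      exact (if_pos ⟨not_lt.1 h1, _, h0⟩).le

/-- The body must leave counter and bound as they are. The increment follows it, which is why the
next potential is taken at the state with the counter set to `j + 1`. -/
theorem ExpLe.forL {i b : ℕ} {p : Prog} (hi : i < 100) (hb : b < 100) (J Tb : ℕ)
    (hJ : (J : ℤ) < wmax w) (Φ : ℕ → St → ℝ≥0∞)
    (hstep : ∀ j < J, ∀ s, Φ j s ≠ ⊤ → s.reg i = j → s.reg b = J →
      ExpLe w A p s Tb (fun s' => open Classical in if s'.reg i = j ∧ s'.reg b = J then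
        Φ (j + 1) (s'.setReg i (j + 1 : ℕ)) else ⊤) (Φ j s))
    (s : St) (hs : s.reg b = J) (hib : i ≠ b) :
    ExpLe w A (forL i b p) s (J * (Tb + 9) + 5) (Φ J) (Φ 0 (s.setReg i 0)) := by
  have hw1 : 1 ≤ wmax w := by unfold wmax; exact one_le_pow₀ (by norm_num)
  classical
  have h := ExpLe.whileLt (w := w) (A := A) (p := p ;; WordRAM.asg i (.rg i + .ct 1)) hi hb J
    (Tb + 7 + 1) (fun j s => if s.reg i = j ∧ s.reg b = J then Φ j s else ⊤) ?_ ?_ (s.setReg i 0)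
  · refine ExpLe.weaken (G := Φ J) (r := Φ 0 (s.setReg i 0)) (ExpLe.run_seq
      (Run.asg hw (by simp; omega) hi ?_)) (T := 3 + (J * (Tb + 7 + 1 + 1) + 1) + 1) (by
        rw [show Tb + 7 + 1 + 1 = Tb + 9 by ring]; omega) (fun s' => Or.inl le_rfl) le_rfl
    refine h.weaken le_rfl (fun s' => Or.inl ?_) ?_
    · split_ifs
      · exact le_rfl
      · exact le_top
    · simp [St.setReg_reg, hib.symm, hs]
  · intro j hj s hs
    split_ifs at hs with h1
    · refine ⟨by rw [h1.1, h1.2]; exact_mod_cast hj, ?_⟩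
      rw [if_pos h1]
      refine ExpLe.weaken ((hstep j hj s hs h1.1 h1.2).seq_run (T' := 7) ?_) le_rfl
        (fun s' => Or.inl le_rfl) le_rfl
      intro s' hs'
      split_ifs at hs' with h2
      · refine Run.weaken (Run.asg hw (Q := fun s'' => s'' = s'.setReg i (j + 1 : ℕ)) ?_ hi ?_)
          (by simp) ?_
        · simp [h2.1]; omega
        · simp [h2.1]
        · rintro s'' rfl
          simp [St.setReg_reg, h2, hib.symm]
      · simp at hs'
    · simp at hs
  · intro s hs
    split_ifs at hs with h1
    · rw [h1.1, h1.2]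
    · simp at hs

theorem Run.forL {i b : ℕ} {p : Prog} (hi : i < 100) (hb : b < 100) (hib : i ≠ b) (J Tb : ℕ)
    (hJ : (J : ℤ) < wmax w) (I : ℕ → St → Prop)
    (hstep : ∀ j < J, ∀ s, I j s → s.reg i = j → s.reg b = J →
      Run w A p s Tb fun s' => s'.reg i = j ∧ s'.reg b = J ∧ I (j + 1) (s'.setReg i (j + 1 : ℕ)))
    {s : St} (hs : s.reg b = J) (h0 : I 0 (s.setReg i 0)) :
    Run w A (forL i b p) s (J * (Tb + 9) + 5) (I J) := by
  classical
  intro r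
  have := ExpLe.forL (A := A) (p := p) hw hi hb J Tb hJ
    (fun j s => if I j s then r else ⊤) (fun j hj s hs h1 h2 => ?_) s hs hib
  · rw [if_pos h0] at this
    exact this
  · split_ifs at hs with h
    · rw [if_pos h]
      refine (hstep j hj s h h1 h2).expLe ?_
      rintro s' ⟨h3, h4, h5⟩
      rw [if_pos ⟨h3, h4⟩, if_pos h5]
    · simp at hs

end Logic

end WordRAM

/-! ## Chains of items

An item `t` belongs to the group `t / k` and carries an interval `[l t, u t]`. -/

/-- Every item may be followed only by items of later groups with larger intervals; `r t` is
compatible with the length of a longest chain ending in `t`. -/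
structure RankRel (k : ℕ) (l u : ℕ → ℤ) (al : ℕ → Prop) (m : ℕ) (r : ℕ → ℕ) : Prop where
  pred : ∀ t < m, al t → 2 ≤ r t → ∃ t' < m, al t' ∧ t' / k < t / k ∧ u t' < l t ∧ r t' + 1 = r t
  mono : ∀ t < m, al t → ∀ t' < m, al t' → t' / k < t / k → u t' < l t → r t' < r t

/-- `f j` is the least right end of an item of rank `j`, for `1 ≤ j ≤ L`. -/
structure Ends (u : ℕ → ℤ) (al : ℕ → Prop) (m : ℕ) (r : ℕ → ℕ) (f : ℕ → ℤ) (L : ℕ) : Prop where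
  one_le : ∀ t < m, al t → 1 ≤ r t
  le_top : ∀ t < m, al t → r t ≤ L
  attained : ∀ j, 1 ≤ j → j ≤ L → ∃ t < m, al t ∧ r t = j ∧ u t = f j
  le : ∀ t < m, al t → f (r t) ≤ u t

/-- The rank `ρ` is the right one for an item with left end `a`. -/
structure Fits (f : ℕ → ℤ) (L : ℕ) (a : ℤ) (ρ : ℕ) : Prop where
  one_le : 1 ≤ ρ
  le : ρ ≤ L + 1
  lt : 2 ≤ ρ → f (ρ - 1) < a
  ge : ρ ≤ L → a ≤ f ρ

section
variable {k : ℕ} {l u : ℕ → ℤ} {al : ℕ → Prop} {m : ℕ} {r : ℕ → ℕ} {f : ℕ → ℤ} {L : ℕ}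

/-- An item of rank `i + 1` with the least right end has a predecessor of rank `i`, which ends
before the left end of that item. -/
theorem Ends.strictMono (hr : RankRel k l u al m r) (hf : Ends u al m r f L)
    (hlu : ∀ t < m, al t → l t ≤ u t) {i j : ℕ} (hi : 1 ≤ i) (hij : i < j) (hj : j ≤ L) :
    f i < f j := by
  induction j, hij using Nat.le_induction with
  | base =>
    obtain ⟨t, ht, hat, hrt, hut⟩ := hf.attained (i + 1) (by omega) hj
    obtain ⟨t', ht', hat', -, hlt, hrt'⟩ := hr.pred t ht hat (by omega)
    have h1 := hf.le t' ht' hat'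
    have h2 := hlu t ht hat
    rw [show r t' = i by omega] at h1
    change f i < f (i + 1)
    linarith
  | succ j hij ih =>
    refine (ih (by omega)).trans ?_
    obtain ⟨t, ht, hat, hrt, hut⟩ := hf.attained (j + 1) (by omega) hj
    have : i + 1 ≤ j := hij
    obtain ⟨t', ht', hat', -, hlt, hrt'⟩ := hr.pred t ht hat (by omega)
    have h1 := hf.le t' ht' hat'
    have h2 := hlu t ht hat
    rw [show r t' = j by omega] at h1
    linarith

/-- A whole group is ranked against the ends of the earlier groups alone. Items of one group impose
no condition on each other, so no end has to be updated in between, and monotonicity of `f` makes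
the rank that fits larger than the ranks of all possible predecessors. -/
theorem RankRel.extend {i : ℕ} (hk : 0 < k) (hr : RankRel k l u al (i * k) r)
    (hf : Ends u al (i * k) r f L) (hlu : ∀ t < i * k, al t → l t ≤ u t)
    (hn : ∀ t, i * k ≤ t → t < i * k + k → al t → Fits f L (l t) (r t)) :
    RankRel k l u al (i * k + k) r := by
  have hgrp : ∀ t, t < i * k → t / k < i := fun t ht => (Nat.div_lt_iff_lt_mul hk).2 ht
  have hgrp' : ∀ t, i * k ≤ t → t < i * k + k → t / k = i := fun t h1 h2 =>
    Nat.div_eq_of_lt_le h1 (by rw [add_mul, one_mul]; exact h2)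
  constructor
  · intro t ht hat h2
    rcases lt_or_ge t (i * k) with h | h
    · obtain ⟨t', h1, h2⟩ := hr.pred t h hat h2
      exact ⟨t', by omega, h2⟩
    · have hs := hn t h ht hat
      have := hs.le
      obtain ⟨t', h1, h3, h4, h5⟩ := hf.attained (r t - 1) (by omega) (by omega)
      refine ⟨t', by omega, h3, ?_, ?_, by omega⟩
      · rw [hgrp' t h ht]; exact hgrp t' h1
      · rw [h5]; exact hs.lt h2
  · intro t ht hat t' ht' hat' hg hlt
    rcases lt_or_ge t' (i * k) with h' | h'
    · rcases lt_or_ge t (i * k) with h | h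
      · exact hr.mono t h hat t' h' hat' hg hlt
      · have hs := hn t h ht hat
        by_contra! hle
        have h1 := hf.le t' h' hat'
        have h2 := hf.le_top t' h' hat'
        have h3 := hs.ge (by omega)
        rcases hle.eq_or_lt with h4 | h4
        · rw [← h4] at h1; linarith
        · have := hf.strictMono hr hlu hs.one_le h4 h2
          linarith
    · rw [hgrp' t' h' ht'] at hg
      rcases lt_or_ge t (i * k) with h | h
      · have := hgrp t h; omega
      · rw [hgrp' t h ht] at hg; omega

theorem Ends.skip (hf : Ends u al m r f L) (h : ¬al m) : Ends u al (m + 1) r f L := by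
  have key : ∀ t < m + 1, al t → t < m := fun t ht hat =>
    lt_of_le_of_ne (Nat.lt_succ_iff.1 ht) fun he => h (he ▸ hat)
  constructor
  · exact fun t ht hat => hf.one_le t (key t ht hat) hat
  · exact fun t ht hat => hf.le_top t (key t ht hat) hat
  · intro j h1 h2
    obtain ⟨t, ht, h3⟩ := hf.attained j h1 h2
    exact ⟨t, by omega, h3⟩
  · exact fun t ht hat => hf.le t (key t ht hat) hat

theorem Ends.keep (hf : Ends u al m r f L) (h1 : 1 ≤ r m) (h2 : r m ≤ L) (h : f (r m) ≤ u m) :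
    Ends u al (m + 1) r f L := by
  constructor
  · intro t ht hat
    rcases Nat.lt_succ_iff_lt_or_eq.1 ht with h' | rfl
    exacts [hf.one_le t h' hat, h1]
  · intro t ht hat
    rcases Nat.lt_succ_iff_lt_or_eq.1 ht with h' | rfl
    exacts [hf.le_top t h' hat, h2]
  · intro j h1 h2
    obtain ⟨t, ht, h3⟩ := hf.attained j h1 h2
    exact ⟨t, by omega, h3⟩
  · intro t ht hat
    rcases Nat.lt_succ_iff_lt_or_eq.1 ht with h' | rfl
    exacts [hf.le t h' hat, h]

theorem Ends.put (hf : Ends u al m r f L) (hm : al m) (h1 : 1 ≤ r m) (h2 : r m ≤ L + 1)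
    (h : r m ≤ L → u m < f (r m)) {L' : ℕ} (hL : L' = max L (r m)) :
    Ends u al (m + 1) r (Function.update f (r m) (u m)) L' := by
  constructor
  · intro t ht hat
    rcases Nat.lt_succ_iff_lt_or_eq.1 ht with h' | rfl
    exacts [hf.one_le t h' hat, h1]
  · intro t ht hat
    rcases Nat.lt_succ_iff_lt_or_eq.1 ht with h' | rfl
    · have := hf.le_top t h' hat; omega
    · omega
  · intro j h3 h4
    by_cases hj : j = r m
    · exact ⟨m, by omega, hm, hj.symm, by rw [hj, Function.update_self]⟩
    · obtain ⟨t, ht, h5⟩ := hf.attained j h3 (by omega)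
      rw [Function.update_of_ne hj]
      exact ⟨t, by omega, h5⟩
  · intro t ht hat
    rcases Nat.lt_succ_iff_lt_or_eq.1 ht with h' | rfl
    · by_cases hj : r t = r m
      · rw [hj, Function.update_self]
        have h3 := hf.le t h' hat
        have h4 := hf.le_top t h' hat
        rw [hj] at h3 h4
        exact (h h4).le.trans h3
      · rw [Function.update_of_ne hj]
        exact hf.le t h' hat
    · rw [Function.update_self]

theorem RankRel.congr {r' : ℕ → ℕ} (hr : RankRel k l u al m r) (h : ∀ t < m, r' t = r t) :
    RankRel k l u al m r' := by
  constructor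
  · intro t ht hat h2
    obtain ⟨t', h3, h4, h5, h6, h7⟩ := hr.pred t ht hat (by rwa [← h t ht])
    exact ⟨t', h3, h4, h5, h6, by rw [h t ht, h t' h3, h7]⟩
  · intro t ht hat t' ht' hat' h1 h2
    rw [h t ht, h t' ht']
    exact hr.mono t ht hat t' ht' hat' h1 h2

theorem Ends.congr {r' : ℕ → ℕ} (hf : Ends u al m r f L) (h : ∀ t < m, r' t = r t) :
    Ends u al m r' f L := by
  constructor
  · intro t ht hat; rw [h t ht]; exact hf.one_le t ht hat
  · intro t ht hat; rw [h t ht]; exact hf.le_top t ht hat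
  · intro j h1 h2
    obtain ⟨t, ht, h3, h4, h5⟩ := hf.attained j h1 h2
    exact ⟨t, ht, h3, by rw [h t ht, h4], h5⟩
  · intro t ht hat; rw [h t ht]; exact hf.le t ht hat

end

namespace WordRAM

open WordRAM.Expr

/-! ## Longest chains by patience sorting

The items are stored in the arrays `o` (left ends), `o + 1` (right ends) and `o + 2` (a positive
flag means that the item is to be ignored). Ranks are written to the array `o + 3`, and the array
`o + 4` holds the least right ends. Register `20` holds the number of groups, register `21` the size
of a group, and register `10` the length of a longest chain. -/

/-- Find the rank for the left end in register `5`, minus one. -/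
def search (o : ℕ) : Prog :=
  asg 1 (ct 0) ;; asg 2 (rg 10) ;; .whileLt 1 2 (
    asg 3 ((rg 1 + rg 2 + ct 1) / ct 2) ;; lda 4 (o + 4) (rg 3) ;;
    ifL (rg 4) (rg 5) (asg 1 (rg 3)) (asg 2 (rg 3 - ct 1)))

/-- Rank 0 marks ignored items; the others have positive ranks. -/
def rankItem (o : ℕ) : Prog :=
  asg 7 (rg 9 * rg 21 + rg 8) ;; lda 6 (o + 2) (rg 7) ;; lda 5 o (rg 7) ;;
  ifL (ct 0) (rg 6) (sta (o + 3) (rg 7) (ct 0)) (search o ;; sta (o + 3) (rg 7) (rg 1 + ct 1))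

def pileItem (o : ℕ) : Prog :=
  asg 7 (rg 9 * rg 21 + rg 8) ;; lda 6 (o + 3) (rg 7) ;; lda 5 (o + 1) (rg 7) ;;
  ifL (ct 0) (rg 6)
    (ifL (rg 10) (rg 6) (asg 10 (rg 6) ;; sta (o + 4) (rg 6) (rg 5))
      (lda 4 (o + 4) (rg 6) ;; ifL (rg 5) (rg 4) (sta (o + 4) (rg 6) (rg 5)) skip))
    skip

/-- Two passes over each group: if ends were updated during the ranking pass, items of the same
group could follow each other. -/
def patience (o : ℕ) : Prog :=
  asg 10 (ct 0) ;; forL 9 20 (forL 8 21 (rankItem o) ;; forL 8 21 (pileItem o))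

variable {w n : ℕ} {A : Fin n → ℤ}

theorem search_run (hw : 1 ≤ w) {o : ℕ} (ho : o ≤ 8) {s : St} {L b : ℕ} (hL : s.reg 10 = L)
    (hLb : L < 2 ^ b) (hLw : 16 * (L : ℤ) + 64 < wmax w) :
    Run w A (search o) s (b * 60 + 20) fun s' => s'.arr = s.arr ∧
      (∀ r, 5 ≤ r → s'.reg r = s.reg r) ∧
      ∃ v : ℕ, s'.reg 1 = v ∧ Fits (s.arr (o + 4)) L (s.reg 5) (v + 1) := by
  have h := Run.whileLt_le (w := w) (A := A) (a := 1) (b := 2) (p :=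
    asg 3 ((rg 1 + rg 2 + ct 1) / ct 2) ;; lda 4 (o + 4) (rg 3) ;;
    ifL (rg 4) (rg 5) (asg 1 (rg 3)) (asg 2 (rg 3 - ct 1))) (by norm_num) (by norm_num) 59
    (fun m s' => s'.arr = s.arr ∧ (∀ r, 5 ≤ r → s'.reg r = s.reg r) ∧ ∃ x y : ℕ,
      s'.reg 1 = x ∧ s'.reg 2 = y ∧ x ≤ y ∧ y ≤ L ∧ y - x < 2 ^ m ∧
      (1 ≤ x → s.arr (o + 4) x < s.reg 5) ∧ (y < L → s.reg 5 ≤ s.arr (o + 4) (y + 1)))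
    ?_ ?_ b (s := (s.setReg 1 0).setReg 2 ((s.setReg 1 0).reg 10)) ?_
  · refine Run.time (Run.seq (Run.asg hw (by simp; omega) (by norm_num) (Run.seq
      (Run.asg hw (by simp) (by norm_num) (h.post ?_))))) ?_
    · rintro s' ⟨h1, m, h2, h3, x, y, h4, h5, h6, h7, h8, h9, h10⟩
      have hxy : x = y := by omega
      subst hxy
      exact ⟨h2, h3, x, h4, by omega, by omega, fun _ => h9 (by omega), fun hx => h10 (by omega)⟩
    · simp; omega
  · rintro m s' ⟨h1, h2, x, y, h3, h4, h5, h6, h7, h8, h9⟩ hlt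
    have hxy : x < y := by omega
    -- Rounding the midpoint up gives `x < z ≤ y`, so both branches shrink the range, to at most
    -- half.
    obtain ⟨z, hz⟩ : ∃ z, z = (x + y + 1) / 2 := ⟨_, rfl⟩
    have hz' : ((x : ℤ) + y + 1) / 2 = z := by omega
    have hz1 : 1 ≤ z := by omega
    have hz2 : z - 1 + 1 = z := by omega
    have hp : 2 ^ (m + 1) = 2 * 2 ^ m := by ring
    refine Run.time (Run.seq (Run.asg hw ?_ (by norm_num) (Run.seq
      (Run.lda hw z ?_ (by omega) (by simp) (by omega) (by norm_num)
      (Run.ifL hw (by simp) (by simp)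
        (fun hc => Run.asg hw (by simp) (by norm_num) ?_)
        (fun hc => Run.asg hw ?_ (by norm_num) ?_)))))) ?_
    · simp [h3, h4]; omega
    · simp [St.setReg_reg, h3, h4, hz']
    · simp [St.setReg_reg, h3, h4, hz', h1, h2 5 le_rfl] at hc
      refine ⟨by simp [h1], fun r hr => ?_, z, y, by simp [St.setReg_reg, h3, h4, hz'],
        by simp [St.setReg_reg, h4], by omega, h6, by omega, fun _ => hc, h9⟩
      simp [St.setReg_reg, show r ≠ 1 by omega, show r ≠ 3 by omega, show r ≠ 4 by omega, h2 r hr]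
    · simp [St.setReg_reg, h3, h4, hz']; omega
    · simp [St.setReg_reg, h3, h4, hz', h1, h2 5 le_rfl] at hc
      refine ⟨by simp [h1], fun r hr => ?_, x, z - 1, by simp [St.setReg_reg, h3],
        by simp [St.setReg_reg, h3, h4, hz']; omega, by omega, by omega, by omega, h8,
        fun _ => by rwa [hz2]⟩
      simp [St.setReg_reg, show r ≠ 2 by omega, show r ≠ 3 by omega, show r ≠ 4 by omega, h2 r hr]
    · simp
  · rintro s' ⟨h1, h2, x, y, h3, h4, h5, h6, h7, h8, h9⟩
    rw [h3, h4]
    simp at h7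
    omega
  · refine ⟨rfl, fun r hr => ?_, 0, L, by simp [St.setReg_reg], by simp [St.setReg_reg, hL],
      by omega, le_rfl, by omega, by omega, by omega⟩
    simp [St.setReg_reg, show r ≠ 1 by omega, show r ≠ 2 by omega]

theorem rankItem_run (hw : 1 ≤ w) {o : ℕ} (ho : o ≤ 8) {s : St} {L b i j k : ℕ}
    (hL : s.reg 10 = L) (hLb : L < 2 ^ b) (hLw : 16 * (L : ℤ) + 64 < wmax w)
    (h9 : s.reg 9 = i) (h21 : s.reg 21 = k) (h8 : s.reg 8 = j)
    (ht : 16 * ((i * k + j : ℕ) : ℤ) + 64 < wmax w) :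
    Run w A (rankItem o) s (b * 60 + 100) fun s' => (∀ r, 8 ≤ r → s'.reg r = s.reg r) ∧
      ∃ v : ℕ, s'.arr = (s.setArr (o + 3) (i * k + j) v).arr ∧
        (0 < s.arr (o + 2) (i * k + j) → v = 0) ∧
        (¬0 < s.arr (o + 2) (i * k + j) → Fits (s.arr (o + 4)) L (s.arr o (i * k + j)) v) := by
  obtain ⟨t, rfl'⟩ : ∃ t, t = i * k + j := ⟨_, rfl⟩
  have hti : (i : ℤ) * k + j = t := by rw [rfl']; push_cast; ring
  rw [← rfl'] at ht ⊢
  have hik : (0 : ℤ) ≤ (i : ℤ) * k := by positivity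
  apply Run.time
  · apply Run.seq
    refine Run.asg hw (by simp [h9, h21, h8]; omega) (by norm_num) ?_
    apply Run.seq
    refine Run.lda hw t (by simp [St.setReg_reg, h9, h21, h8, hti]) (by omega) (by simp)
      (by omega) (by norm_num) ?_
    apply Run.seq
    refine Run.lda hw t (by simp [St.setReg_reg, h9, h21, h8, hti]) (by omega) (by simp)
      (by omega) (by norm_num) ?_
    apply Run.ifL hw
    · simp; omega
    · simp
    · intro hc
      refine Run.sta hw t (by simp [St.setReg_reg, h9, h21, h8, hti]) (by omega) (by simp)
        (by omega) (by simp; omega) ⟨fun r hr => ?_, 0, ?_, fun _ => rfl, ?_⟩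
      · simp [St.setReg_reg, show r ≠ 5 by omega, show r ≠ 6 by omega, show r ≠ 7 by omega]
      · simp [St.setArr]
      · simp [St.setReg_reg] at hc
        exact fun h => absurd hc h
    · intro hc
      apply Run.seq
      refine (search_run hw ho (L := L) (by simp [St.setReg_reg, hL]) hLb hLw).post ?_
      rintro s' ⟨h1, h2, v, h3, h4⟩
      simp [St.setReg_reg] at h1 h2 h4
      simp [St.setReg_reg] at hc
      refine Run.sta hw t (by simp [h9, h21, h8, hti, h2]) (by omega) (by simp)
        (by omega) ?_ ⟨fun r hr => ?_, v + 1, ?_, fun h => absurd h hc.not_gt, fun _ => h4⟩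
      · have := h4.le
        simp [h3]; omega
      · simp [h2 r (by omega), show r ≠ 5 by omega, show r ≠ 6 by omega, show r ≠ 7 by omega]
      · simp [St.setArr, h1, h3]
  · simp; omega

theorem pileItem_run (hw : 1 ≤ w) {o : ℕ} (ho : o ≤ 8) {s : St} {L i j k ρ : ℕ}
    (hL : s.reg 10 = L) (hLw : 16 * (L : ℤ) + 64 < wmax w)
    (h9 : s.reg 9 = i) (h21 : s.reg 21 = k) (h8 : s.reg 8 = j)
    (ht : 16 * ((i * k + j : ℕ) : ℤ) + 64 < wmax w)
    (hρ : s.arr (o + 3) (i * k + j) = ρ) (hρL : 16 * (ρ : ℤ) + 64 < wmax w) :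
    Run w A (pileItem o) s 200 fun s' => (∀ r, 8 ≤ r → r ≠ 10 → s'.reg r = s.reg r) ∧
      ∃ L' : ℕ, s'.reg 10 = L' ∧
        ((ρ = 0 ∧ s'.arr = s.arr ∧ L' = L) ∨
        (0 < ρ ∧ ρ ≤ L ∧ s.arr (o + 4) ρ ≤ s.arr (o + 1) (i * k + j) ∧ s'.arr = s.arr ∧ L' = L) ∨
        (0 < ρ ∧ (ρ ≤ L → s.arr (o + 1) (i * k + j) < s.arr (o + 4) ρ) ∧
          s'.arr = (s.setArr (o + 4) ρ (s.arr (o + 1) (i * k + j))).arr ∧ L' = max L ρ)) := by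
  obtain ⟨t, rfl'⟩ : ∃ t, t = i * k + j := ⟨_, rfl⟩
  have hti : (i : ℤ) * k + j = t := by rw [rfl']; push_cast; ring
  rw [← rfl'] at ht hρ ⊢
  have hik : (0 : ℤ) ≤ (i : ℤ) * k := by positivity
  apply Run.time
  · apply Run.seq
    refine Run.asg hw (by simp [h9, h21, h8]; omega) (by norm_num) ?_
    apply Run.seq
    refine Run.lda hw t (by simp [St.setReg_reg, h9, h21, h8, hti]) (by omega) (by simp)
      (by omega) (by norm_num) ?_
    apply Run.seq
    refine Run.lda hw t (by simp [St.setReg_reg, h9, h21, h8, hti]) (by omega) (by simp)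
      (by omega) (by norm_num) ?_
    apply Run.ifL hw
    · simp; omega
    · simp
    · intro hc
      apply Run.ifL hw
      · simp
      · simp
      · intro hc'
        simp [St.setReg_reg, hL, hρ] at hc hc'
        apply Run.seq
        refine Run.asg hw (by simp) (by norm_num) ?_
        refine Run.sta hw ρ (by simp [St.setReg_reg, hρ]) (by omega) (by simp) (by omega) (by simp)
          ⟨fun r hr hr' => ?_, ρ, ?_, .inr (.inr ⟨hc, by omega, ?_, by omega⟩)⟩
        · simp [St.setReg_reg, show r ≠ 5 by omega, show r ≠ 6 by omega, show r ≠ 7 by omega, hr']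
        · simp [St.setReg_reg, hρ]
        · simp [St.setArr, St.setReg_reg]
      · intro hc'
        simp [St.setReg_reg, hL, hρ] at hc hc'
        apply Run.seq
        refine Run.lda hw ρ (by simp [St.setReg_reg, hρ]) (by omega) (by simp) (by omega)
          (by norm_num) ?_
        apply Run.ifL hw
        · simp
        · simp
        · intro hc''
          refine Run.sta hw ρ (by simp [St.setReg_reg, hρ]) (by omega) (by simp) (by omega)
            (by simp) ⟨fun r hr hr' => ?_, L, ?_, .inr (.inr ⟨hc, ?_, ?_, by omega⟩)⟩
          · simp [St.setReg_reg, show r ≠ 4 by omega, show r ≠ 5 by omega, show r ≠ 6 by omega,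
              show r ≠ 7 by omega]
          · simp [St.setReg_reg, hL]
          · simp [St.setReg_reg] at hc''
            exact fun _ => hc''
          · simp [St.setArr, St.setReg_reg]
        · intro hc''
          refine Run.skip ⟨fun r hr hr' => ?_, L, ?_, .inr (.inl ⟨hc, hc', ?_, ?_, rfl⟩)⟩
          · simp [St.setReg_reg, show r ≠ 4 by omega, show r ≠ 5 by omega, show r ≠ 6 by omega,
              show r ≠ 7 by omega]
          · simp [St.setReg_reg, hL]
          · simpa [St.setReg_reg] using hc''
          · simp
    · intro hc
      simp [St.setReg_reg, hρ] at hc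
      refine Run.skip ⟨fun r hr hr' => ?_, L, ?_, .inl ⟨hc, ?_, rfl⟩⟩
      · simp [St.setReg_reg, show r ≠ 5 by omega, show r ≠ 6 by omega, show r ≠ 7 by omega]
      · simp [St.setReg_reg, hL]
      · simp
  · simp

variable {w n : ℕ} {A : Fin n → ℤ}

theorem rankGroup_run (hw : 1 ≤ w) {o : ℕ} (ho : o ≤ 8) {s : St} {L b i k : ℕ}
    (hL : s.reg 10 = L) (hLb : L < 2 ^ b) (hLw : 16 * (L : ℤ) + 64 < wmax w)
    (h9 : s.reg 9 = i) (h21 : s.reg 21 = k)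
    (ht : 16 * ((i * k + k : ℕ) : ℤ) + 64 < wmax w) :
    Run w A (forL 8 21 (rankItem o)) s (k * (b * 60 + 109) + 5) fun s' =>
      (∀ r, 9 ≤ r → s'.reg r = s.reg r) ∧ (∀ c, c ≠ o + 3 → s'.arr c = s.arr c) ∧
      (∀ t < i * k, s'.arr (o + 3) t = s.arr (o + 3) t) ∧
      ∀ t, i * k ≤ t → t < i * k + k → ∃ v : ℕ, s'.arr (o + 3) t = v ∧
        (0 < s.arr (o + 2) t → v = 0) ∧
        (¬0 < s.arr (o + 2) t → Fits (s.arr (o + 4)) L (s.arr o t) v) := by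
  have hk : (0 : ℤ) ≤ i * k := by positivity
  push_cast at ht
  refine Run.forL hw (by norm_num) (by norm_num) (by norm_num) k (b * 60 + 100) (by omega)
    (fun j s' => (∀ r, 9 ≤ r → s'.reg r = s.reg r) ∧ (∀ c, c ≠ o + 3 → s'.arr c = s.arr c) ∧
      (∀ t < i * k, s'.arr (o + 3) t = s.arr (o + 3) t) ∧
      ∀ t, i * k ≤ t → t < i * k + j → ∃ v : ℕ, s'.arr (o + 3) t = v ∧
        (0 < s.arr (o + 2) t → v = 0) ∧
        (¬0 < s.arr (o + 2) t → Fits (s.arr (o + 4)) L (s.arr o t) v)) ?_ h21 ?_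
  · rintro j hj s' ⟨h1, h2, h3, h4⟩ h8 h21'
    refine (rankItem_run hw ho (L := L) (b := b) (i := i) (j := j) (k := k)
      (by rw [h1 _ (by norm_num), hL]) hLb hLw (by rw [h1 _ (by norm_num), h9]) h21' h8
      (by push_cast; omega)).post ?_
    rintro s'' ⟨h5, v, h6, h7, h7'⟩
    refine ⟨by rw [h5 _ le_rfl, h8], by rw [h5 _ (by norm_num), h21'], fun r hr => ?_,
      fun c hc => ?_, fun t ht' => ?_, fun t ht1 ht2 => ?_⟩
    · rw [St.setReg_reg, if_neg (by omega), h5 r (by omega), h1 r hr]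
    · rw [St.setReg_arr, h6, St.setArr_arr, if_neg hc, h2 c hc]
    · rw [St.setReg_arr, h6, St.setArr_arr, if_pos rfl, Function.update_of_ne (by omega), h3 t ht']
    · rw [St.setReg_arr, h6, St.setArr_arr, if_pos rfl]
      by_cases h : t = i * k + j
      · subst h
        rw [h2 _ (by omega)] at h7 h7'
        rw [h2 _ (by omega), h2 _ (by omega)] at h7'
        exact ⟨v, by rw [Function.update_self], h7, h7'⟩
      · rw [Function.update_of_ne h]
        exact h4 t ht1 (by omega)
  · exact ⟨fun r hr => by rw [St.setReg_reg, if_neg (by omega)], fun _ _ => rfl, fun _ _ => rfl,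
      fun t h1 h2 => absurd h2 (by omega)⟩

theorem pileGroup_run (hw : 1 ≤ w) {o : ℕ} (ho : o ≤ 8) {s : St} {L i k : ℕ}
    (hL : s.reg 10 = L) (hLw : 16 * (L : ℤ) + 100 < wmax w)
    (h9 : s.reg 9 = i) (h21 : s.reg 21 = k)
    (ht : 16 * ((i * k + k : ℕ) : ℤ) + 64 < wmax w) (r : ℕ → ℕ)
    (hr : ∀ t, i * k ≤ t → t < i * k + k → s.arr (o + 3) t = r t ∧ r t ≤ L + 1 ∧
      (r t = 0 ↔ 0 < s.arr (o + 2) t))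
    (hE : Ends (s.arr (o + 1)) (fun t => ¬0 < s.arr (o + 2) t) (i * k) r (s.arr (o + 4)) L) :
    Run w A (forL 8 21 (pileItem o)) s (k * 209 + 5) fun s' =>
      (∀ r, 9 ≤ r → r ≠ 10 → s'.reg r = s.reg r) ∧ (∀ c, c ≠ o + 4 → s'.arr c = s.arr c) ∧
      ∃ L' : ℕ, s'.reg 10 = L' ∧ L' ≤ L + 1 ∧
        Ends (s.arr (o + 1)) (fun t => ¬0 < s.arr (o + 2) t) (i * k + k) r (s'.arr (o + 4)) L' := by
  have hk : (0 : ℤ) ≤ i * k := by positivity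
  push_cast at ht
  refine Run.post (Run.forL hw (by norm_num) (by norm_num) (by norm_num) k 200 (by omega)
    (fun j s' => (∀ r, 9 ≤ r → r ≠ 10 → s'.reg r = s.reg r) ∧
      (∀ c, c ≠ o + 4 → s'.arr c = s.arr c) ∧ ∃ L' : ℕ, s'.reg 10 = L' ∧ L ≤ L' ∧ L' ≤ L + 1 ∧
        Ends (s.arr (o + 1)) (fun t => ¬0 < s.arr (o + 2) t) (i * k + j) r (s'.arr (o + 4)) L')
      ?_ h21 ?_) ?_
  · rintro j hj s' ⟨h1, h2, L', h3, h4, h4', h5⟩ h8 h21'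
    obtain ⟨hr1, hr2, hr3⟩ := hr (i * k + j) (by omega) (by omega)
    refine (pileItem_run hw ho (L := L') (i := i) (j := j) (k := k) (ρ := r (i * k + j))
      h3 (by omega) (by rw [h1 _ (by norm_num) (by norm_num), h9]) h21' h8
      (by push_cast; omega) (by rw [h2 _ (by omega), hr1]) (by omega)).post ?_
    rintro s'' ⟨h6, L'', h7, h⟩
    refine ⟨by rw [h6 _ le_rfl (by norm_num), h8], by rw [h6 _ (by norm_num) (by norm_num), h21'],
      fun r hr hr' => ?_, fun c hc => ?_, L'', ?_⟩
    · rw [St.setReg_reg, if_neg (by omega), h6 r (by omega) hr', h1 r hr hr']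
    · rcases h with ⟨-, h, -⟩ | ⟨-, -, -, h, -⟩ | ⟨-, -, h, -⟩
      · rw [St.setReg_arr, h, h2 c hc]
      · rw [St.setReg_arr, h, h2 c hc]
      · rw [St.setReg_arr, h, St.setArr_arr, if_neg hc, h2 c hc]
    · refine ⟨by rw [St.setReg_reg, if_neg (by norm_num), h7], ?_⟩
      rw [St.setReg_arr]
      rw [h2 (o + 1) (by omega)] at h
      rcases h with ⟨h10, h11, h12⟩ | ⟨h10, h11, h12, h13, h14⟩ | ⟨h10, h11, h12, h13⟩
      · refine ⟨by omega, by omega, ?_⟩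
        rw [h11, h12]
        exact h5.skip (by rw [not_not, ← hr3, h10])
      · refine ⟨by omega, by omega, ?_⟩
        rw [h13, h14]
        exact h5.keep h10 h11 h12
      · refine ⟨by omega, by omega, ?_⟩
        rw [h12, St.setArr_arr, if_pos rfl]
        exact h5.put (by rw [← hr3]; omega) h10 (by omega) h11 h13
  · exact ⟨fun r hr hr' => by rw [St.setReg_reg, if_neg (by omega)], fun _ _ => rfl, L,
      by rw [St.setReg_reg, if_neg (by norm_num), hL], le_rfl, by omega, hE⟩
  · rintro s' ⟨h1, h2, L', h3, -, h4⟩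
    exact ⟨h1, h2, L', h3, h4⟩

theorem patience_run (hw : 1 ≤ w) {o : ℕ} (ho : o ≤ 8) {s : St} {N k b : ℕ}
    (h20 : s.reg 20 = N) (h21 : s.reg 21 = k) (hk : 0 < k) (hb : N * k < 2 ^ b)
    (hM : 16 * ((N * k : ℕ) : ℤ) + 200 < wmax w)
    (hlu : ∀ t < N * k, ¬0 < s.arr (o + 2) t → s.arr o t ≤ s.arr (o + 1) t) :
    Run w A (patience o) s (N * (k * (b * 60 + 318) + 30) + 10) fun s' =>
      (∀ r, 11 ≤ r → s'.reg r = s.reg r) ∧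
      (∀ c, c ≠ o + 3 → c ≠ o + 4 → s'.arr c = s.arr c) ∧
      ∃ (L : ℕ) (r : ℕ → ℕ), s'.reg 10 = L ∧ L ≤ N ∧ (∀ t < N * k, s'.arr (o + 3) t = r t ∧ (0 < s.arr (o + 2) t → r t = 0)) ∧
        RankRel k (s.arr o) (s.arr (o + 1)) (fun t => ¬0 < s.arr (o + 2) t) (N * k) r ∧
        Ends (s.arr (o + 1)) (fun t => ¬0 < s.arr (o + 2) t) (N * k) r (s'.arr (o + 4)) L := by
  have hNk : N ≤ N * k := Nat.le_mul_of_pos_right N hk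
  apply Run.time
  · apply Run.seq
    refine Run.asg hw (by simp; omega) (by norm_num) ?_
    refine Run.forL hw (by norm_num) (by norm_num) (by norm_num) N
      (k * (b * 60 + 109) + 5 + (k * 209 + 5) + 1) (by omega)
      (fun i s' => (∀ r, 11 ≤ r → s'.reg r = s.reg r) ∧
        (∀ c, c ≠ o + 3 → c ≠ o + 4 → s'.arr c = s.arr c) ∧
        ∃ (L : ℕ) (r : ℕ → ℕ), s'.reg 10 = L ∧ L ≤ i ∧ (∀ t < i * k, s'.arr (o + 3) t = r t ∧
          (0 < s.arr (o + 2) t → r t = 0)) ∧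
        RankRel k (s.arr o) (s.arr (o + 1)) (fun t => ¬0 < s.arr (o + 2) t) (i * k) r ∧
        Ends (s.arr (o + 1)) (fun t => ¬0 < s.arr (o + 2) t) (i * k) r (s'.arr (o + 4)) L)
      ?_ (by simp [St.setReg_reg, h20]) ?_
    · rintro i hi s₁ ⟨h1, h2, L, r, h3, h4, h5, h6, h7⟩ h9 h20'
      have hik : i * k + k ≤ N * k := by
        rw [← Nat.succ_mul]; exact Nat.mul_le_mul_right k hi
      apply Run.seq
      refine (rankGroup_run hw ho (L := L) (b := b) (i := i) (k := k) h3 (lt_of_le_of_lt (by omega) hb) (by omega) h9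
        (by rw [h1 _ (by norm_num), h21]) (by omega)).post ?_
      rintro s₂ ⟨a1, a2, a3, a4⟩
      rw [h2 o (by omega) (by omega), h2 (o + 2) (by omega) (by omega)] at a4
      have hr' : ∀ t < i * k, (s₂.arr (o + 3) t).toNat = r t := fun t ht => by
        rw [a3 t ht, (h5 t ht).1, Int.toNat_natCast]
      -- The new rank function is read off the array; it agrees with `r` on the earlier groups and
      -- extends it to group `i`.
      have hR := RankRel.extend (r := fun t => (s₂.arr (o + 3) t).toNat) hk (h6.congr hr')
        (h7.congr hr') (fun t ht hat => hlu t (by omega) hat) (fun t ht1 ht2 hat => by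
          obtain ⟨v, h10, -, h11⟩ := a4 t ht1 ht2
          rw [h10, Int.toNat_natCast]
          exact h11 hat)
      have e1 : s₂.arr (o + 1) = s.arr (o + 1) := by
        rw [a2 _ (by omega), h2 _ (by omega) (by omega)]
      have e2 : s₂.arr (o + 2) = s.arr (o + 2) := by
        rw [a2 _ (by omega), h2 _ (by omega) (by omega)]
      refine (pileGroup_run hw ho (L := L) (i := i) (k := k) (by rw [a1 _ (by norm_num), h3])
        (by omega) (by rw [a1 _ le_rfl, h9]) (by rw [a1 _ (by norm_num), h1 _ (by norm_num), h21])
        (by omega) (fun t => (s₂.arr (o + 3) t).toNat) (fun t ht1 ht2 => ?_) ?_).post ?_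
      · obtain ⟨v, h10, h11, h12⟩ := a4 t ht1 ht2
        rw [h10, Int.toNat_natCast, e2]
        by_cases h : 0 < s.arr (o + 2) t
        · simp [h11 h, h]
        · have := h12 h
          have h13 := this.one_le
          refine ⟨rfl, this.le, ?_⟩
          simp only [h, iff_false]
          omega
      · rw [e1, e2, a2 (o + 4) (by omega)]
        exact h7.congr hr'
      · rintro s₃ ⟨b1, b2, L', b3, b4, b5⟩
        refine ⟨by rw [b1 _ le_rfl (by norm_num), a1 _ le_rfl, h9],
          by rw [b1 _ (by norm_num) (by norm_num), a1 _ (by norm_num), h20'], fun r hr => ?_,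
          fun c hc hc' => ?_, L', fun t => (s₂.arr (o + 3) t).toNat, ?_, by omega, fun t ht => ?_,
          ?_, ?_⟩
        · rw [St.setReg_reg, if_neg (by omega), b1 _ (by omega) (by omega), a1 _ (by omega), h1 _ hr]
        · rw [St.setReg_arr, b2 _ hc', a2 _ hc, h2 _ hc hc']
        · rw [St.setReg_reg, if_neg (by norm_num), b3]
        · rw [Nat.succ_mul] at ht
          dsimp only
          rw [St.setReg_arr, b2 _ (by omega)]
          rcases lt_or_ge t (i * k) with h | h
          · rw [a3 t h, (h5 t h).1, Int.toNat_natCast]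
            exact ⟨rfl, (h5 t h).2⟩
          · obtain ⟨v, h10, h11, -⟩ := a4 t h ht
            rw [h10, Int.toNat_natCast]
            exact ⟨rfl, h11⟩
        · rw [Nat.succ_mul]; exact hR
        · rw [Nat.succ_mul, St.setReg_arr, ← e1, ← e2]; exact b5
    · refine ⟨fun r hr => by simp [St.setReg_reg, show r ≠ 9 by omega, show r ≠ 10 by omega],
        fun _ _ _ => rfl, 0, fun _ => 0, by simp [St.setReg_reg], le_rfl, ?_, ?_, ?_⟩
      · simp
      · constructor <;> simp
      · constructor <;> simp
        omega
  · have : k * (b * 60 + 318) = k * (b * 60 + 109) + k * 209 := by ring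
    simp only [size_ct]
    rw [show k * (b * 60 + 109) + 5 + (k * 209 + 5) + 1 + 9 = k * (b * 60 + 318) + 20 by omega]
    nlinarith

end WordRAM

/-- Any two distinct items of `P` belong to different groups, and the later one has the larger
interval. -/
def ItemChain (k : ℕ) (l u : ℕ → ℤ) (P : Finset ℕ) : Prop :=
  ∀ t ∈ P, ∀ t' ∈ P, t ≠ t' → (t / k < t' / k ∧ u t < l t') ∨ (t' / k < t / k ∧ u t' < l t)

section
variable {k : ℕ} {l u : ℕ → ℤ} {al : ℕ → Prop} {m : ℕ} {r : ℕ → ℕ} {f : ℕ → ℤ} {L : ℕ}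

/-- Ranks are distinct along a chain, and only `L` values are available. -/
theorem ItemChain.card_le (hr : RankRel k l u al m r) (hf : Ends u al m r f L) {P : Finset ℕ}
    (hP : ItemChain k l u P) (hm : ∀ t ∈ P, t < m ∧ al t) : P.card ≤ L := by
  have h := Finset.card_le_card_of_injOn r (s := P) (t := Finset.Icc 1 L) (fun t ht => by
    have := hm t ht
    simp only [Finset.coe_Icc, Set.mem_Icc]
    exact ⟨hf.one_le t this.1 this.2, hf.le_top t this.1 this.2⟩) (fun t ht t' ht' he => by
      by_contra hne
      obtain ⟨h1, h2⟩ := hm t ht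
      obtain ⟨h3, h4⟩ := hm t' ht'
      rcases hP t ht t' ht' hne with h | h
      · have := hr.mono t' h3 h4 t h1 h2 h.1 h.2; omega
      · have := hr.mono t h1 h2 t' h3 h4 h.1 h.2; omega)
  simpa using h

/-- Follow predecessors. The last clause records that `t` comes last in the chain, which lets the
induction append one more item. -/
theorem RankRel.exists_chain (hr : RankRel k l u al m r) (hlu : ∀ t < m, al t → l t ≤ u t)
    (h1 : ∀ t < m, al t → 1 ≤ r t) (j : ℕ) : ∀ t < m, al t → r t = j + 1 →
    ∃ P : Finset ℕ, ItemChain k l u P ∧ (∀ t' ∈ P, t' < m ∧ al t') ∧ P.card = j + 1 ∧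
      ∀ t' ∈ P, t' = t ∨ (t' / k < t / k ∧ u t' < l t) := by
  induction j with
  | zero =>
    intro t ht hat _
    refine ⟨{t}, ?_, ?_, rfl, ?_⟩
    · intro a ha b hb hab
      rw [Finset.mem_singleton] at ha hb
      exact absurd (ha.trans hb.symm) hab
    · simp [ht, hat]
    · simp
  | succ j ih =>
    intro t ht hat hrt
    obtain ⟨t', ht', hat', hg, hlt, hrt'⟩ := hr.pred t ht hat (by omega)
    obtain ⟨P, hP, hP1, hP2, hP3⟩ := ih t' ht' hat' (by omega)
    have key : ∀ a ∈ P, a / k < t / k ∧ u a < l t := by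
      intro a ha
      rcases hP3 a ha with rfl | ⟨h3, h4⟩
      · exact ⟨hg, hlt⟩
      · exact ⟨h3.trans hg, (h4.trans_le (hlu t' ht' hat')).trans hlt⟩
    have hnot : t ∉ P := fun h => absurd (key t h).1 (lt_irrefl _)
    refine ⟨insert t P, ?_, ?_, ?_, ?_⟩
    · intro a ha b hb hab
      rw [Finset.mem_insert] at ha hb
      rcases ha with rfl | ha <;> rcases hb with rfl | hb
      · exact absurd rfl hab
      · exact .inr (key b hb)
      · exact .inl (key a ha)
      · exact hP a ha b hb hab
    · intro a ha
      rcases Finset.mem_insert.1 ha with rfl | ha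
      exacts [⟨ht, hat⟩, hP1 a ha]
    · rw [Finset.card_insert_of_notMem hnot, hP2]
    · intro a ha
      rcases Finset.mem_insert.1 ha with rfl | ha
      exacts [.inl rfl, .inr (key a ha)]

theorem Ends.exists_chain (hr : RankRel k l u al m r) (hf : Ends u al m r f L)
    (hlu : ∀ t < m, al t → l t ≤ u t) :
    ∃ P : Finset ℕ, ItemChain k l u P ∧ (∀ t ∈ P, t < m ∧ al t) ∧ P.card = L := by
  rcases Nat.eq_zero_or_pos L with rfl | hL
  · exact ⟨∅, fun _ h => by simp at h, by simp, rfl⟩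
  · obtain ⟨t, ht, hat, hrt, -⟩ := hf.attained L hL le_rfl
    obtain ⟨P, h1, h2, h3, -⟩ := hr.exists_chain hlu hf.one_le (L - 1) t ht hat (by omega)
    exact ⟨P, h1, h2, by omega⟩

end

namespace WordRAM

open WordRAM.Expr

/-! ## Extracting a longest chain

After `patience 0`, the groups are scanned backwards: register `11` holds the rank of the next item
to be taken, register `12` the left end of the last item taken and register `13` the rank looked for
in the present group (`-1` for none). The items taken are flagged. -/

def takeItem : Prog :=
  sta 2 (rg 7) (ct 1) ;; lda 12 0 (rg 7) ;; asg 11 (rg 13 - ct 1) ;; asg 13 (ct (-1))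

/-- Equality with the rank sought is tested by two strict comparisons. "None" is `-1` because
ignored items have rank 0. The comparison with register `10` admits the first item, of top rank,
when register `12` does not yet hold the left end of a taken item. -/
def extractItem : Prog :=
  asg 7 ((rg 20 - ct 1 - rg 9) * rg 21 + rg 8) ;; lda 5 3 (rg 7) ;; lda 6 1 (rg 7) ;;
  ifL (rg 5) (rg 13) skip (ifL (rg 13) (rg 5) skip
    (ifL (rg 6) (rg 12) takeItem (ifL (rg 13) (rg 10) skip takeItem)))

def extract : Prog :=
  asg 11 (rg 10) ;; forL 9 20 (
    ifL (ct 0) (rg 11) (asg 13 (rg 11)) (asg 13 (ct (-1))) ;; forL 8 21 extractItem)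

variable {w n : ℕ} {A : Fin n → ℤ}

theorem takeItem_run (hw : 1 ≤ w) {s : St} {t x : ℕ} (h7 : s.reg 7 = t)
    (ht : 16 * (t : ℤ) + 64 < wmax w) (hx : 0 < x) (hxw : (x : ℤ) < wmax w) (h13 : s.reg 13 = x) :
    Run w A takeItem s 40 fun s' =>
      (∀ r, r ≠ 11 → r ≠ 12 → r ≠ 13 → s'.reg r = s.reg r) ∧
      s'.reg 11 = (x - 1 : ℕ) ∧ s'.reg 12 = s.arr 0 t ∧ s'.reg 13 = -1 ∧
      s'.arr = (s.setArr 2 t 1).arr := by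
  apply Run.time
  · apply Run.seq
    refine Run.sta hw t (by simp [h7]) (by omega) (by simp) (by omega) (by simp; omega) ?_
    apply Run.seq
    refine Run.lda hw t (by simp [h7]) (by omega) (by simp) (by omega) (by norm_num) ?_
    apply Run.seq
    refine Run.asg hw (by simp [St.setReg_reg, h13]; omega) (by norm_num) ?_
    refine Run.asg hw (by simp; omega) (by norm_num) ⟨fun r h1 h2 h3 => ?_, ?_, ?_, ?_, ?_⟩
    · simp [St.setReg_reg, h1, h2, h3]
    · simp [St.setReg_reg, h13]; omega
    · simp [St.setReg_reg, St.setArr_arr]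
    · simp [St.setReg_reg]
    · simp
  · simp

theorem extractItem_run (hw : 1 ≤ w) {s : St} {N k i ii j L x ρ : ℕ} {y : ℤ}
    (h20 : s.reg 20 = N) (h21 : s.reg 21 = k) (h9 : s.reg 9 = ii) (hi : i + ii + 1 = N)
    (h8 : s.reg 8 = j) (ht : 16 * ((i * k + j : ℕ) : ℤ) + 64 < wmax w) (hN : (N : ℤ) < wmax w)
    (h10 : s.reg 10 = L) (hx : 0 < x) (hxw : (x : ℤ) < wmax w) (h13 : s.reg 13 = y)
    (hy : y = x ∨ y = -1) (hρ : s.arr 3 (i * k + j) = ρ) :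
    Run w A extractItem s 200 fun s' =>
      (∀ r, 8 ≤ r → r ≠ 11 → r ≠ 12 → r ≠ 13 → s'.reg r = s.reg r) ∧
      ((s'.arr = s.arr ∧ s'.reg 11 = s.reg 11 ∧ s'.reg 12 = s.reg 12 ∧ s'.reg 13 = s.reg 13 ∧
        ¬(y = x ∧ ρ = x ∧ (L ≤ x ∨ s.arr 1 (i * k + j) < s.reg 12))) ∨
      (s'.arr = (s.setArr 2 (i * k + j) 1).arr ∧ s'.reg 11 = (x - 1 : ℕ) ∧
        s'.reg 12 = s.arr 0 (i * k + j) ∧ s'.reg 13 = -1 ∧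
        y = x ∧ ρ = x ∧ (L ≤ x ∨ s.arr 1 (i * k + j) < s.reg 12))) := by
  obtain ⟨t, rfl'⟩ : ∃ t, t = i * k + j := ⟨_, rfl⟩
  have hNi : (N : ℤ) - 1 - ii = i := by omega
  have hti : (i : ℤ) * k + j = t := by rw [rfl']; push_cast; ring
  have hik : (0 : ℤ) ≤ (i : ℤ) * k := by positivity
  rw [← rfl'] at ht hρ ⊢
  have frame : ∀ a b c : ℤ, ∀ r, 8 ≤ r → (((s.setReg 7 a).setReg 5 b).setReg 6 c).reg r = s.reg r :=
    fun a b c r hr => by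
      simp [St.setReg_reg, show r ≠ 5 by omega, show r ≠ 6 by omega, show r ≠ 7 by omega]
  apply Run.time
  · apply Run.seq
    refine Run.asg hw ?_ (by norm_num) ?_
    · simp [h9, h20, h21, h8, hNi]; omega
    apply Run.seq
    refine Run.lda hw t (by simp [St.setReg_reg, h9, h20, h21, h8, hNi, hti]) (by omega) (by simp)
      (by omega) (by norm_num) ?_
    apply Run.seq
    refine Run.lda hw t (by simp [St.setReg_reg, h9, h20, h21, h8, hNi, hti]) (by omega) (by simp)
      (by omega) (by norm_num) ?_
    apply Run.ifL hw (by simp) (by simp)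
    · intro hc
      simp [St.setReg_reg, hρ, h13] at hc
      refine Run.skip ⟨fun r hr _ _ _ => frame _ _ _ r hr, .inl ⟨rfl, frame _ _ _ _ (by norm_num),
        frame _ _ _ _ (by norm_num), frame _ _ _ _ (by norm_num), by omega⟩⟩
    intro hc
    apply Run.ifL hw (by simp) (by simp)
    · intro hc'
      simp [St.setReg_reg, hρ, h13] at hc'
      refine Run.skip ⟨fun r hr _ _ _ => frame _ _ _ r hr, .inl ⟨rfl, frame _ _ _ _ (by norm_num),
        frame _ _ _ _ (by norm_num), frame _ _ _ _ (by norm_num), by omega⟩⟩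
    intro hc'
    simp [St.setReg_reg, hρ, h13] at hc hc'
    have hyx : y = x := by omega
    have hρx : ρ = x := by omega
    have take : ∀ a b c : ℤ, a = t → (L ≤ x ∨ s.arr 1 t < s.reg 12) →
        Run w A takeItem (((s.setReg 7 a).setReg 5 b).setReg 6 c) 40 fun s' =>
      (∀ r, 8 ≤ r → r ≠ 11 → r ≠ 12 → r ≠ 13 → s'.reg r = s.reg r) ∧
      ((s'.arr = s.arr ∧ s'.reg 11 = s.reg 11 ∧ s'.reg 12 = s.reg 12 ∧ s'.reg 13 = s.reg 13 ∧
        ¬(y = x ∧ ρ = x ∧ (L ≤ x ∨ s.arr 1 t < s.reg 12))) ∨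
      (s'.arr = (s.setArr 2 t 1).arr ∧ s'.reg 11 = (x - 1 : ℕ) ∧
        s'.reg 12 = s.arr 0 t ∧ s'.reg 13 = -1 ∧
        y = x ∧ ρ = x ∧ (L ≤ x ∨ s.arr 1 t < s.reg 12))) := by
      intro a b c ha hor
      refine (takeItem_run hw (t := t) (x := x) (by simp [St.setReg_reg, ha]) ht hx hxw
        (by simp [St.setReg_reg, h13, hyx])).post ?_
      rintro s' ⟨h1, h2, h3, h4, h5⟩
      refine ⟨fun r hr hr1 hr2 hr3 => ?_, .inr ⟨h5, h2, h3, h4, hyx, hρx, hor⟩⟩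
      rw [h1 r hr1 hr2 hr3, frame _ _ _ r hr]
    apply Run.ifL hw (by simp) (by simp)
    · intro hc2
      simp [St.setReg_reg] at hc2
      exact take _ _ _ (by simp [h9, h20, h21, h8, hNi, hti]) (.inr hc2)
    · intro hc2
      simp [St.setReg_reg] at hc2
      apply Run.ifL hw (by simp) (by simp)
      · intro hc3
        simp [St.setReg_reg, h13, h10] at hc3
        refine Run.skip ⟨fun r hr _ _ _ => frame _ _ _ r hr, .inl ⟨rfl, frame _ _ _ _ (by norm_num),
          frame _ _ _ _ (by norm_num), frame _ _ _ _ (by norm_num), ?_⟩⟩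
        rintro ⟨-, -, h | h⟩ <;> omega
      · intro hc3
        simp [St.setReg_reg, h13, h10] at hc3
        exact take _ _ _ (by simp [h9, h20, h21, h8, hNi, hti]) (.inl (by omega))
  · simp

variable {w n : ℕ} {A : Fin n → ℤ}

theorem extractLoop_run (hw : 1 ≤ w) {s : St} {N k i ii L x : ℕ} {y : ℤ} (r : ℕ → ℕ)
    (h20 : s.reg 20 = N) (h21 : s.reg 21 = k) (h9 : s.reg 9 = ii) (hi : i + ii + 1 = N)
    (ht : 16 * ((i * k + k : ℕ) : ℤ) + 64 < wmax w) (hN : (N : ℤ) < wmax w)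
    (h10 : s.reg 10 = L) (hx : 0 < x) (hxw : (x : ℤ) < wmax w) (h13 : s.reg 13 = y)
    (hy : y = x ∨ y = -1) (hr : ∀ t, i * k ≤ t → t < i * k + k → s.arr 3 t = r t) :
    Run w A (forL 8 21 extractItem) s (k * 209 + 5) fun s' =>
      (∀ r, 9 ≤ r → r ≠ 11 → r ≠ 12 → r ≠ 13 → s'.reg r = s.reg r) ∧
      ((s'.arr = s.arr ∧ s'.reg 11 = s.reg 11 ∧ s'.reg 12 = s.reg 12 ∧
        ∀ t, i * k ≤ t → t < i * k + k → ¬(y = x ∧ r t = x ∧ (L ≤ x ∨ s.arr 1 t < s.reg 12))) ∨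
      ∃ t, i * k ≤ t ∧ t < i * k + k ∧ s'.arr = (s.setArr 2 t 1).arr ∧
        s'.reg 11 = (x - 1 : ℕ) ∧ s'.reg 12 = s.arr 0 t ∧
        y = x ∧ r t = x ∧ (L ≤ x ∨ s.arr 1 t < s.reg 12)) := by
  have hk : (0 : ℤ) ≤ i * k := by positivity
  push_cast at ht
  refine Run.post (Run.forL hw (by norm_num) (by norm_num) (by norm_num) k 200 (by omega)
    (fun j s' => (∀ r, 9 ≤ r → r ≠ 11 → r ≠ 12 → r ≠ 13 → s'.reg r = s.reg r) ∧
      ((s'.arr = s.arr ∧ s'.reg 11 = s.reg 11 ∧ s'.reg 12 = s.reg 12 ∧ s'.reg 13 = y ∧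
        ∀ t, i * k ≤ t → t < i * k + j → ¬(y = x ∧ r t = x ∧ (L ≤ x ∨ s.arr 1 t < s.reg 12))) ∨
      ∃ t, i * k ≤ t ∧ t < i * k + j ∧ s'.arr = (s.setArr 2 t 1).arr ∧
        s'.reg 11 = (x - 1 : ℕ) ∧ s'.reg 12 = s.arr 0 t ∧ s'.reg 13 = -1 ∧
        y = x ∧ r t = x ∧ (L ≤ x ∨ s.arr 1 t < s.reg 12))) ?_ h21 ?_) ?_
  · rintro j hj s' ⟨h1, h2⟩ h8 h21'
    have e3 : s'.arr 3 = s.arr 3 := by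
      rcases h2 with ⟨h2, -⟩ | ⟨t, -, -, h2, -⟩ <;> rw [h2]
      rfl
    have hy' : s'.reg 13 = y ∧ (y = x ∨ y = -1) ∨ s'.reg 13 = -1 := by
      rcases h2 with ⟨-, -, -, h2, -⟩ | ⟨t, -, -, -, -, -, h2, -⟩
      exacts [.inl ⟨h2, hy⟩, .inr h2]
    refine (extractItem_run hw (N := N) (k := k) (i := i) (ii := ii) (j := j) (L := L) (x := x)
      (ρ := r (i * k + j)) (y := s'.reg 13) (by rw [h1, h20] <;> norm_num) h21'
      (by rw [h1, h9] <;> norm_num) hi h8 (by push_cast; omega) hN (by rw [h1, h10] <;> norm_num)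
      hx hxw rfl (by rcases hy' with ⟨h, h'⟩ | h <;> omega)
      (by rw [e3]; exact hr _ (by omega) (by omega))).post ?_
    rintro s'' ⟨h3, h4⟩
    refine ⟨by rw [h3, h8] <;> norm_num, by rw [h3, h21'] <;> norm_num,
      fun r hr h11 h12 h13 => ?_, ?_⟩
    · rw [St.setReg_reg, if_neg (by omega), h3 r (by omega) h11 h12 h13, h1 r hr h11 h12 h13]
    simp only [St.setReg_reg, St.setReg_arr, Nat.reduceEqDiff, if_false]
    rcases h4 with ⟨h4, h5, h6, h7, h8⟩ | ⟨h4, h5, h6, h7, h8, h8', h9⟩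
    · rw [h4, h5, h6, h7]
      rcases h2 with ⟨a1, a2, a3, a4, a5⟩ | ⟨t, b1, b2, b3⟩
      · refine .inl ⟨a1, a2, a3, a4, fun t ht1 ht2 => ?_⟩
        by_cases h : t = i * k + j
        · subst h
          rwa [a1, a3, a4] at h8
        · exact a5 t ht1 (by omega)
      · exact .inr ⟨t, b1, by omega, b3⟩
    · rcases h2 with ⟨a1, a2, a3, a4, a5⟩ | ⟨t, b1, b2, b3, b4, b5, b6, b7⟩
      · refine .inr ⟨i * k + j, by omega, by omega, ?_, h5, ?_, h7, ?_, h8', ?_⟩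
        · rw [h4, St.setArr, a1]; rfl
        · rw [h6, a1]
        · rw [← h8, a4]
        · rwa [a1, a3] at h9
      · omega
  · refine ⟨fun r hr _ _ _ => by rw [St.setReg_reg, if_neg (by omega)],
      .inl ⟨rfl, ?_, ?_, ?_, fun t h1 h2 => absurd h2 (by omega)⟩⟩ <;> simp [St.setReg_reg, h13]
  · rintro s' ⟨h1, ⟨a1, a2, a3, a4, a5⟩ | ⟨t, b1, b2, b3, b4, b5, b6, b7⟩⟩
    · exact ⟨h1, .inl ⟨a1, a2, a3, a5⟩⟩
    · exact ⟨h1, .inr ⟨t, b1, b2, b3, b4, b5, b7⟩⟩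

theorem extractGroup_run (hw : 1 ≤ w) {s : St} {N k i ii L x : ℕ} (r : ℕ → ℕ)
    (h20 : s.reg 20 = N) (h21 : s.reg 21 = k) (h9 : s.reg 9 = ii) (hi : i + ii + 1 = N)
    (ht : 16 * ((i * k + k : ℕ) : ℤ) + 64 < wmax w) (hN : (N : ℤ) < wmax w)
    (h10 : s.reg 10 = L) (hxw : (x : ℤ) < wmax w) (h11 : s.reg 11 = x)
    (hr : ∀ t, i * k ≤ t → t < i * k + k → s.arr 3 t = r t) :
    Run w A (ifL (ct 0) (rg 11) (asg 13 (rg 11)) (asg 13 (ct (-1))) ;; forL 8 21 extractItem) s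
      (k * 209 + 20) fun s' =>
      (∀ r, 9 ≤ r → r ≠ 11 → r ≠ 12 → r ≠ 13 → s'.reg r = s.reg r) ∧
      ((s'.arr = s.arr ∧ s'.reg 11 = s.reg 11 ∧ s'.reg 12 = s.reg 12 ∧
        ∀ t, i * k ≤ t → t < i * k + k → ¬(0 < x ∧ r t = x ∧ (L ≤ x ∨ s.arr 1 t < s.reg 12))) ∨
      ∃ t, i * k ≤ t ∧ t < i * k + k ∧ s'.arr = (s.setArr 2 t 1).arr ∧
        s'.reg 11 = (x - 1 : ℕ) ∧ s'.reg 12 = s.arr 0 t ∧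
        0 < x ∧ r t = x ∧ (L ≤ x ∨ s.arr 1 t < s.reg 12)) := by
  have hk : (0 : ℤ) ≤ ((i * k + k : ℕ) : ℤ) := by positivity
  have key : ∀ y : ℤ, (y = x ∧ 0 < x ∨ y = -1 ∧ x = 0) →
      Run w A (forL 8 21 extractItem) (s.setReg 13 y) (k * 209 + 5) fun s' =>
      (∀ r, 9 ≤ r → r ≠ 11 → r ≠ 12 → r ≠ 13 → s'.reg r = s.reg r) ∧
      ((s'.arr = s.arr ∧ s'.reg 11 = s.reg 11 ∧ s'.reg 12 = s.reg 12 ∧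
        ∀ t, i * k ≤ t → t < i * k + k → ¬(0 < x ∧ r t = x ∧ (L ≤ x ∨ s.arr 1 t < s.reg 12))) ∨
      ∃ t, i * k ≤ t ∧ t < i * k + k ∧ s'.arr = (s.setArr 2 t 1).arr ∧
        s'.reg 11 = (x - 1 : ℕ) ∧ s'.reg 12 = s.arr 0 t ∧
        0 < x ∧ r t = x ∧ (L ≤ x ∨ s.arr 1 t < s.reg 12)) := by
    intro y hy
    -- For `x = 0` nothing is sought, as then `y = -1`; `max x 1` only meets the positivity
    -- hypothesis.
    refine (extractLoop_run hw (s := s.setReg 13 y) (L := L) (x := max x 1) (y := y) r (by simp [St.setReg_reg, h20])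
      (by simp [St.setReg_reg, h21]) (by simp [St.setReg_reg, h9]) hi ht hN
      (by simp [St.setReg_reg, h10]) (by omega) (by omega) (by simp [St.setReg_reg])
      (by rcases hy with h | h <;> omega) hr).post ?_
    rintro s' ⟨h1, h2⟩
    simp [St.setReg_reg] at h1 h2
    refine ⟨fun r hr h11 h12 h13 => ?_, ?_⟩
    · rw [h1 r hr h11 h12 h13, if_neg h13]
    · rcases h2 with ⟨a1, a2, a3, a4⟩ | ⟨t, b1, b2, b3, b4, b5, b6, b7, b8⟩
      · refine .inl ⟨a1, a2, a3, fun t h1 h2 => ?_⟩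
        rintro ⟨h3, h4, h5⟩
        have := a4 t h1 h2 (by omega) (by omega)
        rcases h5 with h5 | h5 <;> omega
      · refine .inr ⟨t, b1, b2, b3, ?_, b5, by omega, by omega, ?_⟩
        · rw [b4]; omega
        · rcases b8 with h | h
          · left; omega
          · exact .inr h
  apply Run.time
  · apply Run.seq
    apply Run.ifL hw (by simp; omega) (by simp)
    · intro hc
      refine Run.asg hw (by simp) (by norm_num) ?_
      simp [h11] at hc
      exact key _ (.inl ⟨h11, hc⟩)
    · intro hc
      refine Run.asg hw (by simp; omega) (by norm_num) ?_
      simp [h11] at hc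
      exact key _ (.inr ⟨rfl, hc⟩)
  · simp
    omega

/-- Invariant of the backward scan: the items taken form a chain in the groups already scanned, and
while a rank `x > 0` is still sought, some unscanned live item of rank `x` ends before the last left
end taken (if one was taken). Whichever item of rank `x` is taken, its own predecessor restores the
invariant, so the scan never gets stuck and takes exactly `L` items. -/
theorem extract_run (hw : 1 ≤ w) {s : St} {N k L m : ℕ} (hm : m = N * k) (hk : 0 < k) (r : ℕ → ℕ)
    {f : ℕ → ℤ}
    (h20 : s.reg 20 = N) (h21 : s.reg 21 = k) (h10 : s.reg 10 = L) (hLN : L ≤ N)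
    (hM : 16 * (m : ℤ) + 200 < wmax w)
    (hr : ∀ t < m, s.arr 3 t = r t ∧ (0 < s.arr 2 t → r t = 0))
    (hlu : ∀ t < m, ¬0 < s.arr 2 t → s.arr 0 t ≤ s.arr 1 t)
    (hR : RankRel k (s.arr 0) (s.arr 1) (fun t => ¬0 < s.arr 2 t) m r)
    (hE : Ends (s.arr 1) (fun t => ¬0 < s.arr 2 t) m r f L) :
    Run w A extract s (N * (k * 209 + 30) + 10) fun s' =>
      (∀ r, 14 ≤ r → s'.reg r = s.reg r) ∧ (∀ c, c ≠ 2 → s'.arr c = s.arr c) ∧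
      ∃ P : Finset ℕ, ItemChain k (s.arr 0) (s.arr 1) P ∧ P.card = L ∧
        (∀ t ∈ P, t < m ∧ ¬0 < s.arr 2 t) ∧
        ∀ t, s'.arr 2 t = if t ∈ P then 1 else s.arr 2 t := by
  subst hm
  have hNk : N ≤ N * k := Nat.le_mul_of_pos_right N hk
  apply Run.time
  · apply Run.seq
    refine Run.asg hw (by simp) (by norm_num) ?_
    refine Run.post (Run.forL hw (by norm_num) (by norm_num) (by norm_num) N (k * 209 + 20)
      (by omega) (fun ii s' =>
      (∀ r, r = 10 ∨ 14 ≤ r → s'.reg r = s.reg r) ∧ (∀ c, c ≠ 2 → s'.arr c = s.arr c) ∧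
      ∃ (P : Finset ℕ) (x : ℕ), ItemChain k (s.arr 0) (s.arr 1) P ∧ s'.reg 11 = x ∧
        P.card + x = L ∧ (∀ t ∈ P, t < N * k ∧ ¬0 < s.arr 2 t ∧ (N - ii) * k ≤ t ∧
          s'.reg 12 ≤ s.arr 0 t) ∧ (∀ t, s'.arr 2 t = if t ∈ P then 1 else s.arr 2 t) ∧
        (0 < x → ∃ t < (N - ii) * k, ¬0 < s.arr 2 t ∧ r t = x ∧
          (x < L → s.arr 1 t < s'.reg 12))) ?_ (by simp [St.setReg_reg, h20]) ?_) ?_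
    · rintro ii hii s' ⟨h1, h2, P, x, h3, h4, h5, h6, h7, h8⟩ h9 h20'
      obtain ⟨i, hi⟩ : ∃ i, i + ii + 1 = N := ⟨N - ii - 1, by omega⟩
      have hi1 : N - ii = i + 1 := by omega
      have hi2 : N - (ii + 1) = i := by omega
      have hik : i * k + k ≤ N * k := by
        rw [← Nat.succ_mul]; exact Nat.mul_le_mul_right k (by omega)
      rw [hi1, Nat.succ_mul] at h6 h8
      rw [hi2]
      refine (extractGroup_run hw (L := L) (x := x) r h20' (by rw [h1 _ (by norm_num), h21]) h9 hi
        (by omega) (by omega) (by rw [h1 _ (by norm_num), h10]) (by omega) h4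
        (fun t _ ht => by rw [h2 3 (by norm_num)]; exact (hr t (by omega)).1)).post ?_
      rintro s'' ⟨b1, b2⟩
      refine ⟨by rw [b1, h9] <;> norm_num, by rw [b1, h20'] <;> norm_num,
        fun r hr => ?_, fun c hc => ?_, ?_⟩
      · rw [St.setReg_reg, if_neg (by omega), b1 r (by omega) (by omega) (by omega) (by omega),
          h1 r hr]
      · rw [St.setReg_arr]
        rcases b2 with ⟨b2, -⟩ | ⟨t, -, -, b2, -⟩
        · rw [b2, h2 c hc]
        · rw [b2, St.setArr_arr, if_neg hc, h2 c hc]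
      simp only [St.setReg_reg, St.setReg_arr, Nat.reduceEqDiff, if_false]
      rcases b2 with ⟨a1, a2, a3, a4⟩ | ⟨p, c1, c2, c3, c4, c5, c6, c7, c8⟩
      · refine ⟨P, x, h3, by rw [a2, h4], h5, fun t ht => ?_, ?_, fun hx => ?_⟩
        · obtain ⟨d1, d2, d3, d4⟩ := h6 t ht
          exact ⟨d1, d2, by omega, by rwa [a3]⟩
        · rw [a1]; exact h7
        · obtain ⟨t, d1, d2, d3, d4⟩ := h8 hx
          refine ⟨t, ?_, d2, d3, by rwa [a3]⟩
          -- Had the promised item been in the group just scanned, one would have been taken there.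
          by_contra! hle
          refine a4 t hle d1 ⟨hx, d3, ?_⟩
          rw [h2 1 (by norm_num)]
          rcases lt_or_ge x L with h | h
          exacts [.inr (d4 h), .inl h]
      · rw [h2 1 (by norm_num)] at c8
        rw [h2 0 (by norm_num)] at c5
        have hal : ¬0 < s.arr 2 p := fun h => by
          have := (hr p (by omega)).2 h
          omega
        have hlp := hlu p (by omega) hal
        have hP : ∀ t ∈ P, p / k < t / k ∧ s.arr 1 p < s.arr 0 t := by
          intro t ht
          obtain ⟨d1, d2, d3, d4⟩ := h6 t ht
          have hc : 0 < P.card := Finset.card_pos.2 ⟨t, ht⟩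
          refine ⟨?_, ?_⟩
          · have e1 : p / k < i + 1 := (Nat.div_lt_iff_lt_mul hk).2 (by rw [Nat.succ_mul]; omega)
            have e2 : i + 1 ≤ t / k := (Nat.le_div_iff_mul_le hk).2 (by rw [Nat.succ_mul]; omega)
            omega
          · rcases c8 with h | h
            · omega
            · exact h.trans_le d4
        have hpP : p ∉ P := fun h => absurd (hP p h).1 (lt_irrefl _)
        refine ⟨insert p P, x - 1, ?_, c4, ?_, ?_, ?_, ?_⟩
        · intro a ha b hb hab
          rw [Finset.mem_insert] at ha hb
          rcases ha with rfl | ha <;> rcases hb with rfl | hb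
          · exact absurd rfl hab
          · exact .inl (hP b hb)
          · exact .inr (hP a ha)
          · exact h3 a ha b hb hab
        · rw [Finset.card_insert_of_notMem hpP]; omega
        · intro t ht
          rw [c5]
          rcases Finset.mem_insert.1 ht with rfl | ht
          · exact ⟨by omega, hal, c1, le_rfl⟩
          · obtain ⟨d1, d2, d3, d4⟩ := h6 t ht
            exact ⟨d1, d2, by omega, hlp.trans (hP t ht).2.le⟩
        · intro t
          rw [c3, St.setArr_arr, if_pos rfl]
          by_cases h : t = p
          · subst h; simp
          · rw [Function.update_of_ne h, h7]
            simp [h]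
        · intro hx
          obtain ⟨t', d1, d2, d3, d4, d5⟩ := hR.pred p (by omega) hal (by omega)
          refine ⟨t', ?_, d2, by omega, fun _ => by rw [c5]; exact d4⟩
          have e1 : p / k < i + 1 := (Nat.div_lt_iff_lt_mul hk).2 (by rw [Nat.succ_mul]; omega)
          exact (Nat.div_lt_iff_lt_mul hk).1 (by omega)
    · refine ⟨fun r hr => by simp [St.setReg_reg, show r ≠ 9 by omega, show r ≠ 11 by omega],
        fun _ _ => rfl, ∅, L, fun _ h => by simp at h, by simp [St.setReg_reg, h10], by simp,
        by simp, by simp, fun hL => ?_⟩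
      obtain ⟨t, d1, d2, d3, d4⟩ := hE.attained L hL le_rfl
      exact ⟨t, by simpa using d1, d2, d3, fun h => absurd h (lt_irrefl _)⟩
    · rintro s' ⟨h1, h2, P, x, h3, h4, h5, h6, h7, h8⟩
      have hx : x = 0 := by
        by_contra h
        obtain ⟨t, ht, -⟩ := h8 (by omega)
        simp at ht
      exact ⟨fun r hr => h1 r (.inr hr), h2, P, h3, by omega,
        fun t ht => ⟨(h6 t ht).1, (h6 t ht).2.1⟩, h7⟩
  · have := Nat.mul_le_mul_left N (show k * 209 + 20 + 9 ≤ k * 209 + 30 by omega)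
    simp only [size_rg]
    omega

end WordRAM

/-! ### Increasing subsequences of sets of positions -/

/-- The length of a longest increasing subsequence of `a` on the positions in `S`. -/
noncomputable def lisOn (a : ℕ → ℤ) (S : Finset ℕ) : ℕ := by
  classical
  exact (S.powerset.filter fun T : Finset ℕ => StrictMonoOn a (T : Set ℕ)).sup Finset.card

theorem le_lisOn {a : ℕ → ℤ} {S T : Finset ℕ} (hT : T ⊆ S) (h : StrictMonoOn a (T : Set ℕ)) :
    T.card ≤ lisOn a S := by
  classical
  exact Finset.le_sup (f := Finset.card) (by simp [hT, h])

theorem exists_lisOn (a : ℕ → ℤ) (S : Finset ℕ) :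
    ∃ T ⊆ S, StrictMonoOn a (T : Set ℕ) ∧ T.card = lisOn a S := by
  classical
  obtain ⟨T, hT, h⟩ := Finset.exists_mem_eq_sup
    (S.powerset.filter fun T : Finset ℕ => StrictMonoOn a (T : Set ℕ)) ⟨∅, by simp [StrictMonoOn]⟩
    Finset.card
  simp only [Finset.mem_filter, Finset.mem_powerset] at hT
  exact ⟨T, hT.1, hT.2, h.symm⟩

theorem lisOn_le_card (a : ℕ → ℤ) (S : Finset ℕ) : lisOn a S ≤ S.card := by
  obtain ⟨T, hT, -, h⟩ := exists_lisOn a S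
  exact h ▸ Finset.card_le_card hT

theorem lisOn_congr {a b : ℕ → ℤ} {S : Finset ℕ} (h : ∀ x ∈ S, a x = b x) :
    lisOn a S = lisOn b S := by
  apply le_antisymm
  · obtain ⟨T, hT, hm, hc⟩ := exists_lisOn a S
    rw [← hc]
    refine le_lisOn hT fun x hx y hy hxy => ?_
    rw [← h x (hT hx), ← h y (hT hy)]
    exact hm hx hy hxy
  · obtain ⟨T, hT, hm, hc⟩ := exists_lisOn b S
    rw [← hc]
    refine le_lisOn hT fun x hx y hy hxy => ?_
    rw [h x (hT hx), h y (hT hy)]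
    exact hm hx hy hxy

theorem itemChain_one_iff {a : ℕ → ℤ} {P : Finset ℕ} :
    ItemChain 1 a a P ↔ StrictMonoOn a (P : Set ℕ) := by
  constructor
  · intro h x hx y hy hxy
    rcases h x hx y hy hxy.ne with h | h
    · exact h.2
    · have := h.1
      simp only [Nat.div_one] at this
      omega
  · intro h x hx y hy hxy
    simp only [Nat.div_one]
    rcases lt_or_gt_of_ne hxy with h1 | h1
    · exact .inl ⟨h1, h hx hy h1⟩
    · exact .inr ⟨h1, h hy hx h1⟩

theorem ItemChain.congr {k : ℕ} {l u l' u' : ℕ → ℤ} {P : Finset ℕ} (h : ItemChain k l u P)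
    (hl : ∀ t ∈ P, l' t = l t) (hu : ∀ t ∈ P, u' t = u t) : ItemChain k l' u' P := by
  intro t ht t' ht' hne
  rw [hl t ht, hl t' ht', hu t ht, hu t' ht']
  exact h t ht t' ht' hne

/-- With groups of size one and intervals reduced to points, chains are increasing subsequences.
Thus the same sorting program also yields exact lengths for blocks and samples. -/
theorem Ends.eq_lisOn {l u : ℕ → ℤ} {al : ℕ → Prop} [DecidablePred al] {m : ℕ} {r : ℕ → ℕ}
    {f : ℕ → ℤ} {L : ℕ} (hr : RankRel 1 l u al m r) (hf : Ends u al m r f L)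
    (hlu : ∀ t < m, al t → l t = u t) :
    L = lisOn l ((Finset.range m).filter al) := by
  apply le_antisymm
  · obtain ⟨P, h1, h2, h3⟩ := hf.exists_chain hr fun t ht hat => (hlu t ht hat).le
    rw [← h3]
    refine le_lisOn (fun t ht => by simpa using h2 t ht) (itemChain_one_iff.1 (h1.congr ?_ ?_))
    · exact fun _ _ => rfl
    · exact fun t ht => hlu t (h2 t ht).1 (h2 t ht).2
  · obtain ⟨T, hT, hm, hc⟩ := exists_lisOn l ((Finset.range m).filter al)
    rw [← hc]
    have hT' : ∀ t ∈ T, t < m ∧ al t := fun t ht => by simpa using hT ht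
    refine ((itemChain_one_iff.2 hm).congr ?_ ?_ : ItemChain 1 l u T).card_le hr hf hT'
    · exact fun _ _ => rfl
    · exact fun t ht => (hlu t (hT' t ht).1 (hT' t ht).2).symm

namespace WordRAM

open WordRAM.Expr

variable {w n : ℕ} {A : Fin n → ℤ}

/-- Extract as many longest chains as register `22` says. -/
def rounds : Prog := forL 14 22 (patience 0 ;; extract)

/-- `D` is a disjoint union of `R` chains, so a bound for the weight of every chain gives `R` times
that bound for `D`; later the weight is the score. A chain `C` that avoids `D` was available in
every round, so each extracted chain was at least as long, and together they have at most `N * k`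
items. -/
theorem rounds_run (hw : 1 ≤ w) {s : St} {N k R b : ℕ}
    (h20 : s.reg 20 = N) (h21 : s.reg 21 = k) (h22 : s.reg 22 = R) (hk : 0 < k)
    (hb : N * k < 2 ^ b) (hR : (R : ℤ) < wmax w)
    (hM : 16 * ((N * k : ℕ) : ℤ) + 200 < wmax w)
    (hlu : ∀ t < N * k, ¬0 < s.arr 2 t → s.arr 0 t ≤ s.arr 1 t) :
    Run w A rounds s (R * (N * (k * (b * 60 + 527) + 60) + 40) + 10) fun s' =>
      (∀ r, 15 ≤ r → s'.reg r = s.reg r) ∧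
      (∀ c, c ≠ 2 → c ≠ 3 → c ≠ 4 → s'.arr c = s.arr c) ∧
      ∃ D : Finset ℕ, (∀ t ∈ D, t < N * k ∧ ¬0 < s.arr 2 t) ∧
        (∀ t, s'.arr 2 t = if t ∈ D then 1 else s.arr 2 t) ∧
        (∀ (σ : ℕ → ℕ) (Λ : ℕ), (∀ P, ItemChain k (s.arr 0) (s.arr 1) P → (∀ t ∈ P, t < N * k) →
          ∑ t ∈ P, σ t ≤ Λ) → ∑ t ∈ D, σ t ≤ R * Λ) ∧
        ∀ C, ItemChain k (s.arr 0) (s.arr 1) C → (∀ t ∈ C, t < N * k ∧ ¬0 < s.arr 2 t) →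
          Disjoint C D → R * C.card ≤ N * k := by
  have h := Run.forL (w := w) (A := A) hw (i := 14) (b := 22) (p := patience 0 ;; extract)
    (by norm_num) (by norm_num) (by norm_num) R
    ((N * (k * (b * 60 + 318) + 30) + 10) + (N * (k * 209 + 30) + 10) + 1) hR (fun j s' =>
      (∀ r, 15 ≤ r → s'.reg r = s.reg r) ∧
      (∀ c, c ≠ 2 → c ≠ 3 → c ≠ 4 → s'.arr c = s.arr c) ∧
      ∃ D : Finset ℕ, (∀ t ∈ D, t < N * k ∧ ¬0 < s.arr 2 t) ∧
        (∀ t, s'.arr 2 t = if t ∈ D then 1 else s.arr 2 t) ∧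
        (∀ (σ : ℕ → ℕ) (Λ : ℕ), (∀ P, ItemChain k (s.arr 0) (s.arr 1) P → (∀ t ∈ P, t < N * k) →
          ∑ t ∈ P, σ t ≤ Λ) → ∑ t ∈ D, σ t ≤ j * Λ) ∧
        ∀ C, ItemChain k (s.arr 0) (s.arr 1) C → (∀ t ∈ C, t < N * k ∧ ¬0 < s.arr 2 t) →
          Disjoint C D → j * C.card ≤ D.card) ?_ h22 ?_
  · refine h.weaken ?_ ?_
    · have : N * (k * (b * 60 + 527) + 60) =
        N * (k * (b * 60 + 318) + 30) + N * (k * 209 + 30) := by ring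
      rw [this]
      have := Nat.mul_le_mul_left R (show N * (k * (b * 60 + 318) + 30) + 10 +
        (N * (k * 209 + 30) + 10) + 1 + 9 ≤
        N * (k * (b * 60 + 318) + 30) + N * (k * 209 + 30) + 40 by omega)
      exact Nat.add_le_add this (by norm_num)
    · rintro s' ⟨h1, h2, D, h3, h4, h5, h6⟩
      refine ⟨h1, h2, D, h3, h4, h5, fun C hC hC' hCD => (h6 C hC hC' hCD).trans ?_⟩
      have := Finset.card_le_card (show D ⊆ Finset.range (N * k) from fun t ht => by
        simpa using (h3 t ht).1)
      simpa using this
  · rintro j hj s₁ ⟨h1, h2, D, h3, h4, h5, h6⟩ h14 h22'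
    have e0 : s₁.arr 0 = s.arr 0 := h2 0 (by norm_num) (by norm_num) (by norm_num)
    have e1 : s₁.arr 1 = s.arr 1 := h2 1 (by norm_num) (by norm_num) (by norm_num)
    have hal : ∀ t, ¬0 < s₁.arr 2 t ↔ t ∉ D ∧ ¬0 < s.arr 2 t := by
      intro t
      rw [h4]
      split_ifs with h <;> simp [h]
    have hlu1 : ∀ t < N * k, ¬0 < s₁.arr 2 t → s₁.arr 0 t ≤ s₁.arr 1 t := by
      intro t ht hat
      rw [e0, e1]
      exact hlu t ht ((hal t).1 hat).2
    apply Run.seq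
    refine (patience_run hw (o := 0) (by norm_num) (N := N) (k := k) (b := b)
      (by rw [h1 _ (by norm_num), h20]) (by rw [h1 _ (by norm_num), h21]) hk hb hM hlu1).post ?_
    rintro s₂ ⟨a1, a2, L, r, a3, a4, a5, a6, a7⟩
    simp only [Nat.zero_add] at a2 a5 a6 a7
    have e0' : s₂.arr 0 = s.arr 0 := by rw [a2 0 (by norm_num) (by norm_num), e0]
    have e1' : s₂.arr 1 = s.arr 1 := by rw [a2 1 (by norm_num) (by norm_num), e1]
    have e2' : s₂.arr 2 = s₁.arr 2 := a2 2 (by norm_num) (by norm_num)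
    refine (extract_run hw (N := N) (k := k) (L := L) rfl hk r (f := s₂.arr 4)
      (by rw [a1 _ (by norm_num), h1 _ (by norm_num), h20])
      (by rw [a1 _ (by norm_num), h1 _ (by norm_num), h21]) a3 a4 hM
      (by rw [e2']; exact a5) (by rw [e0', e1', e2', ← e0, ← e1]; exact hlu1)
      (by rw [e0', e1', e2', ← e0, ← e1]; exact a6) (by rw [e1', e2', ← e1]; exact a7)).post ?_
    rintro s₃ ⟨b1, b2, P, b3, b4, b5, b6⟩
    rw [e0', e1'] at b3
    rw [e2'] at b5
    have hPD : Disjoint D P := Finset.disjoint_left.2 fun t ht ht' => ((hal t).1 (b5 t ht').2).1 ht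
    refine ⟨by rw [b1 _ (by norm_num), a1 _ (by norm_num), h14],
      by rw [b1 _ (by norm_num), a1 _ (by norm_num), h22'], fun r hr => ?_, fun c h2' h3' h4' => ?_,
      D ∪ P, ?_, ?_, ?_, ?_⟩
    · rw [St.setReg_reg, if_neg (by omega), b1 _ (by omega), a1 _ (by omega), h1 _ hr]
    · rw [St.setReg_arr, b2 _ h2', a2 _ h3' h4', h2 _ h2' h3' h4']
    · intro t ht
      rcases Finset.mem_union.1 ht with ht | ht
      · exact h3 t ht
      · exact ⟨(b5 t ht).1, ((hal t).1 (b5 t ht).2).2⟩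
    · intro t
      rw [St.setReg_arr, b6, e2', h4]
      by_cases h : t ∈ P <;> by_cases h' : t ∈ D <;> simp [h, h']
    · intro σ Λ hσ
      rw [Finset.sum_union hPD, Nat.succ_mul]
      exact add_le_add (h5 σ Λ hσ) (hσ P b3 fun t ht => (b5 t ht).1)
    · intro C hC hC1 hC2
      rw [Finset.disjoint_union_right] at hC2
      rw [Finset.card_union_of_disjoint hPD, Nat.succ_mul]
      refine add_le_add (h6 C hC hC1 hC2.1) ?_
      rw [b4]
      rw [e1, e0] at a6
      rw [e1] at a7
      exact hC.card_le a6 a7 fun t ht =>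
        ⟨(hC1 t ht).1, (hal t).2 ⟨Finset.disjoint_left.1 hC2.1 ht, (hC1 t ht).2⟩⟩
  · exact ⟨fun r hr => by rw [St.setReg_reg, if_neg (by omega)], fun _ _ _ _ => rfl, ∅, by simp,
      by simp, by simp, by simp⟩

/-! ## Scores

The items are stored in the arrays `0`, `1`, `2`. Registers `31` and `32` hold the length of the
blocks of the input and the number of items of each block. -/

/-- Add the length of a longest increasing subsequence of the block of the item in register `30`,
with values in the interval of that item, to register `33` if the item is flagged. -/
def addScore : Prog :=
  asg 20 (rg 31) ;; asg 21 (ct 1) ;; asg 14 (rg 30 / rg 32 * rg 31) ;;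
  lda 15 0 (rg 30) ;; lda 16 1 (rg 30) ;;
  forL 9 20 (inp 1 (rg 14 + rg 9) ;; sta 8 (rg 9) (rg 1) ;; sta 9 (rg 9) (rg 1) ;;
    ifL (rg 1) (rg 15) (sta 10 (rg 9) (ct 1)) (ifL (rg 16) (rg 1) (sta 10 (rg 9) (ct 1))
      (sta 10 (rg 9) (ct 0)))) ;;
  patience 8 ;; lda 1 2 (rg 30) ;; asg 33 (rg 33 + rg 1 * rg 10)

/-- The length of a longest increasing subsequence in the `i`-th block of length `B`, with values in
`[x, y]`. -/
noncomputable def blockLis (a : ℕ → ℤ) (B i : ℕ) (x y : ℤ) : ℕ :=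
  lisOn (fun z => a (i * B + z)) ((Finset.range B).filter fun z => x ≤ a (i * B + z) ∧ a (i * B + z) ≤ y)

theorem blockLis_le (a : ℕ → ℤ) (B i : ℕ) (x y : ℤ) : blockLis a B i x y ≤ B := by
  refine (lisOn_le_card _ _).trans ((Finset.card_filter_le _ _).trans ?_)
  simp

theorem scoreEntry_run (hw : 1 ≤ w) {s : St} {B i z : ℕ} (h14 : s.reg 14 = (i * B : ℕ))
    (h9 : s.reg 9 = z) (hz : 16 * (z : ℤ) + 64 < wmax w) (hi : ((i * B + z : ℕ) : ℤ) < wmax w) :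
    Run w A (inp 1 (rg 14 + rg 9) ;; sta 8 (rg 9) (rg 1) ;; sta 9 (rg 9) (rg 1) ;;
      ifL (rg 1) (rg 15) (sta 10 (rg 9) (ct 1)) (ifL (rg 16) (rg 1) (sta 10 (rg 9) (ct 1))
      (sta 10 (rg 9) (ct 0)))) s 100 fun s' => (∀ r, r ≠ 1 → s'.reg r = s.reg r) ∧
      ∃ f : ℤ, (0 < f ↔ ¬(s.reg 15 ≤ entry A (i * B + z : ℕ) ∧
        entry A (i * B + z : ℕ) ≤ s.reg 16)) ∧
      s'.arr = (((s.setArr 8 z (entry A (i * B + z : ℕ))).setArr 9 z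
        (entry A (i * B + z : ℕ))).setArr 10 z f).arr := by
  have e : s.reg 14 + s.reg 9 = (i * B + z : ℕ) := by rw [h14, h9]; push_cast; ring
  apply Run.time
  · apply Run.seq
    refine Run.inp hw (by simp [e]; omega) (by norm_num) ?_
    rw [eval_add, eval_rg, eval_rg, e]
    generalize entry A (i * B + z : ℕ) = v
    apply Run.seq
    refine Run.sta hw z (by simp [St.setReg_reg, h9]) (by norm_num) (by simp) (by omega)
      (by simp) ?_
    apply Run.seq
    refine Run.sta hw z (by simp [St.setReg_reg, h9]) (by norm_num) (by simp) (by omega)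
      (by simp) ?_
    apply Run.ifL hw (by simp) (by simp)
    · intro hc
      simp [St.setReg_reg] at hc
      refine Run.sta hw z (by simp [St.setReg_reg, h9]) (by norm_num) (by simp) (by omega)
        (by simp; omega) ⟨fun r hr => by simp [St.setReg_reg, hr], 1, ?_, ?_⟩
      · simp; omega
      · simp [St.setArr, St.setReg_reg]
    intro hc
    simp [St.setReg_reg] at hc
    apply Run.ifL hw (by simp) (by simp)
    · intro hc'
      simp [St.setReg_reg] at hc'
      refine Run.sta hw z (by simp [St.setReg_reg, h9]) (by norm_num) (by simp) (by omega)
        (by simp; omega) ⟨fun r hr => by simp [St.setReg_reg, hr], 1, ?_, ?_⟩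
      · simp; omega
      · simp [St.setArr, St.setReg_reg]
    · intro hc'
      simp [St.setReg_reg] at hc'
      refine Run.sta hw z (by simp [St.setReg_reg, h9]) (by norm_num) (by simp) (by omega)
        (by simp; omega) ⟨fun r hr => by simp [St.setReg_reg, hr], 0, ?_, ?_⟩
      · simp; omega
      · simp [St.setArr, St.setReg_reg]
  · simp

variable {w n : ℕ} {A : Fin n → ℤ}

theorem addScore_run (hw : 1 ≤ w) {s : St} {B k t X e b : ℕ} (h30 : s.reg 30 = t)
    (h31 : s.reg 31 = B) (h32 : s.reg 32 = k) (h33 : s.reg 33 = X) (he : s.arr 2 t = e) (he1 : e ≤ 1)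
    (hb : B < 2 ^ b) (htw : 16 * (t : ℤ) + 200 < wmax w) (hBw : 16 * (B : ℤ) + 200 < wmax w)
    (hXw : (X + B : ℤ) < wmax w) (htB : (((t / k) * B + B : ℕ) : ℤ) < wmax w) :
    Run w A addScore s (B * (b * 60 + 500) + 200) fun s' =>
      (∀ r, 22 ≤ r → r ≠ 33 → s'.reg r = s.reg r) ∧ (∀ c, c < 8 → s'.arr c = s.arr c) ∧
      s'.reg 33 =
        (X + e * blockLis (fun x => entry A x) B (t / k) (s.arr 0 t) (s.arr 1 t) : ℕ) := by
  have hdiv : (t : ℤ) / k = (t / k : ℕ) := by push_cast; rfl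
  have hdiv' : (t / k : ℕ) ≤ (t : ℤ) := by exact_mod_cast Nat.div_le_self t k
  have hmul : ((t / k : ℕ) : ℤ) * B = (t / k * B : ℕ) := by push_cast; rfl
  have hLB := blockLis_le (fun x => entry A x) B (t / k) (s.arr 0 t) (s.arr 1 t)
  obtain ⟨i, hi⟩ : ∃ i, i = t / k := ⟨_, rfl⟩
  rw [← hi] at hdiv hdiv' hmul htB hLB ⊢
  clear hi
  apply Run.time
  · apply Run.seq
    refine Run.asg hw (by simp) (by norm_num) ?_
    apply Run.seq
    refine Run.asg hw (by simp; omega) (by norm_num) ?_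
    apply Run.seq
    refine Run.asg hw ?_ (by norm_num) ?_
    · simp [St.setReg_reg, h30, h31, h32]
      rw [hdiv, hmul]
      omega
    apply Run.seq
    refine Run.lda hw t (by simp [St.setReg_reg, h30]) (by norm_num) (by simp) (by omega)
      (by norm_num) ?_
    apply Run.seq
    refine Run.lda hw t (by simp [St.setReg_reg, h30]) (by norm_num) (by simp) (by omega)
      (by norm_num) ?_
    set s₁ := ((((s.setReg 20 ((rg 31).eval s)).setReg 21 _).setReg 14 _).setReg 15 _).setReg 16 _
      with hs₁
    have c14 : s₁.reg 14 = (i * B : ℕ) := by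
      simp [hs₁, St.setReg_reg, h30, h31, h32, hdiv]
    have c15 : s₁.reg 15 = s.arr 0 t := by simp [hs₁, St.setReg_reg]
    have c16 : s₁.reg 16 = s.arr 1 t := by simp [hs₁, St.setReg_reg]
    have c20 : s₁.reg 20 = B := by simp [hs₁, St.setReg_reg, h31]
    have c21 : s₁.reg 21 = (1 : ℕ) := by simp [hs₁, St.setReg_reg]
    have carr : s₁.arr = s.arr := by simp [hs₁]
    have cr : ∀ r, 22 ≤ r → s₁.reg r = s.reg r := fun r hr => by
      simp [hs₁, St.setReg_reg, show r ≠ 20 by omega, show r ≠ 21 by omega, show r ≠ 14 by omega,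
        show r ≠ 15 by omega, show r ≠ 16 by omega]
    clear_value s₁
    apply Run.seq
    refine Run.post (Run.forL hw (by norm_num) (by norm_num) (by norm_num) B 100 (by omega)
      (fun j s' => (∀ r, 14 ≤ r → s'.reg r = s₁.reg r) ∧ (∀ c, c < 8 → s'.arr c = s.arr c) ∧
        ∀ z < j, s'.arr 8 z = entry A (i * B + z : ℕ) ∧ s'.arr 9 z = entry A (i * B + z : ℕ) ∧
          (0 < s'.arr 10 z ↔ ¬(s.arr 0 t ≤ entry A (i * B + z : ℕ) ∧
            entry A (i * B + z : ℕ) ≤ s.arr 1 t))) ?_ c20 ?_) ?_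
    · rintro z hz s' ⟨h1, h2, h3⟩ h9 h20
      refine (scoreEntry_run hw (B := B) (i := i) (z := z) (by rw [h1 _ (by norm_num), c14]) h9
        (by omega) (by push_cast at htB ⊢; omega)).post ?_
      rintro s'' ⟨h4, f, h5, h6⟩
      refine ⟨by rw [h4 _ (by norm_num), h9], by rw [h4 _ (by norm_num), h20], fun r hr => ?_,
        fun c hc => ?_, fun z' hz' => ?_⟩
      · rw [St.setReg_reg, if_neg (by omega), h4 r (by omega), h1 r hr]
      · rw [St.setReg_arr, h6]
        simp [St.setArr_arr, show c ≠ 8 by omega, show c ≠ 9 by omega, show c ≠ 10 by omega, h2 c hc]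
      · rw [St.setReg_arr, h6]
        rw [h1 15 (by norm_num), h1 16 (by norm_num), c15, c16] at h5
        simp only [St.setArr_arr, Nat.reduceEqDiff, if_true, if_false]
        by_cases hzz : z' = z
        · subst hzz
          simpa using h5
        · simp only [Function.update_of_ne hzz]
          exact h3 z' (by omega)
    · exact ⟨fun r hr => by rw [St.setReg_reg, if_neg (by omega)],
        fun c _ => by rw [St.setReg_arr, carr], fun z hz => absurd hz (by omega)⟩
    rintro s₂ ⟨h1, h2, h3⟩
    apply Run.seq
    refine (patience_run hw (o := 8) le_rfl (N := B) (k := 1) (b := b) (by rw [h1 _ (by norm_num), c20])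
      (by rw [h1 _ (by norm_num), c21]) one_pos (by omega) (by rw [mul_one]; omega) ?_).post ?_
    · intro z hz _
      rw [(h3 z (by omega)).1, (h3 z (by omega)).2.1]
    rintro s₃ ⟨a1, a2, L, r, a3, a4, a5, a6, a7⟩
    have hL := a7.eq_lisOn a6 fun z hz _ => by
      rw [(h3 z (by omega)).1, (h3 z (by omega)).2.1]
    have hL' : L = blockLis (fun x => entry A x) B i (s.arr 0 t) (s.arr 1 t) := by
      rw [hL, blockLis, mul_one]
      rw [lisOn_congr (a := s₂.arr 8) (b := fun z => entry A (i * B + z : ℕ))]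
      · congr 1
        apply Finset.filter_congr
        intro z hz
        rw [(h3 z (by simpa using hz)).2.2, not_not]
      · intro z hz
        simp only [Finset.mem_filter, Finset.mem_range] at hz
        exact (h3 z hz.1).1
    have d2 : s₃.arr 2 t = e := by
      rw [a2 2 (by norm_num) (by norm_num), h2 2 (by norm_num), he]
    have d30 : s₃.reg 30 = t := by
      rw [a1 _ (by norm_num), h1 _ (by norm_num), cr _ (by norm_num), h30]
    have d33 : s₃.reg 33 = X := by
      rw [a1 _ (by norm_num), h1 _ (by norm_num), cr _ (by norm_num), h33]
    have heL : e * L ≤ L := by nlinarith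
    apply Run.seq
    refine Run.lda hw t (by simp [d30]) (by norm_num) (by simp) (by omega) (by norm_num) ?_
    refine Run.asg hw ?_ (by norm_num) ?_
    · simp [St.setReg_reg, d33, a3, d2]
      have : (e : ℤ) * L = (e * L : ℕ) := by push_cast; rfl
      rw [this]
      omega
    · refine ⟨fun r hr hr' => ?_, fun c hc => ?_, ?_⟩
      · rw [St.setReg_reg, if_neg hr', St.setReg_reg, if_neg (by omega), a1 _ (by omega),
          h1 _ (by omega), cr _ hr]
      · rw [St.setReg_arr, St.setReg_arr, a2 c (by omega) (by omega), h2 c hc]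
      · simp [St.setReg_reg, d33, a3, d2, hL']
  · simp
    have : B * (b * 60 + 500) = B * (100 + 9) + B * (b * 60 + 318 + 30) + B * 43 := by ring
    rw [this]
    omega

section Rules

variable {w n : ℕ} {A : Fin n → ℤ} (hw : 1 ≤ w)
include hw

/-- Each value drawn may get its own bound `g v`. The rule for sequences wants an intermediate
potential defined on all states, and the infimum of all valid bounds for `q` is one. -/
theorem ExpLe.rnd_seq {d : ℕ} {e : Expr} {q : Prog} {s : St} {T T' : ℕ} {G : St → ℝ≥0∞} (m : ℕ)
    (hT : e.size + 2 + T + 1 ≤ T') (hm : e.eval s = m) (h : e.ok w s) (hd : d < 100) (g : ℕ → ℝ≥0∞)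
    (hq : ∀ v ≤ m, ExpLe w A q (s.setReg d v) T G (g v)) :
    ExpLe w A (WordRAM.rnd d e ;; q) s T' G
      ((∑ v ∈ Finset.range (m + 1), g v) / ((m + 1 : ℕ) : ℝ≥0∞)) := by
  have key : ∀ s', ExpLe w A q s' T G (⨅ (r) (_ : ExpLe w A q s' T G r), r) := by
    intro s' σ hσ k t F hF
    exact le_iInf fun r => le_iInf fun hr => hr σ hσ k t F hF
  refine (ExpLe.seq (ExpLe.rnd hw m hm h hd) key).weaken hT (fun _ => .inl le_rfl) ?_
  gcongr with v hv
  exact iInf₂_le _ (hq v (by simpa [Nat.lt_succ_iff] using hv))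

theorem ExpLe.asg_seq {d : ℕ} {e : Expr} {q : Prog} {s : St} {T T' : ℕ} {G : St → ℝ≥0∞} {r : ℝ≥0∞}
    (hT : e.size + 2 + T + 1 ≤ T') (h : e.ok w s) (hd : d < 100)
    (hq : ExpLe w A q (s.setReg d (e.eval s)) T G r) : ExpLe w A (WordRAM.asg d e ;; q) s T' G r :=
  (ExpLe.run_seq (Run.asg hw h hd hq)).weaken hT (fun _ => .inl le_rfl) le_rfl

end Rules

/-! ## Sampling -/

/-- Take for every item (there are as many as register `34` says) the values at two random positions
of its block as left and right end, and flag it if these are in the wrong order. -/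
def fill : Prog := forL 30 34 (
  asg 14 (rg 30 / rg 32 * rg 31) ;; rnd 1 (rg 31 - ct 1) ;; rnd 2 (rg 31 - ct 1) ;;
  inp 1 (rg 14 + rg 1) ;; inp 2 (rg 14 + rg 2) ;; sta 0 (rg 30) (rg 1) ;; sta 1 (rg 30) (rg 2) ;;
  ifL (rg 2) (rg 1) (sta 2 (rg 30) (ct 1)) (sta 2 (rg 30) (ct 0)))

/-- Take for every item (there are as many as register `20` says) the value at a random position of
its block of length register `31`. -/
def thin : Prog := forL 30 20 (
  asg 14 (rg 30 * rg 31) ;; rnd 1 (rg 31 - ct 1) ;; inp 1 (rg 14 + rg 1) ;;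
  sta 8 (rg 30) (rg 1) ;; sta 9 (rg 30) (rg 1) ;; sta 10 (rg 30) (ct 0))

variable {w n : ℕ} {A : Fin n → ℤ}

theorem fillTail_run (hw : 1 ≤ w) {s : St} {t i B a b : ℕ} (h30 : s.reg 30 = t)
    (h14 : s.reg 14 = (i * B : ℕ)) (h1 : s.reg 1 = a) (h2 : s.reg 2 = b) (ha : a < B) (hb : b < B)
    (ht : 16 * (t : ℤ) + 64 < wmax w) (hi : ((i * B + B : ℕ) : ℤ) < wmax w) :
    Run w A (inp 1 (rg 14 + rg 1) ;; inp 2 (rg 14 + rg 2) ;; sta 0 (rg 30) (rg 1) ;;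
      sta 1 (rg 30) (rg 2) ;; ifL (rg 2) (rg 1) (sta 2 (rg 30) (ct 1)) (sta 2 (rg 30) (ct 0))) s 100
      fun s' => (∀ r, 15 ≤ r → s'.reg r = s.reg r) ∧
        s'.arr = (((s.setArr 0 t (entry A (i * B + a : ℕ))).setArr 1 t
        (entry A (i * B + b : ℕ))).setArr 2 t
        (if entry A (i * B + b : ℕ) < entry A (i * B + a : ℕ) then 1 else 0)).arr := by
  have e1 : s.reg 14 + s.reg 1 = (i * B + a : ℕ) := by rw [h14, h1]; push_cast; ring
  have e2 : s.reg 14 + s.reg 2 = (i * B + b : ℕ) := by rw [h14, h2]; push_cast; ring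
  apply Run.time
  · apply Run.seq
    refine Run.inp hw (by simp [e1]; omega) (by norm_num) ?_
    rw [eval_add, eval_rg, eval_rg, e1]
    apply Run.seq
    refine Run.inp hw (by simp [St.setReg_reg, e2]; omega) (by norm_num) ?_
    rw [eval_add, eval_rg, eval_rg, St.setReg_reg, if_neg (by norm_num), St.setReg_reg,
      if_neg (by norm_num), e2]
    generalize entry A (i * B + a : ℕ) = v
    generalize entry A (i * B + b : ℕ) = v'
    apply Run.seq
    refine Run.sta hw t (by simp [St.setReg_reg, h30]) (by norm_num) (by simp) (by omega)
      (by simp) ?_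
    apply Run.seq
    refine Run.sta hw t (by simp [St.setReg_reg, h30]) (by norm_num) (by simp) (by omega)
      (by simp) ?_
    apply Run.ifL hw (by simp) (by simp)
    · intro hc
      simp [St.setReg_reg] at hc
      refine Run.sta hw t (by simp [St.setReg_reg, h30]) (by norm_num) (by simp) (by omega)
        (by simp; omega) ⟨fun r hr => ?_, ?_⟩
      · simp [St.setReg_reg, show r ≠ 1 by omega, show r ≠ 2 by omega]
      · simp [St.setArr, St.setReg_reg, hc]
    · intro hc
      simp [St.setReg_reg] at hc
      refine Run.sta hw t (by simp [St.setReg_reg, h30]) (by norm_num) (by simp) (by omega)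
        (by simp; omega) ⟨fun r hr => ?_, ?_⟩
      · simp [St.setReg_reg, show r ≠ 1 by omega, show r ≠ 2 by omega]
      · simp [St.setArr, St.setReg_reg, hc.not_gt]
  · simp

open Classical in
-- `Ψ` may depend only on the interval ends, which are all that the drawn positions leave behind.
-- `hΨ` says that drawing both ends of item `t` does not increase it on average.
theorem fill_expLe (hw : 1 ≤ w) {s : St} {B k M : ℕ} (h31 : s.reg 31 = B) (h32 : s.reg 32 = k)
    (h34 : s.reg 34 = M) (hB : 0 < B) (hM : 16 * (M : ℤ) + 64 < wmax w)
    (hMB : ∀ t < M, ((t / k * B + B : ℕ) : ℤ) < wmax w) (Ψ : ℕ → (ℕ → ℤ) → (ℕ → ℤ) → ℝ≥0∞)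
    (hΨ : ∀ t < M, ∀ l u,
      (∑ a ∈ Finset.range B, (∑ b ∈ Finset.range B,
        Ψ (t + 1) (Function.update l t (entry A (t / k * B + a : ℕ)))
          (Function.update u t (entry A (t / k * B + b : ℕ)))) / (B : ℝ≥0∞)) / (B : ℝ≥0∞) ≤ Ψ t l u)
    {G : St → ℝ≥0∞} (hG : ∀ s', (∀ r, 31 ≤ r → s'.reg r = s.reg r) →
      (∀ c, 3 ≤ c → s'.arr c = s.arr c) →
      (∀ t < M, s'.arr 2 t = if s'.arr 1 t < s'.arr 0 t then 1 else 0) →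
      G s' ≤ Ψ M (s'.arr 0) (s'.arr 1)) :
    ExpLe w A fill s (M * 150 + 5) G (Ψ 0 (s.arr 0) (s.arr 1)) := by
  have h := ExpLe.forL (w := w) (A := A) hw (i := 30) (b := 34) (p :=
    asg 14 (rg 30 / rg 32 * rg 31) ;; rnd 1 (rg 31 - ct 1) ;; rnd 2 (rg 31 - ct 1) ;;
    inp 1 (rg 14 + rg 1) ;; inp 2 (rg 14 + rg 2) ;; sta 0 (rg 30) (rg 1) ;; sta 1 (rg 30) (rg 2) ;;
    ifL (rg 2) (rg 1) (sta 2 (rg 30) (ct 1)) (sta 2 (rg 30) (ct 0))) (by norm_num) (by norm_num)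
    M 141 (by omega) (fun t s' => if (∀ r, 31 ≤ r → s'.reg r = s.reg r) ∧
      (∀ c, 3 ≤ c → s'.arr c = s.arr c) ∧
      (∀ t' < t, s'.arr 2 t' = if s'.arr 1 t' < s'.arr 0 t' then 1 else 0) then
      Ψ t (s'.arr 0) (s'.arr 1) else ⊤) ?_ s h34 (by norm_num)
  · refine h.weaken le_rfl (fun s' => .inl ?_) ?_
    · split_ifs with hc
      · exact hG s' hc.1 hc.2.1 hc.2.2
      · exact le_top
    · rw [if_pos ⟨fun r hr => by rw [St.setReg_reg, if_neg (by omega)], fun _ _ => rfl,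
        fun t ht => absurd ht (by omega)⟩]
      rfl
  · intro t ht s' hs' h30 h34'
    split_ifs at hs' with hc
    · obtain ⟨h1, h2, h3⟩ := hc
      rw [if_pos ⟨h1, h2, h3⟩]
      have e31 : s'.reg 31 = B := by rw [h1 31 le_rfl, h31]
      have e32 : s'.reg 32 = k := by rw [h1 32 (by norm_num), h32]
      have hdiv : (t : ℤ) / k = (t / k : ℕ) := by push_cast; rfl
      have hdiv' : (t / k : ℕ) ≤ (t : ℤ) := by exact_mod_cast Nat.div_le_self t k
      have hmul : ((t / k : ℕ) : ℤ) * B = (t / k * B : ℕ) := by push_cast; rfl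
      have hMB' := hMB t ht
      have hΨ' := hΨ t ht (s'.arr 0) (s'.arr 1)
      obtain ⟨i, hi⟩ : ∃ i, i = t / k := ⟨_, rfl⟩
      rw [← hi] at hdiv hdiv' hmul hMB' hΨ'
      clear hi
      have hB1 : (B - 1 : ℕ) + 1 = B := by omega
      have hB2 : (((B - 1 : ℕ) : ℕ) : ℤ) = (B : ℤ) - 1 := by omega
      refine ExpLe.weaken (r := (∑ a ∈ Finset.range (B - 1 + 1), (∑ b ∈ Finset.range (B - 1 + 1),
          Ψ (t + 1) (Function.update (s'.arr 0) t (entry A (i * B + a : ℕ)))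
            (Function.update (s'.arr 1) t (entry A (i * B + b : ℕ)))) / ((B - 1 + 1 : ℕ) : ℝ≥0∞)) /
            ((B - 1 + 1 : ℕ) : ℝ≥0∞)) (T := 141)
          ?_ (by simp) (fun _ => .inl le_rfl) (by rw [hB1]; exact hΨ')
      apply ExpLe.asg_seq hw (T := 120)
      · simp
      · simp [h30, e32, e31]
        rw [hdiv, hmul]
        omega
      · norm_num
      apply ExpLe.rnd_seq (d := 1) (e := rg 31 - ct 1) (T := 110) hw (B - 1)
      · simp
      · simp [St.setReg_reg, e31]; omega
      · simp [St.setReg_reg, e31]; omega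
      · norm_num
      intro a ha
      apply ExpLe.rnd_seq (d := 2) (e := rg 31 - ct 1) (T := 100) hw (B - 1)
      · simp
      · simp [St.setReg_reg, e31]; omega
      · simp [St.setReg_reg, e31]; omega
      · norm_num
      intro b hb
      refine (fillTail_run hw (t := t) (i := i) (B := B) (a := a) (b := b)
        (by simp [St.setReg_reg, h30]) (by simp [St.setReg_reg, h30, e31, e32, hdiv])
        (by simp [St.setReg_reg]) (by simp [St.setReg_reg]) (by omega) (by omega) (by omega)
        hMB').expLe ?_
      rintro s'' ⟨h4, h5⟩
      rw [if_pos, if_pos]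
      · rw [St.setReg_arr, h5]
        simp [St.setArr]
      · refine ⟨fun r hr => ?_, fun c hc => ?_, fun t' ht' => ?_⟩
        · rw [St.setReg_reg, if_neg (by omega), h4 r (by omega)]
          simp [St.setReg_reg, show r ≠ 1 by omega, show r ≠ 2 by omega, show r ≠ 14 by omega,
            h1 r hr]
        · rw [St.setReg_arr, h5]
          simp [St.setArr_arr, show c ≠ 0 by omega, show c ≠ 1 by omega, show c ≠ 2 by omega, h2 c hc]
        · rw [St.setReg_arr, h5]
          simp only [St.setArr_arr, if_true, if_false, OfNat.ofNat_ne_zero,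
            OfNat.ofNat_ne_one, zero_ne_one, OfNat.zero_ne_ofNat, OfNat.one_ne_ofNat, St.setReg_arr, one_ne_zero]
          by_cases htt : t' = t
          · subst htt
            simp
          · simp only [Function.update_of_ne htt]
            exact h3 t' (by omega)
      · constructor
        · rw [h4 _ (by norm_num)]
          simp [St.setReg_reg, h30]
        · rw [h4 _ (by norm_num)]
          simp [St.setReg_reg, h34']
    · simp at hs'

open Classical in
theorem thin_expLe (hw : 1 ≤ w) {s : St} {g N : ℕ} (h31 : s.reg 31 = g) (h20 : s.reg 20 = N)
    (hg : 0 < g) (hN : 16 * (N : ℤ) + 64 < wmax w) (hNg : ((N * g : ℕ) : ℤ) < wmax w)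
    (Ψ : ℕ → (ℕ → ℤ) → ℝ≥0∞)
    (hΨ : ∀ t < N, ∀ v, (∑ a ∈ Finset.range g,
        Ψ (t + 1) (Function.update v t (entry A (t * g + a : ℕ)))) / (g : ℝ≥0∞) ≤ Ψ t v)
    {G : St → ℝ≥0∞} (hG : ∀ s', (∀ r, r = 20 ∨ 31 ≤ r → s'.reg r = s.reg r) → s'.arr 9 = s'.arr 8 →
      (∀ t < N, s'.arr 10 t = 0 ∧ ∃ a < g, s'.arr 8 t = entry A (t * g + a : ℕ)) →
      G s' ≤ Ψ N (s'.arr 8)) (h98 : s.arr 9 = s.arr 8) :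
    ExpLe w A thin s (N * 150 + 5) G (Ψ 0 (s.arr 8)) := by
  have h := ExpLe.forL (w := w) (A := A) hw (i := 30) (b := 20) (p :=
    asg 14 (rg 30 * rg 31) ;; rnd 1 (rg 31 - ct 1) ;; inp 1 (rg 14 + rg 1) ;;
    sta 8 (rg 30) (rg 1) ;; sta 9 (rg 30) (rg 1) ;; sta 10 (rg 30) (ct 0)) (by norm_num) (by norm_num)
    N 141 (by omega) (fun t s' => if (∀ r, r = 20 ∨ 31 ≤ r → s'.reg r = s.reg r) ∧
      s'.arr 9 = s'.arr 8 ∧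
      (∀ t' < t, s'.arr 10 t' = 0 ∧ ∃ a < g, s'.arr 8 t' = entry A (t' * g + a : ℕ)) then
      Ψ t (s'.arr 8) else ⊤) ?_ s h20 (by norm_num)
  · refine h.weaken le_rfl (fun s' => .inl ?_) ?_
    · split_ifs with hc
      · exact hG s' hc.1 hc.2.1 hc.2.2
      · exact le_top
    · rw [if_pos ⟨fun r hr => by rw [St.setReg_reg, if_neg (by omega)], h98,
        fun t ht => absurd ht (by omega)⟩]
      rfl
  · intro t ht s' hs' h30 h20'
    split_ifs at hs' with hc
    · obtain ⟨h1, h2, h3⟩ := hc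
      rw [if_pos ⟨h1, h2, h3⟩]
      have e31 : s'.reg 31 = g := by rw [h1 31 (.inr le_rfl), h31]
      have hmul : (t : ℤ) * g = (t * g : ℕ) := by push_cast; rfl
      have htg : t * g + g ≤ N * g := by rw [← Nat.succ_mul]; exact Nat.mul_le_mul_right g ht
      have hΨ' := hΨ t ht (s'.arr 8)
      have hB1 : (g - 1 : ℕ) + 1 = g := by omega
      refine ExpLe.weaken (r := (∑ a ∈ Finset.range (g - 1 + 1),
          Ψ (t + 1) (Function.update (s'.arr 8) t (entry A (t * g + a : ℕ)))) /
            ((g - 1 + 1 : ℕ) : ℝ≥0∞)) (T := 141)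
          ?_ (by simp) (fun _ => .inl le_rfl) (by rw [hB1]; exact hΨ')
      apply ExpLe.asg_seq hw (T := 120)
      · simp
      · simp [h30, e31]
        rw [hmul]
        omega
      · norm_num
      apply ExpLe.rnd_seq (d := 1) (e := rg 31 - ct 1) (T := 100) hw (g - 1)
      · simp
      · simp [St.setReg_reg, e31]; omega
      · simp [St.setReg_reg, e31]; omega
      · norm_num
      intro a ha
      have key : Run w A (inp 1 (rg 14 + rg 1) ;; sta 8 (rg 30) (rg 1) ;; sta 9 (rg 30) (rg 1) ;;
          sta 10 (rg 30) (ct 0))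
          ((s'.setReg 14 ((rg 30 * rg 31).eval s')).setReg 1 a) 100 fun s'' =>
          (∀ r, 15 ≤ r → s''.reg r = s'.reg r) ∧
          s''.arr = (((s'.setArr 8 t (entry A (t * g + a : ℕ))).setArr 9 t
            (entry A (t * g + a : ℕ))).setArr 10 t 0).arr := by
        have e1 : (t : ℤ) * g + a = (t * g + a : ℕ) := by push_cast; ring
        apply Run.time
        · apply Run.seq
          refine Run.inp hw (by simp [St.setReg_reg, h30, e31]; rw [e1]; omega) (by norm_num) ?_
          apply Run.seq
          refine Run.sta hw t (by simp [St.setReg_reg, h30]) (by norm_num) (by simp) (by omega)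
            (by simp) ?_
          apply Run.seq
          refine Run.sta hw t (by simp [St.setReg_reg, h30]) (by norm_num) (by simp) (by omega)
            (by simp) ?_
          refine Run.sta hw t (by simp [St.setReg_reg, h30]) (by norm_num) (by simp) (by omega)
            (by simp; omega) ⟨fun r hr => ?_, ?_⟩
          · simp [St.setReg_reg, show r ≠ 1 by omega, show r ≠ 14 by omega]
          · simp [St.setArr, St.setReg_reg, h30, e31]
        · simp
      refine key.expLe ?_
      rintro s'' ⟨h4, h5⟩
      rw [if_pos, if_pos]
      · rw [St.setReg_arr, h5]
        simp [St.setArr]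
      · refine ⟨fun r hr => ?_, ?_, fun t' ht' => ?_⟩
        · rw [St.setReg_reg, if_neg (by omega), h4 r (by omega), h1 r hr]
        · rw [St.setReg_arr, h5]
          simp [St.setArr_arr, h2]
        · rw [St.setReg_arr, h5]
          by_cases htt : t' = t
          · subst htt
            refine ⟨by simp [St.setArr_arr], a, by omega, by simp [St.setArr_arr]⟩
          · have := h3 t' (by omega)
            simpa [St.setArr_arr, Function.update_of_ne htt] using this
      · constructor
        · rw [h4 _ (by norm_num), h30]
        · rw [h4 _ (by norm_num), h20']
    · simp at hs'

/-! ### Chains of intervals and increasing subsequences -/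

/-- Optimal subsequences inside the intervals of a chain concatenate: positions increase with the
blocks and values with the intervals. No chain can therefore score more than the whole array,
whatever was drawn. -/
theorem ItemChain.sum_blockLis_le {a : ℕ → ℤ} {B k n : ℕ} {l u : ℕ → ℤ} {P : Finset ℕ}
    (hP : ItemChain k l u P) (hn : ∀ t ∈ P, t / k * B + B ≤ n) :
    ∑ t ∈ P, blockLis a B (t / k) (l t) (u t) ≤ lisOn a (Finset.range n) := by
  classical
  have h := fun t => exists_lisOn (fun z => a (t / k * B + z))
    ((Finset.range B).filter fun z => l t ≤ a (t / k * B + z) ∧ a (t / k * B + z) ≤ u t)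
  choose T hT hm hc using h
  have hT' : ∀ t, ∀ z ∈ T t, z < B ∧ l t ≤ a (t / k * B + z) ∧ a (t / k * B + z) ≤ u t :=
    fun t z hz => by simpa using hT t hz
  have hlt : ∀ t t' z z', t / k < t' / k → z < B → t / k * B + z < t' / k * B + z' := by
    intro t t' z z' h hz
    have := Nat.mul_le_mul_right B (Nat.succ_le_of_lt h)
    rw [Nat.succ_mul] at this
    omega
  have hcard : (P.biUnion fun t => (T t).image (t / k * B + ·)).card =
      ∑ t ∈ P, blockLis a B (t / k) (l t) (u t) := by
    rw [Finset.card_biUnion]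
    · refine Finset.sum_congr rfl fun t _ => ?_
      rw [Finset.card_image_of_injective _ fun x y h => by simpa using h, hc]
      rfl
    · intro t ht t' ht' hne
      simp only [Function.onFun, Finset.disjoint_left]
      intro z hz hz'
      simp only [Finset.mem_image] at hz hz'
      obtain ⟨z, hz, rfl⟩ := hz
      obtain ⟨z', hz', he⟩ := hz'
      rcases hP t ht t' ht' hne with h | h
      · have := hlt _ _ z z' h.1 (hT' t z hz).1
        omega
      · have := hlt _ _ z' z h.1 (hT' t' z' hz').1
        omega
  rw [← hcard]
  apply le_lisOn
  · intro z hz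
    simp only [Finset.mem_biUnion, Finset.mem_image] at hz
    obtain ⟨t, ht, z, hz, rfl⟩ := hz
    have := hn t ht
    have := (hT' t z hz).1
    simp only [Finset.mem_range]
    omega
  · intro z hz z' hz' hzz
    simp only [Finset.mem_coe, Finset.mem_biUnion, Finset.mem_image] at hz hz'
    obtain ⟨t, ht, z, hz, rfl⟩ := hz
    obtain ⟨t', ht', z', hz', rfl⟩ := hz'
    by_cases htt : t = t'
    · subst htt
      exact hm t hz hz' (by simpa using hzz)
    · have h1 := (hT' t z hz).2.2
      have h2 := (hT' t' z' hz').2.1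
      rcases hP t ht t' ht' htt with h | h
      · exact h1.trans_lt (h.2.trans_le h2)
      · have := hlt _ _ z' z h.1 (hT' t' z' hz').1
        omega

/-! ### Random items that hit an optimal subsequence -/

/-- Take the first and the last `m` elements, where `m` is a third of `h`, rounded up. From any of
the former to any of the latter there are at least `h - 2 * m + 2` elements, ends included, which is
at least a third. -/
theorem exists_outer_thirds (H : Finset ℕ) : ∃ F ⊆ H, ∃ L ⊆ H, H.card ≤ 3 * F.card ∧
    H.card ≤ 3 * L.card ∧ ∀ p ∈ F, ∀ q ∈ L, p ≤ q ∧
      H.card ≤ 3 * (H.filter fun z => p ≤ z ∧ z ≤ q).card := by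
  obtain ⟨h, hh⟩ : ∃ h, H.card = h := ⟨_, rfl⟩
  obtain ⟨m, hm⟩ : ∃ m, m = (h + 2) / 3 := ⟨_, rfl⟩
  let e := H.orderEmbOfFin hh
  have he : ∀ i, e i ∈ H := fun i => Finset.orderEmbOfFin_mem H hh i
  refine ⟨(Finset.univ.filter fun i : Fin h => (i : ℕ) < m).map e.toEmbedding, ?_,
    (Finset.univ.filter fun i : Fin h => h - m ≤ (i : ℕ)).map e.toEmbedding, ?_, ?_, ?_, ?_⟩
  · intro z hz
    obtain ⟨i, -, rfl⟩ := Finset.mem_map.1 hz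
    exact he i
  · intro z hz
    obtain ⟨i, -, rfl⟩ := Finset.mem_map.1 hz
    exact he i
  · rw [Finset.card_map, Fin.card_filter_val_lt]
    omega
  · rw [Finset.card_map]
    have h1 : (Finset.univ.filter fun i : Fin h => h - m ≤ (i : ℕ)).card +
        (Finset.univ.filter fun i : Fin h => (i : ℕ) < h - m).card = h := by
      have := Finset.card_filter_add_card_filter_not (s := (Finset.univ : Finset (Fin h)))
        (p := fun i => h - m ≤ (i : ℕ))
      simpa only [not_le, Finset.card_univ, Fintype.card_fin] using this
    rw [Fin.card_filter_val_lt] at h1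
    omega
  · intro p hp q hq
    obtain ⟨i, hi, rfl⟩ := Finset.mem_map.1 hp
    obtain ⟨j, hj, rfl⟩ := Finset.mem_map.1 hq
    simp only [Finset.mem_filter, Finset.mem_univ, true_and] at hi hj
    have hj' := j.2
    have hi' := i.2
    refine ⟨e.monotone (Fin.le_def.2 (by omega)), ?_⟩
    have h1 : (Finset.Icc i j).map e.toEmbedding ⊆ H.filter fun z => e i ≤ z ∧ z ≤ e j := by
      intro z hz
      obtain ⟨y, hy, rfl⟩ := Finset.mem_map.1 hz
      rw [Finset.mem_Icc] at hy
      exact Finset.mem_filter.2 ⟨he y, e.monotone hy.1, e.monotone hy.2⟩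
    have h2 := Finset.card_le_card h1
    rw [Finset.card_map, Fin.card_Icc] at h2
    simp only [RelEmbedding.coe_toEmbedding]
    omega

/-- In each block `i ∈ S` a random interval hits `i` with probability at least `1 / k`; intervals
which hit their blocks form a chain, and their scores are at least a third of `h i`. -/
structure Hits (a : ℕ → ℤ) (B k : ℕ) (S : Finset ℕ) (h : ℕ → ℕ) (hit : ℕ → ℤ → ℤ → Prop) :
    Prop where
  le : ∀ i ∈ S, h i ≤ B
  score : ∀ i ∈ S, ∀ v v', hit i v v' → v ≤ v' ∧ h i ≤ 3 * blockLis a B i v v'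
  chain : ∀ i ∈ S, ∀ i' ∈ S, i < i' → ∀ v v' y y', hit i v v' → hit i' y y' → v' < y
  prob : ∀ i ∈ S, ∃ E ⊆ Finset.range B ×ˢ Finset.range B,
    (∀ z ∈ E, hit i (a (i * B + z.1)) (a (i * B + z.2))) ∧ B * B ≤ k * E.card

/-- `S` consists of the blocks in which the optimal subsequence has at least `B / (2 * q)` entries.
The others lose at most `N * B / (2 * q)`, hence at most half of the length, and the rest behind the
last full block loses at most `N`, a quarter. In a block of `S` either outer third has at least `B /
(6 * q)` entries, whence the probability. A hit is defined by values and not by positions, since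
only values are stored. -/
theorem exists_hits (a : ℕ → ℤ) {n N B q : ℕ} (hn : n ≤ N * B + N)
    (hNB : N * B ≤ n) (hq : n ≤ q * lisOn a (Finset.range n)) (hN : 4 * N ≤ lisOn a (Finset.range n)) :
    ∃ (S : Finset ℕ) (h : ℕ → ℕ) (hit : ℕ → ℤ → ℤ → Prop), (∀ i ∈ S, i < N) ∧
      Hits a B (36 * q ^ 2) S h hit ∧ lisOn a (Finset.range n) ≤ 4 * ∑ i ∈ S, h i := by
  classical
  obtain ⟨O, hO, hm, hc⟩ := exists_lisOn a (Finset.range n)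
  rw [← hc] at hq hN ⊢
  let H : ℕ → Finset ℕ := fun i => (Finset.range B).filter fun z => i * B + z ∈ O
  have hH : ∀ i z, z ∈ H i ↔ z < B ∧ i * B + z ∈ O := fun i z => by simp [H]
  have hHB : ∀ i, (H i).card ≤ B := fun i => by
    simpa using Finset.card_filter_le (Finset.range B) fun z => i * B + z ∈ O
  choose F hF L hL hF3 hL3 hFL using fun i => exists_outer_thirds (H i)
  have hFO : ∀ i, ∀ z ∈ F i, z < B ∧ i * B + z ∈ O := fun i z hz => (hH i z).1 (hF i hz)
  have hLO : ∀ i, ∀ z ∈ L i, z < B ∧ i * B + z ∈ O := fun i z hz => (hH i z).1 (hL i hz)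
  refine ⟨(Finset.range N).filter fun i => B ≤ 2 * q * (H i).card, fun i => (H i).card,
    fun i v v' => ∃ p ∈ F i, ∃ p' ∈ L i, v = a (i * B + p) ∧ v' = a (i * B + p'), ?_,
    ⟨fun i _ => hHB i, ?_, ?_, ?_⟩, ?_⟩
  · intro i hi
    simpa using (Finset.mem_filter.1 hi).1
  · rintro i - v v' ⟨p, hp, p', hp', rfl, rfl⟩
    obtain ⟨h1, h2⟩ := hFL i p hp p' hp'
    refine ⟨hm.monotoneOn (hFO i p hp).2 (hLO i p' hp').2 (by omega), h2.trans ?_⟩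
    refine Nat.mul_le_mul_left 3 (le_lisOn ?_ ?_)
    · intro z hz
      obtain ⟨hz, h3, h4⟩ := Finset.mem_filter.1 hz
      have hz := (hH i z).1 hz
      simp only [Finset.mem_filter, Finset.mem_range]
      exact ⟨hz.1, hm.monotoneOn (hFO i p hp).2 hz.2 (by omega),
        hm.monotoneOn hz.2 (hLO i p' hp').2 (by omega)⟩
    · intro z hz z' hz' hzz
      have hz := (hH i z).1 (Finset.mem_filter.1 hz).1
      have hz' := (hH i z').1 (Finset.mem_filter.1 hz').1
      exact hm hz.2 hz'.2 (by omega)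
  · rintro i - i' - hii v v' y y' ⟨p, hp, p', hp', rfl, rfl⟩ ⟨r, hr, r', hr', rfl, rfl⟩
    refine hm (hLO i p' hp').2 (hFO i' r hr).2 ?_
    have := Nat.mul_le_mul_right B (Nat.succ_le_of_lt hii)
    rw [Nat.succ_mul] at this
    have := (hLO i p' hp').1
    omega
  · intro i hi
    refine ⟨F i ×ˢ L i, ?_, ?_, ?_⟩
    · refine Finset.product_subset_product (fun z hz => ?_) (fun z hz => ?_)
      · simpa using (hFO i z hz).1
      · simpa using (hLO i z hz).1
    · intro z hz
      rw [Finset.mem_product] at hz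
      exact ⟨z.1, hz.1, z.2, hz.2, rfl, rfl⟩
    · have hi := (Finset.mem_filter.1 hi).2
      rw [Finset.card_product]
      calc B * B ≤ (2 * q * (H i).card) * (2 * q * (H i).card) := Nat.mul_le_mul hi hi
        _ = 4 * q ^ 2 * ((H i).card * (H i).card) := by ring
        _ ≤ 4 * q ^ 2 * (3 * (F i).card * (3 * (L i).card)) :=
          Nat.mul_le_mul_left _ (Nat.mul_le_mul (hF3 i) (hL3 i))
        _ = 36 * q ^ 2 * ((F i).card * (L i).card) := by ring
  · have h1 : O.card ≤ ∑ i ∈ Finset.range N, (H i).card + N := by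
      have h2 : O ⊆ ((Finset.range N).biUnion fun i => (H i).image (i * B + ·)) ∪
          Finset.Ico (N * B) n := by
        intro z hz
        have hzn := Finset.mem_range.1 (hO hz)
        simp only [Finset.mem_union, Finset.mem_biUnion, Finset.mem_image, Finset.mem_Ico,
          Finset.mem_range]
        by_cases h : z < N * B
        · left
          have hB : 0 < B := Nat.pos_of_ne_zero (by rintro rfl; simp at h)
          have h3 := Nat.div_add_mod' z B
          refine ⟨z / B, (Nat.div_lt_iff_lt_mul hB).2 h, z % B, (hH _ _).2 ⟨Nat.mod_lt _ hB, ?_⟩, h3⟩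
          rwa [h3]
        · exact .inr ⟨by omega, hzn⟩
      refine (Finset.card_le_card h2).trans ((Finset.card_union_le _ _).trans (add_le_add ?_ ?_))
      · exact Finset.card_biUnion_le.trans (Finset.sum_le_sum fun i _ => Finset.card_image_le)
      · rw [Nat.card_Ico]
        omega
    have h2 := Finset.sum_filter_add_sum_filter_not (Finset.range N)
      (fun i => B ≤ 2 * q * (H i).card) fun i => (H i).card
    have h3 : 2 * q * ∑ i ∈ (Finset.range N).filter (fun i => ¬B ≤ 2 * q * (H i).card),
        (H i).card ≤ N * B := by
      rw [Finset.mul_sum]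
      refine (Finset.sum_le_card_nsmul _ _ B fun i hi => ?_).trans ?_
      · have := (Finset.mem_filter.1 hi).2
        omega
      · rw [smul_eq_mul]
        refine Nat.mul_le_mul_right B ((Finset.card_filter_le _ _).trans ?_)
        simp
    have h4 : q * (2 * ∑ i ∈ (Finset.range N).filter (fun i => ¬B ≤ 2 * q * (H i).card),
        (H i).card) ≤ q * O.card := by
      refine le_trans (le_of_eq ?_) (h3.trans (hNB.trans hq))
      ring
    rcases Nat.eq_zero_or_pos q with rfl | hq0
    · rcases Nat.eq_zero_or_pos O.card with h | h
      · omega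
      · exfalso
        have : O.card ≤ n := by simpa using Finset.card_le_card hO
        omega
    · have h5 := Nat.le_of_mul_le_mul_left h4 hq0
      change _ ≤ 4 * ∑ i ∈ (Finset.range N).filter (fun i => B ≤ 2 * q * (H i).card), (H i).card
      omega

/-! ### Concentration of the weight of the blocks that are hit -/

open Classical in
/-- An upper bound for the probability that no item of block `i` will hit if the first `t` items
are known. -/
noncomputable def missProb (k : ℕ) (hit : ℕ → ℤ → ℤ → Prop) (i t : ℕ) (l u : ℕ → ℤ) : ℝ :=
  if ∃ t' < t, t' / k = i ∧ hit i (l t') (u t') then 0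
  else (1 - 1 / (k : ℝ)) ^ (i * k + k - max t (i * k))

section
variable {k : ℕ} {hit : ℕ → ℤ → ℤ → Prop}

theorem missProb_nonneg (hk : 0 < k) (i t : ℕ) (l u : ℕ → ℤ) : 0 ≤ missProb k hit i t l u := by
  unfold missProb
  split_ifs
  · exact le_rfl
  · refine pow_nonneg (sub_nonneg.2 ?_) _
    rw [div_le_one (by positivity)]
    exact_mod_cast hk

theorem missProb_zero_le (hk : 0 < k) (i : ℕ) (l u : ℕ → ℤ) : missProb k hit i 0 l u ≤ 1 / 2 := by
  have h1 : i * k + k - max 0 (i * k) = k := by simp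
  rw [missProb, if_neg (by simp), h1]
  refine (Real.one_sub_div_pow_le_exp_neg (n := k) (t := 1) (by exact_mod_cast hk)).trans ?_
  rw [Real.exp_neg, one_div]
  have := Real.add_one_le_exp (1 : ℝ)
  exact inv_anti₀ (by norm_num) (by linarith)

theorem missProb_update_of_ne {i t : ℕ} (hi : t / k ≠ i) (l u : ℕ → ℤ) (v v' : ℤ) (hk : 0 < k) :
    missProb k hit i (t + 1) (Function.update l t v) (Function.update u t v') =
      missProb k hit i t l u := by
  have h1 : (∃ t' < t + 1, t' / k = i ∧
      hit i (Function.update l t v t') (Function.update u t v' t')) ↔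
      ∃ t' < t, t' / k = i ∧ hit i (l t') (u t') := by
    constructor
    · rintro ⟨t', h1, h2, h3⟩
      have hne : t' ≠ t := by rintro rfl; exact hi h2
      rw [Function.update_of_ne hne, Function.update_of_ne hne] at h3
      exact ⟨t', by omega, h2, h3⟩
    · rintro ⟨t', h1, h2, h3⟩
      refine ⟨t', by omega, h2, ?_⟩
      rwa [Function.update_of_ne h1.ne, Function.update_of_ne h1.ne]
  suffices h2 : i * k + k - max (t + 1) (i * k) = i * k + k - max t (i * k) by
    unfold missProb
    rw [h2]
    split_ifs with h3 h4 h4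
    · rfl
    · exact absurd (h1.1 h3) h4
    · exact absurd (h1.2 h4) h3
    · rfl
  rcases lt_or_gt_of_ne hi with h | h
  · have := (Nat.div_lt_iff_lt_mul hk).1 h
    omega
  · have := (Nat.le_div_iff_mul_le hk).1 (Nat.succ_le_of_lt h)
    rw [Nat.succ_mul] at this
    omega

/-- `e` bounds the value after any draw for this block, and a hit makes it zero. As a hit has
probability at least `1 / k` in a block of `S`, the average is at most the value before the draw. -/
theorem exists_missProb_update (t : ℕ) (l u : ℕ → ℤ) (hk : 0 < k) : ∃ e : ℝ, 0 ≤ e ∧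
    missProb k hit (t / k) t l u = (1 - 1 / (k : ℝ)) * e ∧
    ∀ v v', missProb k hit (t / k) (t + 1) (Function.update l t v) (Function.update u t v') ≤ e ∧
    (hit (t / k) v v' → missProb k hit (t / k) (t + 1) (Function.update l t v)
      (Function.update u t v') = 0) := by
  have hθ : 0 ≤ 1 - 1 / (k : ℝ) := by
    rw [sub_nonneg, div_le_one (by positivity)]
    exact_mod_cast hk
  have h1 := Nat.div_mul_le_self t k
  have h2 := Nat.lt_div_mul_add hk (a := t)
  by_cases hs : ∃ t' < t, t' / k = t / k ∧ hit (t / k) (l t') (u t')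
  · refine ⟨0, le_rfl, by rw [missProb, if_pos hs, mul_zero], fun v v' => ?_⟩
    have : missProb k hit (t / k) (t + 1) (Function.update l t v) (Function.update u t v') = 0 := by
      rw [missProb, if_pos]
      obtain ⟨t', h1, h2, h3⟩ := hs
      refine ⟨t', by omega, h2, ?_⟩
      rwa [Function.update_of_ne h1.ne, Function.update_of_ne h1.ne]
    rw [this]
    simp
  · refine ⟨(1 - 1 / (k : ℝ)) ^ (t / k * k + k - (t + 1)), by positivity, ?_, fun v v' => ⟨?_, ?_⟩⟩
    · rw [missProb, if_neg hs, ← pow_succ']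
      congr 1
      omega
    · unfold missProb
      split_ifs
      · positivity
      · rw [max_eq_left (by omega)]
    · intro h
      rw [missProb, if_pos ⟨t, by omega, rfl, by simpa using h⟩]

open Classical in
theorem missProb_end {N i : ℕ} (hi : i < N) (l u : ℕ → ℤ) :
    missProb k hit i (N * k) l u = if ∃ t < N * k, t / k = i ∧ hit i (l t) (u t) then 0 else 1 := by
  have := Nat.mul_le_mul_right k (Nat.succ_le_of_lt hi)
  rw [Nat.succ_mul] at this
  rw [missProb, show i * k + k - max (N * k) (i * k) = 0 by omega, pow_zero]

end

/-- The potential of the items found so far, where `y i` is the weight of block `i`. -/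
noncomputable def fillPot (k : ℕ) (hit : ℕ → ℤ → ℤ → Prop) (S : Finset ℕ) (y : ℕ → ℝ) (t : ℕ)
    (l u : ℕ → ℤ) : ℝ :=
  ∏ i ∈ S, (1 - y i / 2 + y i / 2 * missProb k hit i t l u)

section
variable {a : ℕ → ℤ} {B k : ℕ} {S : Finset ℕ} {h : ℕ → ℕ} {hit : ℕ → ℤ → ℤ → Prop} {y : ℕ → ℝ}

theorem fillPot_nonneg (hk : 0 < k) (hy0 : ∀ i ∈ S, 0 ≤ y i) (hy1 : ∀ i ∈ S, y i ≤ 1) (t : ℕ)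
    (l u : ℕ → ℤ) : 0 ≤ fillPot k hit S y t l u := by
  refine Finset.prod_nonneg fun i hi => ?_
  have h1 := hy1 i hi
  exact add_nonneg (by linarith) (mul_nonneg (by linarith [hy0 i hi]) (missProb_nonneg hk _ _ _ _))

/-- Item `t` affects only the factor of block `t / k`, and that factor is affine in the miss
probability, so averaging reduces to a single block. -/
theorem Hits.fillPot_step (hH : Hits a B k S h hit) (hk : 0 < k) (hB : 0 < B)
    (hy0 : ∀ i ∈ S, 0 ≤ y i) (hy1 : ∀ i ∈ S, y i ≤ 1) (t : ℕ) (l u : ℕ → ℤ) :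
    (∑ p ∈ Finset.range B, (∑ p' ∈ Finset.range B, fillPot k hit S y (t + 1)
      (Function.update l t (a (t / k * B + p))) (Function.update u t (a (t / k * B + p')))) / (B : ℝ)) /
      (B : ℝ) ≤ fillPot k hit S y t l u := by
  classical
  have hB' : (0 : ℝ) < B := by exact_mod_cast hB
  have hk' : (0 : ℝ) < k := by exact_mod_cast hk
  rw [← Finset.sum_div, div_div, div_le_iff₀ (by positivity), ← Finset.sum_product']
  by_cases hi : t / k ∈ S
  · obtain ⟨e, he0, he, hu⟩ := exists_missProb_update (hit := hit) t l u hk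
    obtain ⟨E, hE, hEh, hEc⟩ := hH.prob _ hi
    let Z : ℝ := ∏ i ∈ S.erase (t / k), (1 - y i / 2 + y i / 2 * missProb k hit i t l u)
    have hZ : 0 ≤ Z := Finset.prod_nonneg fun i hi => by
      have h1 := hy1 i (Finset.mem_of_mem_erase hi)
      have h0 := hy0 i (Finset.mem_of_mem_erase hi)
      exact add_nonneg (by linarith) (mul_nonneg (by linarith) (missProb_nonneg hk _ _ _ _))
    have h0 := hy0 _ hi
    have h1 := hy1 _ hi
    have e1 : fillPot k hit S y t l u =
        (1 - y (t / k) / 2 + y (t / k) / 2 * ((1 - 1 / (k : ℝ)) * e)) * Z := by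
      rw [fillPot, ← Finset.mul_prod_erase S _ hi, he]
    have e2 : ∀ z ∈ Finset.range B ×ˢ Finset.range B, fillPot k hit S y (t + 1)
        (Function.update l t (a (t / k * B + z.1))) (Function.update u t (a (t / k * B + z.2))) ≤
        (1 - y (t / k) / 2 + y (t / k) / 2 * (e - if z ∈ E then e else 0)) * Z := by
      intro z _
      rw [fillPot, ← Finset.mul_prod_erase S _ hi]
      have : ∏ i ∈ S.erase (t / k), (1 - y i / 2 + y i / 2 * missProb k hit i (t + 1)
          (Function.update l t (a (t / k * B + z.1))) (Function.update u t (a (t / k * B + z.2)))) = Z :=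
        Finset.prod_congr rfl fun i hi => by
          rw [missProb_update_of_ne (Finset.ne_of_mem_erase hi).symm _ _ _ _ hk]
      rw [this]
      refine mul_le_mul_of_nonneg_right (add_le_add_right
        (mul_le_mul_of_nonneg_left ?_ (by linarith)) _) hZ
      split_ifs with hz
      · rw [(hu _ _).2 (hEh z hz), sub_self]
      · rw [sub_zero]
        exact (hu _ _).1
    refine (Finset.sum_le_sum e2).trans ?_
    rw [← Finset.sum_mul, Finset.sum_add_distrib, ← Finset.mul_sum, Finset.sum_sub_distrib,
      Finset.sum_sub_distrib, Finset.sum_ite_mem, Finset.inter_eq_right.2 hE, Finset.sum_const, Finset.sum_const,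
      Finset.sum_const, Finset.sum_const, Finset.card_product, Finset.card_range, nsmul_eq_mul,
      nsmul_eq_mul, nsmul_eq_mul, nsmul_eq_mul, e1]
    rw [mul_right_comm _ Z]
    refine mul_le_mul_of_nonneg_right ?_ hZ
    have h2 : (B : ℝ) * B ≤ k * E.card := by exact_mod_cast hEc
    have h3 : (B : ℝ) * B / k ≤ E.card := by rwa [div_le_iff₀' hk']
    have h4 := mul_le_mul_of_nonneg_right h3 (mul_nonneg h0 he0)
    push_cast
    have h5 : (1 - 1 / (k : ℝ)) * e * (B * B) = e * (B * B) - B * B / k * e := by ring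
    calc _ = (1 - y (t / k) / 2 + y (t / k) / 2 * e) * (B * B) - E.card * (y (t / k) * e) / 2 := by ring
      _ ≤ (1 - y (t / k) / 2 + y (t / k) / 2 * e) * (B * B) - B * B / k * (y (t / k) * e) / 2 := by
        linarith
      _ = _ := by ring
  · have e2 : ∀ z ∈ Finset.range B ×ˢ Finset.range B, fillPot k hit S y (t + 1)
        (Function.update l t (a (t / k * B + z.1))) (Function.update u t (a (t / k * B + z.2))) =
        fillPot k hit S y t l u := fun z _ => Finset.prod_congr rfl fun i hi' => by
      rw [missProb_update_of_ne (fun h => hi (h ▸ hi')) _ _ _ _ hk]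
    rw [Finset.sum_congr rfl e2, Finset.sum_const, Finset.card_product, Finset.card_range,
      nsmul_eq_mul]
    push_cast
    exact le_of_eq (mul_comm _ _)

/-- As a block is missed with probability at most 1/2, its factor is at most 1 - y/4 ≤ exp(-y/4) ≤
2^(-y/4). -/
theorem fillPot_zero_le (hk : 0 < k) (hy0 : ∀ i ∈ S, 0 ≤ y i) (hy1 : ∀ i ∈ S, y i ≤ 1)
    (l u : ℕ → ℤ) : fillPot k hit S y 0 l u ≤ (1 / 2 : ℝ) ^ ((∑ i ∈ S, y i) / 4) := by
  rw [Finset.sum_div, Real.rpow_sum_of_pos (by norm_num)]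
  refine Finset.prod_le_prod (fun i hi => ?_) fun i hi => ?_
  · exact add_nonneg (by linarith [hy1 i hi])
      (mul_nonneg (by linarith [hy0 i hi]) (missProb_nonneg hk _ _ _ _))
  · have h1 := mul_le_mul_of_nonneg_left (missProb_zero_le (hit := hit) hk i l u)
      (show 0 ≤ y i / 2 by linarith [hy0 i hi])
    have h2 := Real.add_one_le_exp (-(y i / 4))
    have h3 : Real.exp (-(y i / 4)) ≤ (1 / 2 : ℝ) ^ (y i / 4) := by
      rw [Real.rpow_def_of_pos (by norm_num), Real.exp_le_exp, one_div, Real.log_inv]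
      have := Real.log_two_lt_d9
      nlinarith [hy0 i hi]
    linarith

open Classical in
-- For a block that is hit this is Bernoulli's inequality (1/2)^y ≤ 1 - y/2 on [0,1]; the other
-- factors are 1.
theorem le_fillPot_end {N : ℕ} (hS : ∀ i ∈ S, i < N) (hy0 : ∀ i ∈ S, 0 ≤ y i)
    (hy1 : ∀ i ∈ S, y i ≤ 1) (l u : ℕ → ℤ) :
    (1 / 2 : ℝ) ^ (∑ i ∈ S with ∃ t < N * k, t / k = i ∧ hit i (l t) (u t), y i) ≤
      fillPot k hit S y (N * k) l u := by
  rw [Real.rpow_sum_of_pos (by norm_num), Finset.prod_filter]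
  refine Finset.prod_le_prod (fun i hi => ?_) fun i hi => ?_
  · split_ifs <;> positivity
  · rw [missProb_end (hS i hi)]
    split_ifs
    · have := rpow_one_add_le_one_add_mul_self (s := -1 / 2) (by norm_num) (hy0 i hi) (hy1 i hi)
      norm_num at this ⊢
      linarith
    · simp

end

open Classical in
-- A Chernoff bound. With Y the sum of `h i / B` over `S`, the potential is 2^(Y/8) times `fillPot`.
-- It starts at no more than 2^(Y/8 - Y/4) ≤ 2^(-x), and it is at least 1 at the end if the blocks
-- hit have weight at most Y/8.
theorem Hits.exists_potential {a : ℕ → ℤ} {N B k x : ℕ} {S : Finset ℕ} {h : ℕ → ℕ}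
    {hit : ℕ → ℤ → ℤ → Prop} (hH : Hits a B k S h hit) (hS : ∀ i ∈ S, i < N) (hk : 0 < k) (hB : 0 < B)
    (hx : 8 * x * B ≤ ∑ i ∈ S, h i) :
    ∃ Ψ : ℕ → (ℕ → ℤ) → (ℕ → ℤ) → ℝ≥0∞,
      (∀ t l u, (∑ p ∈ Finset.range B, (∑ p' ∈ Finset.range B,
        Ψ (t + 1) (Function.update l t (a (t / k * B + p)))
          (Function.update u t (a (t / k * B + p')))) / (B : ℝ≥0∞)) / (B : ℝ≥0∞) ≤ Ψ t l u) ∧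
      (∀ l u, Ψ 0 l u ≤ ENNReal.ofReal ((1 / 2 : ℝ) ^ x)) ∧
      ∀ l u, 8 * ∑ i ∈ S with ∃ t < N * k, t / k = i ∧ hit i (l t) (u t), h i < ∑ i ∈ S, h i →
        1 ≤ Ψ (N * k) l u := by
  have hB' : (0 : ℝ) < B := by exact_mod_cast hB
  let y : ℕ → ℝ := fun i => h i / B
  have hy0 : ∀ i ∈ S, 0 ≤ y i := fun i _ => by positivity
  have hy1 : ∀ i ∈ S, y i ≤ 1 := fun i hi => by
    rw [div_le_one hB']
    exact_mod_cast hH.le i hi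
  have hY : ∀ S' : Finset ℕ, ∑ i ∈ S', y i = ((∑ i ∈ S', h i : ℕ) : ℝ) / B := fun S' => by
    rw [Nat.cast_sum, Finset.sum_div]
  let c : ℝ := (1 / 2 : ℝ) ^ (-((∑ i ∈ S, y i) / 8))
  have hc : 0 ≤ c := by positivity
  have hnn : ∀ t l u, 0 ≤ c * fillPot k hit S y t l u := fun t l u =>
    mul_nonneg hc (fillPot_nonneg hk hy0 hy1 t l u)
  refine ⟨fun t l u => ENNReal.ofReal (c * fillPot k hit S y t l u), fun t l u => ?_,
    fun l u => ?_, fun l u hlu => ?_⟩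
  · have e1 : ∀ p, (∑ p' ∈ Finset.range B, ENNReal.ofReal (c * fillPot k hit S y (t + 1)
        (Function.update l t (a (t / k * B + p)))
        (Function.update u t (a (t / k * B + p'))))) / (B : ℝ≥0∞) =
        ENNReal.ofReal ((∑ p' ∈ Finset.range B, c * fillPot k hit S y (t + 1)
        (Function.update l t (a (t / k * B + p)))
        (Function.update u t (a (t / k * B + p')))) / B) := fun p => by
      rw [ENNReal.ofReal_div_of_pos hB', ENNReal.ofReal_sum_of_nonneg fun _ _ => hnn _ _ _,
        ENNReal.ofReal_natCast]
    rw [Finset.sum_congr rfl fun p _ => e1 p, ← ENNReal.ofReal_sum_of_nonneg fun _ _ =>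
      div_nonneg (Finset.sum_nonneg fun _ _ => hnn _ _ _) hB'.le, ← ENNReal.ofReal_natCast,
      ← ENNReal.ofReal_div_of_pos hB']
    refine ENNReal.ofReal_le_ofReal (le_trans (le_of_eq ?_) (mul_le_mul_of_nonneg_left
      (hH.fillPot_step hk hB hy0 hy1 t l u) hc))
    simp only [← Finset.mul_sum, mul_div_assoc]
  · refine ENNReal.ofReal_le_ofReal ((mul_le_mul_of_nonneg_left
      (fillPot_zero_le hk hy0 hy1 l u) hc).trans ?_)
    rw [← Real.rpow_add (by norm_num), ← Real.rpow_natCast]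
    refine Real.rpow_le_rpow_of_exponent_ge (by norm_num) (by norm_num) ?_
    have : 8 * (x : ℝ) ≤ ∑ i ∈ S, y i := by
      rw [hY, le_div_iff₀ hB']
      exact_mod_cast hx
    linarith
  · rw [ENNReal.one_le_ofReal]
    refine le_trans ?_ (mul_le_mul_of_nonneg_left (le_fillPot_end hS hy0 hy1 l u) hc)
    rw [← Real.rpow_add (by norm_num)]
    refine Real.one_le_rpow_of_pos_of_le_one_of_nonpos (by norm_num) (by norm_num) ?_
    rw [hY, hY]
    have : 8 * ((∑ i ∈ S with ∃ t < N * k, t / k = i ∧ hit i (l t) (u t), h i : ℕ) : ℝ) ≤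
        (∑ i ∈ S, h i : ℕ) := by exact_mod_cast hlu.le
    have := div_le_div_of_nonneg_right this hB'.le
    rw [mul_div_assoc] at this
    linarith

open Classical in
-- Choose one hitting item for every block that is hit; together they form a chain. Its members in
-- `D` are paid for by a third of their share, which they score. The others form a chain avoiding
-- `D`, so they are few, and each is worth at most `B`.
theorem Hits.mul_sum_le {a : ℕ → ℤ} {N B k' k R : ℕ} {S : Finset ℕ} {h : ℕ → ℕ}
    {hit : ℕ → ℤ → ℤ → Prop} (hH : Hits a B k' S h hit) {l u : ℕ → ℤ} {D : Finset ℕ}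
    (hD : ∀ C, ItemChain k l u C → (∀ t ∈ C, t < N * k ∧ l t ≤ u t) → Disjoint C D →
      R * C.card ≤ N * k) :
    R * ∑ i ∈ S with ∃ t < N * k, t / k = i ∧ hit i (l t) (u t), h i ≤
      3 * (R * ∑ t ∈ D, blockLis a B (t / k) (l t) (u t)) + N * k * B := by
  set S' := S.filter fun i => ∃ t < N * k, t / k = i ∧ hit i (l t) (u t) with hS'
  have hex : ∀ i, ∃ t, i ∈ S' → t < N * k ∧ t / k = i ∧ hit i (l t) (u t) := by
    intro i
    by_cases hi : i ∈ S'
    · obtain ⟨t, ht⟩ := (Finset.mem_filter.1 hi).2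
      exact ⟨t, fun _ => ht⟩
    · exact ⟨0, fun h => absurd h hi⟩
  choose τ hτ using hex
  have hS : ∀ i ∈ S', i ∈ S := fun i hi => (Finset.mem_filter.1 hi).1
  have hinj : Set.InjOn τ S' := fun i hi j hj hij => by
    rw [← (hτ i hi).2.1, hij, (hτ j hj).2.1]
  have hchain : ItemChain k l u (S'.image τ) := by
    intro t ht t' ht' hne
    obtain ⟨i, hi, rfl⟩ := Finset.mem_image.1 ht
    obtain ⟨j, hj, rfl⟩ := Finset.mem_image.1 ht'
    obtain ⟨-, h1, h2⟩ := hτ i hi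
    obtain ⟨-, h3, h4⟩ := hτ j hj
    rw [h1, h3]
    rcases lt_trichotomy i j with hij | hij | hij
    · exact .inl ⟨hij, hH.chain i (hS i hi) j (hS j hj) hij _ _ _ _ h2 h4⟩
    · exact absurd (by rw [hij]) hne
    · exact .inr ⟨hij, hH.chain j (hS j hj) i (hS i hi) hij _ _ _ _ h4 h2⟩
  have h1 := hD (S'.image τ \ D)
    (fun t ht t' ht' => hchain t (Finset.mem_sdiff.1 ht).1 t' (Finset.mem_sdiff.1 ht').1) (by
      intro t ht
      obtain ⟨i, hi, rfl⟩ := Finset.mem_image.1 (Finset.mem_sdiff.1 ht).1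
      exact ⟨(hτ i hi).1, (hH.score i (hS i hi) _ _ (hτ i hi).2.2).1⟩) Finset.sdiff_disjoint
  have h2 : ∑ i ∈ S', h i = ∑ t ∈ S'.image τ, h (t / k) := by
    rw [Finset.sum_image hinj]
    exact Finset.sum_congr rfl fun i hi => by rw [(hτ i hi).2.1]
  have h3 : ∑ t ∈ S'.image τ ∩ D, h (t / k) ≤ 3 * ∑ t ∈ D, blockLis a B (t / k) (l t) (u t) := by
    rw [Finset.mul_sum]
    refine (Finset.sum_le_sum fun t ht => ?_).trans
      (Finset.sum_le_sum_of_subset (Finset.inter_subset_right (s₁ := S'.image τ)))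
    obtain ⟨i, hi, rfl⟩ := Finset.mem_image.1 (Finset.mem_inter.1 ht).1
    rw [(hτ i hi).2.1]
    exact (hH.score i (hS i hi) _ _ (hτ i hi).2.2).2
  have h4 : ∑ t ∈ S'.image τ \ D, h (t / k) ≤ (S'.image τ \ D).card * B := by
    refine (Finset.sum_le_card_nsmul _ _ B fun t ht => ?_).trans (by rw [smul_eq_mul])
    obtain ⟨i, hi, rfl⟩ := Finset.mem_image.1 (Finset.mem_sdiff.1 ht).1
    rw [(hτ i hi).2.1]
    exact hH.le i (hS i hi)
  rw [h2, ← Finset.sum_inter_add_sum_sdiff (S'.image τ) D, mul_add]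
  refine add_le_add ?_ ?_
  · refine (Nat.mul_le_mul_left R h3).trans (le_of_eq (by ring))
  · refine (Nat.mul_le_mul_left R h4).trans ?_
    rw [← mul_assoc]
    exact Nat.mul_le_mul_right B h1

/-! ## Sums of random samples -/

/-- An exponential potential for `s` samples, where a sample multiplies `g` by at most `ρ` on
average. -/
theorem exists_sample_potential {M s : ℕ} (v : ℕ → ℕ) (g : ℕ → ℝ) (ρ : ℝ) (hM : 0 < M)
    (hg : ∀ X, 0 ≤ g X) (hρ : 0 ≤ ρ)
    (h : ∀ X, ∑ t ∈ Finset.range M, g (X + v t) ≤ M * (ρ * g X)) :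
    ∃ Φ : ℕ → ℕ → ℝ≥0∞,
      (∀ j < s, ∀ X, (∑ t ∈ Finset.range M, Φ (j + 1) (X + v t)) / (M : ℝ≥0∞) ≤ Φ j X) ∧
      Φ 0 0 = ENNReal.ofReal (ρ ^ s * g 0) ∧ ∀ X, Φ s X = ENNReal.ofReal (g X) := by
  have hM' : (0 : ℝ) < M := by exact_mod_cast hM
  refine ⟨fun j X => ENNReal.ofReal (ρ ^ (s - j) * g X), fun j hj X => ?_, rfl, fun X => by simp⟩
  rw [← ENNReal.ofReal_sum_of_nonneg fun _ _ => mul_nonneg (pow_nonneg hρ _) (hg _),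
    ← ENNReal.ofReal_natCast, ← ENNReal.ofReal_div_of_pos hM']
  refine ENNReal.ofReal_le_ofReal ?_
  rw [div_le_iff₀ hM', ← Finset.mul_sum, show s - j = s - (j + 1) + 1 by omega, pow_succ]
  refine (mul_le_mul_of_nonneg_left (h X) (pow_nonneg hρ _)).trans (le_of_eq (by ring))

/-- The potential is 2^(X/B - x - 4sΛ/(MB)). Since 2^(v/B) ≤ 1 + v/B, a sample multiplies it on
average by at most 1 + Λ/(MB), and the factor 4 absorbs the `s`-th power of this. -/
theorem exists_upper_potential {M B s x Λ : ℕ} (v : ℕ → ℕ) (hM : 0 < M) (hB : 0 < B)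
    (hv : ∀ t < M, v t ≤ B) (hΛ : ∑ t ∈ Finset.range M, v t ≤ Λ) :
    ∃ Φ : ℕ → ℕ → ℝ≥0∞,
      (∀ j < s, ∀ X, (∑ t ∈ Finset.range M, Φ (j + 1) (X + v t)) / (M : ℝ≥0∞) ≤ Φ j X) ∧
      Φ 0 0 ≤ ENNReal.ofReal ((1 / 2 : ℝ) ^ x) ∧
      ∀ X, M * (B * x) + 4 * s * Λ ≤ M * X → 1 ≤ Φ s X := by
  have hM' : (0 : ℝ) < M := by exact_mod_cast hM
  have hB' : (0 : ℝ) < B := by exact_mod_cast hB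
  obtain ⟨Φ, h1, h2, h3⟩ := exists_sample_potential (M := M) (s := s) v
    (fun X => (2 : ℝ) ^ ((X : ℝ) / B - x - 4 * (s * (Λ / (M * B)))))
    (1 + Λ / (M * B)) hM (fun X => by positivity) (by positivity) (fun X => by
      have e : ∀ t ∈ Finset.range M,
          (2 : ℝ) ^ (((X + v t : ℕ) : ℝ) / B - x - 4 * (s * (Λ / (M * B)))) ≤
          (1 + v t / B) * 2 ^ ((X : ℝ) / B - x - 4 * (s * (Λ / (M * B)))) := fun t ht => by
        have h4 := rpow_one_add_le_one_add_mul_self (s := 1) (by norm_num)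
          (show 0 ≤ (v t : ℝ) / B by positivity) (by
            rw [div_le_one hB']
            exact_mod_cast hv t (Finset.mem_range.1 ht))
        rw [show (1 : ℝ) + 1 = 2 by norm_num, mul_one] at h4
        rw [show ((X + v t : ℕ) : ℝ) / B - x - 4 * (s * (Λ / (M * B))) =
          (v t : ℝ) / B + ((X : ℝ) / B - x - 4 * (s * (Λ / (M * B)))) by push_cast; ring,
          Real.rpow_add (by norm_num)]
        gcongr
      refine (Finset.sum_le_sum e).trans ?_
      rw [← Finset.sum_mul, ← mul_assoc (M : ℝ)]
      refine mul_le_mul_of_nonneg_right ?_ (by positivity)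
      rw [Finset.sum_add_distrib, ← Finset.sum_div, Finset.sum_const, Finset.card_range,
        nsmul_eq_mul, mul_one, mul_add, mul_one, show (M : ℝ) * (Λ / (M * B)) = Λ / B by field_simp]
      gcongr
      exact_mod_cast hΛ)
  refine ⟨Φ, h1, ?_, fun X hX => ?_⟩
  · rw [h2]
    refine ENNReal.ofReal_le_ofReal ?_
    have h4 : (1 + Λ / (M * B) : ℝ) ^ s ≤ (2 : ℝ) ^ (4 * (s * (Λ / (M * B)) : ℝ)) := by
      have h5 := pow_le_pow_left₀ (by positivity) (Real.add_one_le_exp (Λ / (M * B) : ℝ)) s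
      rw [← Real.exp_nat_mul, add_comm] at h5
      refine h5.trans ?_
      rw [Real.rpow_def_of_pos (by norm_num), Real.exp_le_exp]
      have := Real.log_two_gt_d9
      have h6 : (0 : ℝ) ≤ s * (Λ / (M * B)) := by positivity
      nlinarith
    refine (mul_le_mul_of_nonneg_right h4 (by positivity)).trans ?_
    rw [← Real.rpow_add (by norm_num)]
    rw [show (4 * (s * (Λ / (M * B))) + (((0 : ℕ) : ℝ) / B - x - 4 * (s * (Λ / (M * B)))) : ℝ) = -x by
      push_cast; ring, Real.rpow_neg (by norm_num), Real.rpow_natCast, one_div, inv_pow]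
  · rw [h3, ENNReal.one_le_ofReal]
    refine Real.one_le_rpow (by norm_num) ?_
    have h4 : (M * (B * x) + 4 * s * Λ : ℝ) ≤ M * X := by exact_mod_cast hX
    rw [show ((X : ℝ) / B - x - 4 * (s * (Λ / (M * B)))) =
      (M * X - (M * (B * x) + 4 * s * Λ)) / (M * B) by field_simp; ring]
    exact div_nonneg (by linarith) (by positivity)

/-- The same with base 1/2: a sample multiplies the potential on average by at most 1 - Λ/(2MB),
where Λ is the sum of all `v t`. By `hT` the exponent sΛ/(2MB) gained in `s` samples is at least 2x
+ T/(MB). -/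
theorem exists_lower_potential {M B s x T : ℕ} (v : ℕ → ℕ) (hM : 0 < M) (hB : 0 < B)
    (hv : ∀ t < M, v t ≤ B) (hT : 4 * x * (M * B) + 2 * T ≤ s * ∑ t ∈ Finset.range M, v t) :
    ∃ Φ : ℕ → ℕ → ℝ≥0∞,
      (∀ j < s, ∀ X, (∑ t ∈ Finset.range M, Φ (j + 1) (X + v t)) / (M : ℝ≥0∞) ≤ Φ j X) ∧
      Φ 0 0 ≤ ENNReal.ofReal ((1 / 2 : ℝ) ^ x) ∧
      ∀ X, M * X ≤ M * (B * x) + T → 1 ≤ Φ s X := by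
  have hM' : (0 : ℝ) < M := by exact_mod_cast hM
  have hB' : (0 : ℝ) < B := by exact_mod_cast hB
  obtain ⟨Λ, hΛ⟩ : ∃ Λ, Λ = ∑ t ∈ Finset.range M, v t := ⟨_, rfl⟩
  rw [← hΛ] at hT
  have hΛM : Λ ≤ M * B := by
    rw [hΛ]
    refine (Finset.sum_le_card_nsmul _ _ B fun t ht => hv t (Finset.mem_range.1 ht)).trans ?_
    simp
  have hΛ1 : (Λ : ℝ) / (M * B) ≤ 1 := by
    rw [div_le_one (by positivity)]
    exact_mod_cast hΛM
  obtain ⟨Φ, h1, h2, h3⟩ := exists_sample_potential (M := M) (s := s) v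
    (fun X => (1 / 2 : ℝ) ^ ((X : ℝ) / B - x - T / (M * B)))
    (1 - Λ / (M * B) / 2) hM (fun X => by positivity) (by linarith) (fun X => by
      have e : ∀ t ∈ Finset.range M,
          (1 / 2 : ℝ) ^ (((X + v t : ℕ) : ℝ) / B - x - T / (M * B)) ≤
          (1 - v t / B / 2) * (1 / 2) ^ ((X : ℝ) / B - x - T / (M * B)) := fun t ht => by
        have h4 := rpow_one_add_le_one_add_mul_self (s := -1 / 2) (by norm_num)
          (show 0 ≤ (v t : ℝ) / B by positivity) (by
            rw [div_le_one hB']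
            exact_mod_cast hv t (Finset.mem_range.1 ht))
        rw [show (1 : ℝ) + -1 / 2 = 1 / 2 by norm_num] at h4
        rw [show ((X + v t : ℕ) : ℝ) / B - x - T / (M * B) =
          (v t : ℝ) / B + ((X : ℝ) / B - x - T / (M * B)) by push_cast; ring,
          Real.rpow_add (by norm_num)]
        refine mul_le_mul_of_nonneg_right (h4.trans (le_of_eq (by ring))) (by positivity)
      refine (Finset.sum_le_sum e).trans ?_
      rw [← Finset.sum_mul, ← mul_assoc (M : ℝ)]
      refine mul_le_mul_of_nonneg_right (le_of_eq ?_) (by positivity)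
      rw [Finset.sum_sub_distrib, ← Finset.sum_div, ← Finset.sum_div, Finset.sum_const,
        Finset.card_range, nsmul_eq_mul, mul_one, mul_sub, mul_one, hΛ]
      push_cast
      field_simp)
  refine ⟨Φ, h1, ?_, fun X hX => ?_⟩
  · rw [h2]
    refine ENNReal.ofReal_le_ofReal ?_
    have h4 : (1 - Λ / (M * B) / 2 : ℝ) ^ s ≤ (1 / 2 : ℝ) ^ (s * (Λ / (M * B) / 2) : ℝ) := by
      have h5 := pow_le_pow_left₀ (by linarith) (Real.one_sub_le_exp_neg (Λ / (M * B) / 2 : ℝ)) s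
      rw [← Real.exp_nat_mul] at h5
      refine h5.trans ?_
      rw [Real.rpow_def_of_pos (by norm_num), Real.exp_le_exp, one_div (2 : ℝ), Real.log_inv]
      have := Real.log_two_lt_d9
      have h6 : (0 : ℝ) ≤ s * (Λ / (M * B) / 2) := by positivity
      nlinarith
    refine (mul_le_mul_of_nonneg_right h4 (by positivity)).trans ?_
    rw [← Real.rpow_add (by norm_num), ← Real.rpow_natCast]
    refine Real.rpow_le_rpow_of_exponent_ge (by norm_num) (by norm_num) ?_
    have h5 : (4 * x * (M * B) + 2 * T : ℝ) ≤ s * Λ := by exact_mod_cast hT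
    have h6 := div_le_div_of_nonneg_right h5 (show (0 : ℝ) ≤ 2 * (M * B) by positivity)
    rw [show (4 * x * (M * B) + 2 * T : ℝ) / (2 * (M * B)) = 2 * x + T / (M * B) by field_simp; ring,
      show (s * Λ : ℝ) / (2 * (M * B)) = s * (Λ / (M * B) / 2) by field_simp] at h6
    push_cast
    rw [zero_div]
    linarith
  · rw [h3, ENNReal.one_le_ofReal]
    refine Real.one_le_rpow_of_pos_of_le_one_of_nonpos (by norm_num) (by norm_num) ?_
    have h4 : (M * X : ℝ) ≤ M * (B * x) + T := by exact_mod_cast hX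
    rw [show ((X : ℝ) / B - x - T / (M * B)) = (M * X - (M * (B * x) + T)) / (M * B) by field_simp; ring]
    exact div_nonpos_of_nonpos_of_nonneg (by linarith) (by positivity)

/-- Allows one loop to carry the penalties for too large and for too small estimates together. -/
theorem avg_add_mul_le {M : ℕ} (hM : 0 < M) {f g : ℕ → ℝ≥0∞} {F H : ℝ≥0∞} (c₀ c₁ c₂ : ℝ≥0∞)
    (hf : (∑ t ∈ Finset.range M, f t) / (M : ℝ≥0∞) ≤ F)
    (hg : (∑ t ∈ Finset.range M, g t) / (M : ℝ≥0∞) ≤ H) :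
    (∑ t ∈ Finset.range M, (c₀ + c₁ * f t + c₂ * g t)) / (M : ℝ≥0∞) ≤ c₀ + c₁ * F + c₂ * H := by
  rw [Finset.sum_add_distrib, Finset.sum_add_distrib, ← Finset.mul_sum, ← Finset.mul_sum,
    ENNReal.add_div, ENNReal.add_div, mul_div_assoc, mul_div_assoc, Finset.sum_const,
    Finset.card_range, nsmul_eq_mul, mul_comm (M : ℝ≥0∞), ENNReal.mul_div_cancel_right
      (by exact_mod_cast hM.ne') (ENNReal.natCast_ne_top M)]
  gcongr

/-! ### Estimating the score of the extracted items -/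

/-- Add the scores of as many random items as register `35` says. -/
def scoreLoop : Prog := forL 36 35 (rnd 30 (rg 34 - ct 1) ;; addScore)

variable {w n : ℕ} {A : Fin n → ℤ}

theorem scoreLoop_expLe (hw : 1 ≤ w) {s : St} {B k M S b : ℕ} (e : ℕ → ℕ) (h31 : s.reg 31 = B)
    (h32 : s.reg 32 = k) (h33 : s.reg 33 = 0) (h34 : s.reg 34 = M) (h35 : s.reg 35 = S)
    (hM : 0 < M) (he : ∀ t < M, s.arr 2 t = e t ∧ e t ≤ 1) (hb : B < 2 ^ b)
    (hMw : 16 * (M : ℤ) + 200 < wmax w) (hBw : 16 * (B : ℤ) + 200 < wmax w)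
    (hSw : (S : ℤ) < wmax w) (hXw : ((S * B + B : ℕ) : ℤ) < wmax w)
    (hMB : ∀ t < M, ((t / k * B + B : ℕ) : ℤ) < wmax w) (Φ : ℕ → ℕ → ℝ≥0∞)
    (hΦ : ∀ j < S, ∀ X, (∑ t ∈ Finset.range M, Φ (j + 1) (X + e t *
      blockLis (fun x => entry A x) B (t / k) (s.arr 0 t) (s.arr 1 t))) / (M : ℝ≥0∞) ≤ Φ j X)
    {G : St → ℝ≥0∞} (hG : ∀ s' (X : ℕ),
      (∀ r, 22 ≤ r → r ≠ 30 → r ≠ 33 → r ≠ 36 → s'.reg r = s.reg r) →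
      s'.reg 33 = (X : ℤ) → X ≤ S * B → G s' ≤ Φ S X) :
    ExpLe w A scoreLoop s (S * (B * (b * 60 + 500) + 230) + 5) G (Φ 0 0) := by
  classical
  have h := ExpLe.forL (w := w) (A := A) hw (i := 36) (b := 35)
    (p := rnd 30 (rg 34 - ct 1) ;; addScore) (by norm_num) (by norm_num) S
    (B * (b * 60 + 500) + 220) hSw (fun j s' =>
      if (∀ r, 22 ≤ r → r ≠ 30 → r ≠ 33 → r ≠ 36 → s'.reg r = s.reg r) ∧
        (∀ c < 8, s'.arr c = s.arr c) ∧ s'.reg 33 = ((s'.reg 33).toNat : ℤ) ∧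
        (s'.reg 33).toNat ≤ j * B then
      Φ j (s'.reg 33).toNat else ⊤) ?_ s h35 (by norm_num)
  · refine h.weaken (Nat.add_le_add_right (Nat.mul_le_mul_left S (by omega)) 5) (fun s' => .inl ?_) ?_
    · split_ifs with hc
      · exact hG s' _ hc.1 hc.2.2.1 hc.2.2.2
      · exact le_top
    · rw [if_pos]
      · simp [St.setReg_reg, h33]
      · refine ⟨fun r _ _ _ hr => by rw [St.setReg_reg, if_neg hr], fun _ _ => rfl, ?_, ?_⟩ <;>
        simp [St.setReg_reg, h33]
  · intro j hj s' hs' h36 h35'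
    split_ifs at hs' with hc
    · rw [if_pos hc]
      obtain ⟨h1, h2, h3, h4⟩ := hc
      obtain ⟨X, hX⟩ : ∃ X, X = (s'.reg 33).toNat := ⟨_, rfl⟩
      rw [← hX] at h3 h4 ⊢
      have hjB : (j + 1) * B ≤ S * B := Nat.mul_le_mul_right B hj
      rw [Nat.succ_mul] at hjB
      have hM1 : M - 1 + 1 = M := by omega
      have e34 : s'.reg 34 = M := by rw [h1 34 (by norm_num) (by norm_num) (by norm_num) (by norm_num), h34]
      refine ExpLe.weaken (r := (∑ t ∈ Finset.range (M - 1 + 1), Φ (j + 1) (X + e t *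
        blockLis (fun x => entry A x) B (t / k) (s.arr 0 t) (s.arr 1 t))) / ((M - 1 + 1 : ℕ) : ℝ≥0∞))
        ?_ le_rfl (fun _ => .inl le_rfl) (by rw [hM1]; exact hΦ j hj X)
      apply ExpLe.rnd_seq (d := 30) (e := rg 34 - ct 1) (T := B * (b * 60 + 500) + 200) hw (M - 1)
      · simp; omega
      · simp [e34]; omega
      · simp [e34]; omega
      · norm_num
      intro t ht
      have htM : t < M := by omega
      obtain ⟨h5, h6⟩ := he t htM
      refine (addScore_run (A := A) (b := b) hw (t := t) (B := B) (k := k) (X := X) (e := e t)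
        (by simp [St.setReg_reg]) ?_ ?_ ?_ ?_ h6 hb (by omega) hBw ?_ (hMB t htM)).expLe ?_
      · rw [St.setReg_reg, if_neg (by norm_num),
          h1 31 (by norm_num) (by norm_num) (by norm_num) (by norm_num), h31]
      · rw [St.setReg_reg, if_neg (by norm_num),
          h1 32 (by norm_num) (by norm_num) (by norm_num) (by norm_num), h32]
      · rw [St.setReg_reg, if_neg (by norm_num), h3]
      · rw [St.setReg_arr, h2 2 (by norm_num), h5]
      · push_cast at hXw
        have : (X : ℤ) ≤ S * B := by exact_mod_cast (h4.trans (by omega))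
        omega
      · rintro s'' ⟨a1, a2, a3⟩
        rw [St.setReg_arr, h2 0 (by norm_num), h2 1 (by norm_num)] at a3
        obtain ⟨V, hV⟩ : ∃ V, V = X + e t *
          blockLis (fun x => entry A x) B (t / k) (s.arr 0 t) (s.arr 1 t) := ⟨_, rfl⟩
        rw [← hV] at a3 ⊢
        have hVB : V ≤ (j + 1) * B := by
          rw [hV, Nat.succ_mul]
          refine add_le_add h4 ((Nat.mul_le_mul h6 (blockLis_le _ _ _ _ _)).trans (by simp))
        rw [if_pos, if_pos]
        · rw [St.setReg_reg, if_neg (by norm_num), a3, Int.toNat_natCast]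
        · refine ⟨fun r hr h30 h33 h36 => ?_, fun c hc => ?_, ?_, ?_⟩
          · rw [St.setReg_reg, if_neg h36, a1 r hr h33, St.setReg_reg, if_neg h30, h1 r hr h30 h33 h36]
          · rw [St.setReg_arr, a2 c hc, St.setReg_arr, h2 c hc]
          · rw [St.setReg_reg, if_neg (by norm_num), a3, Int.toNat_natCast]
          · rw [St.setReg_reg, if_neg (by norm_num), a3, Int.toNat_natCast]
            exact hVB
        · constructor
          · rw [a1 _ (by norm_num) (by norm_num), St.setReg_reg, if_neg (by norm_num), h36]
          · rw [a1 _ (by norm_num) (by norm_num), St.setReg_reg, if_neg (by norm_num), h35']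
    · simp at hs'

/-- Compute the estimate from the sum of the scores, and improve the best estimate. -/
def updateBest : Prog :=
  asg 37 (rg 34 * (rg 33 - rg 31 * rg 41) / (ct 4 * rg 35 * rg 22)) ;;
  ifL (rg 45) (rg 37) (asg 45 (rg 37)) skip

/-- The term `B * x` is the additive error of both sampling bounds. Without it a few lucky samples
could produce an overestimate; with it the quotient may be negative, and `max` takes care of that.
-/
theorem updateBest_run (hw : 1 ≤ w) {s : St} {B M S R x X : ℕ} (h31 : s.reg 31 = B)
    (h33 : s.reg 33 = X) (h34 : s.reg 34 = M) (h35 : s.reg 35 = S) (h22 : s.reg 22 = R)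
    (h41 : s.reg 41 = x) (hM : 0 < M) (hS : 0 < S) (hR : 0 < R)
    (hX : ((M * X : ℕ) : ℤ) < wmax w) (hB : ((M * (B * x) : ℕ) : ℤ) < wmax w)
    (hSR : ((4 * S * R : ℕ) : ℤ) < wmax w) :
    Run w A updateBest s 50 fun s' => (∀ r, 22 ≤ r → r ≠ 37 → r ≠ 45 → s'.reg r = s.reg r) ∧
      s'.reg 45 = max (s.reg 45) (((M : ℤ) * (X - B * x)) / (4 * S * R : ℕ)) := by
  obtain ⟨d, hd⟩ : ∃ d : ℕ, d = 4 * S * R := ⟨_, rfl⟩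
  have hd0 : 0 < d := by rw [hd]; positivity
  have hd4 : (4 : ℤ) * S * R = d := by rw [hd]; push_cast; ring
  obtain ⟨y, hy⟩ : ∃ y : ℕ, y = B * x := ⟨_, rfl⟩
  have hy' : (B : ℤ) * x = y := by rw [hy]; push_cast; ring
  rw [← hd] at hSR
  rw [← hy] at hB
  have h4S : 4 * S ≤ d := hd ▸ Nat.le_mul_of_pos_right _ hR
  have hyM : y ≤ M * y := Nat.le_mul_of_pos_left _ hM
  have hXM : X ≤ M * X := Nat.le_mul_of_pos_left _ hM
  have hMX : (M : ℤ) * (X - y) = (M * X : ℕ) - (M * y : ℕ) := by push_cast; ring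
  have hdiv1 : (M : ℤ) * (X - y) / d < wmax w := by
    rw [hMX]
    refine Int.ediv_lt_of_lt_mul (by exact_mod_cast hd0) ?_
    have : wmax w ≤ wmax w * d := le_mul_of_one_le_right (by omega) (by exact_mod_cast hd0)
    omega
  have hdiv2 : -wmax w ≤ (M : ℤ) * (X - y) / d := by
    rw [hMX]
    refine Int.le_ediv_of_mul_le (by exact_mod_cast hd0) ?_
    have : wmax w ≤ wmax w * d := le_mul_of_one_le_right (by omega) (by exact_mod_cast hd0)
    rw [neg_mul]
    omega
  rw [← hd, hy']
  apply Run.time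
  · apply Run.seq
    refine Run.asg hw ?_ (by norm_num) ?_
    · simp only [ok_div, ok_mul, ok_sub, ok_rg, ok_ct, eval_mul, eval_sub, eval_rg, eval_ct,
        h31, h33, h34, h35, h22, h41, hy', hd4] at *
      omega
    have e1 : (rg 34 * (rg 33 - rg 31 * rg 41) / (ct 4 * rg 35 * rg 22)).eval s =
        (M : ℤ) * (X - y) / d := by
      simp only [eval_div, eval_mul, eval_sub, eval_rg, eval_ct,
        h31, h33, h34, h35, h22, h41, hy', hd4]
    rw [e1]
    apply Run.ifL hw (by simp) (by simp)
    · intro hc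
      simp [St.setReg_reg] at hc
      refine Run.asg hw (by simp) (by norm_num) ⟨fun r _ h1 h2 => ?_, ?_⟩
      · simp [St.setReg_reg, h1, h2]
      · simp only [eval_rg, St.setReg_reg, if_true]
        exact (max_eq_right hc.le).symm
    · intro hc
      simp [St.setReg_reg] at hc
      refine Run.skip ⟨fun r _ h1 h2 => ?_, ?_⟩
      · simp [St.setReg_reg, h1]
      · rw [St.setReg_reg, if_neg (by norm_num)]
        exact (max_eq_left hc).symm
  · simp

/-- Extract chains and estimate the sum of the scores of the extracted items. -/
def estimate : Prog :=
  asg 20 (rg 46) ;; asg 21 (rg 32) ;; asg 22 (ct 64 * rg 32 * rg 49) ;; rounds ;; scoreLoop ;;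
  updateBest

variable {w n : ℕ} {A : Fin n → ℤ}

open Classical in
-- An overestimate costs `c₁` and an estimate below `τ` costs `c₂`. The first is unlikely for any
-- items whatsoever, because the total score of `D` is at most `R * L`. The second needs a lower
-- bound on the score of `D`, which is waived by `c₂ = 0`.
theorem estimate_expLe (hw : 1 ≤ w) {s : St} {B N k q x S R b τ L : ℕ} (h31 : s.reg 31 = B)
    (h32 : s.reg 32 = k) (h33 : s.reg 33 = 0) (h34 : s.reg 34 = (N * k : ℕ)) (h35 : s.reg 35 = S)
    (h41 : s.reg 41 = x) (h46 : s.reg 46 = N) (h49 : s.reg 49 = q) (hR : R = 64 * k * q)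
    (hN : 0 < N) (hk : 0 < k) (hq : 0 < q) (hB : 0 < B) (hS : 0 < S) (hNB : N * B ≤ n)
    (hL : L = lisOn (fun x => entry A x) (Finset.range n))
    (h2 : ∀ t < N * k, s.arr 2 t = if s.arr 1 t < s.arr 0 t then 1 else 0)
    (hbN : N * k < 2 ^ b) (hbB : B < 2 ^ b)
    (hW : ((N * k * (S * B + B * x) + 4 * S * R + 16 * (N * k) + 16 * B + N * B + 200 : ℕ) : ℤ) <
      wmax w) {G : St → ℝ≥0∞} {c₀ c₁ c₂ : ℝ≥0∞}
    (hlow : c₂ = 0 ∨ ∀ D : Finset ℕ,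
      (∀ C, ItemChain k (s.arr 0) (s.arr 1) C → (∀ t ∈ C, t < N * k ∧ s.arr 0 t ≤ s.arr 1 t) →
        Disjoint C D → R * C.card ≤ N * k) →
      4 * x * (N * k * B) + 2 * (4 * S * R * τ) ≤
        S * ∑ t ∈ D, blockLis (fun x => entry A x) B (t / k) (s.arr 0 t) (s.arr 1 t))
    (hG : ∀ s' (z : ℤ), (∀ r, 38 ≤ r → r ≠ 45 → s'.reg r = s.reg r) → s'.reg 31 = (B : ℤ) →
      s'.reg 45 = max (s.reg 45) z →
      G s' ≤ c₀ + (if (L : ℤ) < z then c₁ else 0) + (if z < τ then c₂ else 0)) :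
    ExpLe w A estimate s (R * (N * (k * (b * 60 + 527) + 60) + 40) +
      S * (B * (b * 60 + 500) + 230) + 200) G
      (c₀ + c₁ * ENNReal.ofReal ((1 / 2) ^ x) + c₂ * ENNReal.ofReal ((1 / 2) ^ x)) := by
  have hM : 0 < N * k := by positivity
  have hR0 : 0 < R := by rw [hR]; positivity
  have hRS : R ≤ 4 * S * R := Nat.le_mul_of_pos_left _ (by positivity)
  have hSR : S ≤ 4 * S * R := (Nat.le_mul_of_pos_left S (by norm_num)).trans (Nat.le_mul_of_pos_right _ hR0)
  have hNM : N ≤ N * k := Nat.le_mul_of_pos_right _ hk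
  have hkM : k ≤ N * k := Nat.le_mul_of_pos_left _ hN
  have hkR : 64 * k ≤ R := hR ▸ Nat.le_mul_of_pos_right _ hq
  have hMSB : S * B + B * x ≤ N * k * (S * B + B * x) := Nat.le_mul_of_pos_left _ hM
  have hSB1 : B ≤ S * B := Nat.le_mul_of_pos_left _ hS
  have hRz : (64 : ℤ) * k * q = R := by rw [hR]; push_cast; ring
  have hMX : ∀ X, X ≤ S * B → N * k * X ≤ N * k * (S * B + B * x) := fun X hX =>
    Nat.mul_le_mul_left _ (by omega)
  have hMx : N * k * (B * x) ≤ N * k * (S * B + B * x) := Nat.mul_le_mul_left _ (by omega)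
  have hdivB : ∀ t < N * k, t / k * B + B ≤ N * B := fun t ht => by
    rw [← Nat.succ_mul]
    exact Nat.mul_le_mul_right B ((Nat.div_lt_iff_lt_mul hk).2 ht)
  obtain ⟨Z, hZ⟩ : ∃ Z, Z = N * k * (S * B + B * x) := ⟨_, rfl⟩
  rw [← hZ] at hW hMSB hMX hMx
  obtain ⟨Y, hY⟩ : ∃ Y, Y = 4 * S * R := ⟨_, rfl⟩
  rw [← hY] at hW hRS hSR
  apply ExpLe.asg_seq hw (T := R * (N * (k * (b * 60 + 527) + 60) + 40) +
      S * (B * (b * 60 + 500) + 230) + 190)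
  · simp
    omega
  · simp
  · norm_num
  apply ExpLe.asg_seq hw (T := R * (N * (k * (b * 60 + 527) + 60) + 40) +
      S * (B * (b * 60 + 500) + 230) + 180)
  · simp
    omega
  · simp
  · norm_num
  apply ExpLe.asg_seq hw (T := R * (N * (k * (b * 60 + 527) + 60) + 40) +
      S * (B * (b * 60 + 500) + 230) + 150)
  · simp
    omega
  · simp [St.setReg_reg, h32, h49, hRz]
    omega
  · norm_num
  set s₁ := ((s.setReg 20 ((rg 46).eval s)).setReg 21 ((rg 32).eval (s.setReg 20 ((rg 46).eval s)))).setReg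
    22 ((ct 64 * rg 32 * rg 49).eval ((s.setReg 20 ((rg 46).eval s)).setReg 21
      ((rg 32).eval (s.setReg 20 ((rg 46).eval s))))) with hs₁
  have a20 : s₁.reg 20 = N := by simp [hs₁, St.setReg_reg, h46]
  have a21 : s₁.reg 21 = k := by simp [hs₁, St.setReg_reg, h32]
  have a22 : s₁.reg 22 = R := by simp [hs₁, St.setReg_reg, h32, h49, hRz]
  have a23 : ∀ r, 23 ≤ r → s₁.reg r = s.reg r := fun r hr => by
    simp [hs₁, St.setReg_reg, show r ≠ 20 by omega, show r ≠ 21 by omega, show r ≠ 22 by omega]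
  have aarr : s₁.arr = s.arr := rfl
  clear_value s₁
  clear hs₁
  refine ExpLe.weaken (ExpLe.run_seq (T := R * (N * (k * (b * 60 + 527) + 60) + 40) + 10)
    (T' := S * (B * (b * 60 + 500) + 230) + 100) (G := G) (p := rounds)
    ((rounds_run hw (N := N) (k := k) (R := R) (b := b) a20 a21 a22 hk hbN (by omega) (by omega)
      ?_).post ?_)) (by omega) (fun _ => .inl le_rfl) le_rfl
  · intro t ht h
    rw [aarr] at h ⊢
    rw [h2 t ht] at h
    split_ifs at h with h'
    · simp at h
    · exact not_lt.1 h'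
  rintro s₂ ⟨d1, d2, D, d3, d4, d5, d6⟩
  rw [aarr] at d2 d3 d4 d5 d6
  have hal : ∀ t < N * k, (¬0 < s.arr 2 t ↔ s.arr 0 t ≤ s.arr 1 t) := fun t ht => by
    rw [h2 t ht]
    split_ifs with h <;> simp [h] <;> omega
  have f0 : s₂.arr 0 = s.arr 0 := d2 0 (by norm_num) (by norm_num) (by norm_num)
  have f1 : s₂.arr 1 = s.arr 1 := d2 1 (by norm_num) (by norm_num) (by norm_num)
  let e : ℕ → ℕ := fun t => if t ∈ D then 1 else if s.arr 1 t < s.arr 0 t then 1 else 0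
  let v : ℕ → ℕ := fun t => e t * blockLis (fun x => entry A x) B (t / k) (s.arr 0 t) (s.arr 1 t)
  have he1 : ∀ t, e t ≤ 1 := fun t => by
    simp only [e]
    split_ifs <;> norm_num
  have hvB : ∀ t, v t ≤ B := fun t =>
    (Nat.mul_le_mul (he1 t) (blockLis_le _ _ _ _ _)).trans (by simp)
  -- Items flagged from the outset have empty intervals and score zero, so the flags can serve as
  -- weights although they do not tell such items from extracted ones.
  have hvD : ∀ t, v t = if t ∈ D then
      blockLis (fun x => entry A x) B (t / k) (s.arr 0 t) (s.arr 1 t) else 0 := by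
    intro t
    simp only [v, e]
    split_ifs with h h'
    · simp
    · rw [one_mul, ← Nat.le_zero]
      refine (lisOn_le_card _ _).trans (le_of_eq ?_)
      rw [Finset.card_eq_zero, Finset.filter_eq_empty_iff]
      intro z _ hz
      omega
    · simp
  have hDM : D ⊆ Finset.range (N * k) := fun t ht => by simpa using (d3 t ht).1
  have hsum : ∑ t ∈ Finset.range (N * k), v t =
      ∑ t ∈ D, blockLis (fun x => entry A x) B (t / k) (s.arr 0 t) (s.arr 1 t) := by
    rw [Finset.sum_congr rfl fun t _ => hvD t, Finset.sum_ite_mem, Finset.inter_eq_right.2 hDM]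
  have hup : ∑ t ∈ Finset.range (N * k), v t ≤ R * L := by
    rw [hsum, hL]
    -- The weight of a chain is here its score, and the bound for a chain is `L`.
    exact d5 _ _ fun P hP hP' => ItemChain.sum_blockLis_le hP fun t ht => (hdivB t (hP' t ht)).trans hNB
  obtain ⟨Φ₁, p1, p2, p3⟩ := exists_upper_potential (s := S) (x := x) v hM hB (fun t _ => hvB t) hup
  obtain ⟨Φ₂, q1, q2, q3⟩ : ∃ Φ : ℕ → ℕ → ℝ≥0∞,
      (∀ j < S, ∀ X, (∑ t ∈ Finset.range (N * k), Φ (j + 1) (X + v t)) / ((N * k : ℕ) : ℝ≥0∞) ≤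
        Φ j X) ∧
      Φ 0 0 ≤ ENNReal.ofReal ((1 / 2 : ℝ) ^ x) ∧
      (c₂ = 0 ∨ ∀ X, N * k * X ≤ N * k * (B * x) + 4 * S * R * τ → 1 ≤ Φ S X) := by
    rcases hlow with h | h
    · exact ⟨fun _ _ => 0, by simp, by simp, .inl h⟩
    · have := h D fun C hC hC' hCD => d6 C hC (fun t ht => ⟨(hC' t ht).1, (hal t (hC' t ht).1).2 (hC' t ht).2⟩) hCD
      rw [← hsum] at this
      obtain ⟨Φ, r1, r2, r3⟩ := exists_lower_potential v hM hB (fun t _ => hvB t) this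
      exact ⟨Φ, r1, r2, .inr r3⟩
  have e31 : s₂.reg 31 = B := by rw [d1 _ (by norm_num), a23 _ (by norm_num), h31]
  have key := scoreLoop_expLe (A := A) (s := s₂) (b := b) (B := B) (k := k) (M := N * k) (S := S) hw e
    e31 (by rw [d1 _ (by norm_num), a23 _ (by norm_num), h32])
    (by rw [d1 _ (by norm_num), a23 _ (by norm_num), h33])
    (by rw [d1 _ (by norm_num), a23 _ (by norm_num), h34])
    (by rw [d1 _ (by norm_num), a23 _ (by norm_num), h35]) hM
    (fun t ht => ⟨by
      rw [d4, h2 t ht]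
      simp only [e]
      split_ifs <;> rfl, he1 t⟩) hbB (by omega) (by omega) (by omega) (by omega)
    (fun t ht => by have := hdivB t ht; omega)
    (fun j X => c₀ + c₁ * Φ₁ j X + c₂ * Φ₂ j X) (fun j hj X => by
      rw [f0, f1]
      exact avg_add_mul_le hM c₀ c₁ c₂ (p1 j hj X) (q1 j hj X))
    (G := fun s' => if (∀ r, 22 ≤ r → r ≠ 30 → r ≠ 33 → r ≠ 36 → s'.reg r = s₂.reg r) ∧
      s'.reg 33 = ((s'.reg 33).toNat : ℤ) ∧ (s'.reg 33).toNat ≤ S * B then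
      c₀ + c₁ * Φ₁ S (s'.reg 33).toNat + c₂ * Φ₂ S (s'.reg 33).toNat else ⊤) (by
      intro s' X h22 h33 hX
      rw [if_pos ⟨h22, by rw [h33, Int.toNat_natCast], by rw [h33, Int.toNat_natCast]; exact hX⟩, h33,
        Int.toNat_natCast])
  refine ExpLe.weaken (ExpLe.seq (q := updateBest) (T' := 50) (G := G) key fun s₃ => ?_) (by omega)
    (fun _ => .inl le_rfl) (by gcongr)
  split_ifs with hc
  swap
  · exact ExpLe.top
  obtain ⟨g1, g2, g3⟩ := hc
  obtain ⟨X, hX⟩ : ∃ X, X = (s₃.reg 33).toNat := ⟨_, rfl⟩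
  rw [← hX] at g2 g3 ⊢
  have hMX3 := hMX X g3
  refine (updateBest_run hw (B := B) (M := N * k) (S := S) (R := R) (x := x) (X := X)
    (by rw [g1 _ (by norm_num) (by norm_num) (by norm_num) (by norm_num), e31]) g2
    (by rw [g1 _ (by norm_num) (by norm_num) (by norm_num) (by norm_num), d1 _ (by norm_num),
      a23 _ (by norm_num), h34])
    (by rw [g1 _ (by norm_num) (by norm_num) (by norm_num) (by norm_num), d1 _ (by norm_num),
      a23 _ (by norm_num), h35])
    (by rw [g1 _ (by norm_num) (by norm_num) (by norm_num) (by norm_num), d1 _ (by norm_num), a22])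
    (by rw [g1 _ (by norm_num) (by norm_num) (by norm_num) (by norm_num), d1 _ (by norm_num),
      a23 _ (by norm_num), h41]) hM hS hR0 (by omega) (by omega) (by rw [← hY]; omega)).expLe ?_
  rintro s₄ ⟨i1, i2⟩
  have hreg : ∀ r, 23 ≤ r → r ≠ 30 → r ≠ 33 → r ≠ 36 → s₃.reg r = s.reg r := fun r h h30 h33 h36 => by
    rw [g1 _ (by omega) h30 h33 h36, d1 _ (by omega), a23 _ h]
  refine (hG s₄ (((N * k : ℕ) : ℤ) * (X - B * x) / (4 * S * R : ℕ)) (fun r hr h45 => ?_) ?_ ?_).trans ?_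
  · rw [i1 _ (by omega) (by omega) h45, hreg _ (by omega) (by omega) (by omega) (by omega)]
  · rw [i1 _ (by norm_num) (by norm_num) (by norm_num), hreg _ (by norm_num) (by norm_num)
      (by norm_num) (by norm_num), h31]
  · rw [i2, hreg 45 (by norm_num) (by norm_num) (by norm_num) (by norm_num)]
  have hd : 0 < (4 * S * R : ℕ) := by positivity
  refine add_le_add (add_le_add le_rfl ?_) ?_
  · split_ifs with hlt
    · refine le_mul_of_one_le_right' (p3 X ?_)
      have h5 : ((L + 1 : ℕ) : ℤ) * (4 * S * R : ℕ) ≤ (N * k : ℕ) * (X - B * x) :=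
        (Int.le_ediv_iff_mul_le (by exact_mod_cast hd)).1
        (by rw [Nat.cast_succ]; exact Int.add_one_le_of_lt hlt)
      have h6 : ((N * k * (B * x) + 4 * S * (R * L) : ℕ) : ℤ) ≤ (N * k * X : ℕ) := by
        have : (0 : ℤ) ≤ (4 * S * R : ℕ) := by positivity
        push_cast at h5 this ⊢
        linarith
      exact_mod_cast h6
    · exact zero_le
  · rcases q3 with h | h
    · simp [h]
    split_ifs with hlt
    · refine le_mul_of_one_le_right' (h X ?_)
      have h5 : ((N * k : ℕ) : ℤ) * (X - B * x) < τ * (4 * S * R : ℕ) :=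
        (Int.ediv_lt_iff_lt_mul (by exact_mod_cast hd)).1 hlt
      have h6 : ((N * k * X : ℕ) : ℤ) ≤ (N * k * (B * x) + 4 * S * R * τ : ℕ) := by
        push_cast at h5 ⊢
        linarith
      exact_mod_cast h6
    · exact zero_le

/-! ### A single guess of the ratio -/

/-- Improve the best estimate by one which is accurate if the ratio of the length of the input to
the length of a longest increasing subsequence is about one more than register `48` says. -/
def phase : Prog :=
  asg 49 (rg 48 + ct 1) ;; asg 32 (ct 36 * rg 49 * rg 49) ;; asg 34 (rg 46 * rg 32) ;;
  asg 35 (ct 55296 * rg 49 * rg 49 * rg 49 * rg 41) ;; asg 33 (ct 0) ;; fill ;; estimate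

/-- The constants are fixed here. `L ≤ 32 * W'` gives `2 * L ≤ 64 * W'`, and with `R = 64 * k * q`
the loss `N * k * B ≤ k * q * L` amounts to one `L`, so `L ≤ 192 * V`. The two summands of the claim
get half of `S * V` each: 55296 = 8·36·192 serves the first, and 7077888 = 192·16·2304, where `R =
2304 * q ^ 3`, the second. -/
theorem extracted_score_bound {n N B L W W' V k q x R S M τ : ℕ} (hk : k = 36 * q ^ 2)
    (hR : R = 64 * k * q) (hS : S = 55296 * q ^ 3 * x) (hM : M = N * k) (hq : 0 < q)
    (hn : n ≤ q * L) (hNB : N * B ≤ n) (hL : L ≤ 4 * W) (hW : W ≤ 8 * W')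
    (hV : R * W' ≤ 3 * (R * V) + N * k * B) (hτ : 7077888 * q ^ 3 * τ ≤ L) :
    4 * x * (M * B) + 2 * (4 * S * R * τ) ≤ S * V := by
  have hk0 : 0 < k := by rw [hk]; positivity
  have hkq : 0 < k * q := by positivity
  have hkL : N * k * B ≤ k * q * L := by
    calc N * k * B = k * (N * B) := by ring
      _ ≤ k * (q * L) := Nat.mul_le_mul_left k (hNB.trans hn)
      _ = k * q * L := by ring
  have h1 : 64 * W' ≤ 192 * V + L := by
    refine Nat.le_of_mul_le_mul_left ?_ hkq
    calc k * q * (64 * W') = R * W' := by rw [hR]; ring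
      _ ≤ 3 * (R * V) + k * q * L := hV.trans (Nat.add_le_add_left hkL _)
      _ = k * q * (192 * V + L) := by rw [hR]; ring
  have h2 : L ≤ 192 * V := by omega
  have h3 : 2 * (4 * x * (M * B)) ≤ S * V := by
    calc 2 * (4 * x * (M * B)) = 8 * x * (N * k * B) := by rw [hM]; ring
      _ ≤ 8 * x * (k * q * (192 * V)) :=
        Nat.mul_le_mul_left _ (hkL.trans (Nat.mul_le_mul_left _ h2))
      _ = S * V := by rw [hS, hk]; ring
  have h4 : 192 * (16 * R * τ) ≤ 192 * V := by
    calc 192 * (16 * R * τ) = 7077888 * q ^ 3 * τ := by rw [hR, hk]; ring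
      _ ≤ 192 * V := hτ.trans h2
  have h5 : 2 * (2 * (4 * S * R * τ)) ≤ S * V := by
    calc 2 * (2 * (4 * S * R * τ)) = S * (16 * R * τ) := by ring
      _ ≤ S * V := Nat.mul_le_mul_left S (by omega)
  omega

theorem avg_add_mul {M : ℕ} (hM : 0 < M) {f : ℕ → ℝ≥0∞} (c₀ c₁ : ℝ≥0∞) :
    (∑ t ∈ Finset.range M, (c₀ + c₁ * f t)) / (M : ℝ≥0∞) =
      c₀ + c₁ * ((∑ t ∈ Finset.range M, f t) / (M : ℝ≥0∞)) := by
  rw [Finset.sum_add_distrib, ← Finset.mul_sum, ENNReal.add_div, mul_div_assoc, Finset.sum_const,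
    Finset.card_range, nsmul_eq_mul, mul_comm (M : ℝ≥0∞), ENNReal.mul_div_cancel_right
      (by exact_mod_cast hM.ne') (ENNReal.natCast_ne_top M)]

variable {w n : ℕ} {A : Fin n → ℤ}

open Classical in
-- The lower bound can be spoilt by drawing bad items or by bad sampling of scores, whence the
-- factor 2 at `c₂`. After bad items the penalty `c₂` is charged in full by moving it into `c₀`, and
-- the estimate is continued without a lower guarantee; the bound for overestimates is not affected.
theorem phase_expLe (hw : 1 ≤ w) {s : St} {B N k y q x S R b τ L : ℕ} (h31 : s.reg 31 = B)
    (h41 : s.reg 41 = x) (h46 : s.reg 46 = N) (h48 : s.reg 48 = y) (hq : q = y + 1)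
    (hk : k = 36 * q ^ 2) (hR : R = 64 * k * q) (hS : S = 55296 * q ^ 3 * x)
    (hN : 0 < N) (hB : 0 < B) (hx : 0 < x) (hNB : N * B ≤ n)
    (hL : L = lisOn (fun x => entry A x) (Finset.range n))
    (hbN : N * k < 2 ^ b) (hbB : B < 2 ^ b)
    (hW : ((N * k * (S * B + B * x) + 4 * S * R + 16 * (N * k) + 16 * B + N * B + 200 : ℕ) : ℤ) <
      wmax w) {G : St → ℝ≥0∞} {c₀ c₁ c₂ : ℝ≥0∞}
    (hlow : c₂ = 0 ∨ (n ≤ N * B + N ∧ n ≤ q * L ∧ 4 * N ≤ L ∧ 32 * x * B ≤ L ∧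
      7077888 * q ^ 3 * τ ≤ L))
    (hG : ∀ s' (z : ℤ), (∀ r, 38 ≤ r → r ≠ 45 → r ≠ 49 → s'.reg r = s.reg r) →
      s'.reg 31 = (B : ℤ) → s'.reg 45 = max (s.reg 45) z →
      G s' ≤ c₀ + (if (L : ℤ) < z then c₁ else 0) + (if z < τ then c₂ else 0)) :
    ExpLe w A phase s (N * k * 150 + R * (N * (k * (b * 60 + 527) + 60) + 40) +
      S * (B * (b * 60 + 500) + 230) + 500) G
      (c₀ + c₁ * ENNReal.ofReal ((1 / 2) ^ x) + 2 * (c₂ * ENNReal.ofReal ((1 / 2) ^ x))) := by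
  obtain ⟨δ, hδ⟩ : ∃ δ, δ = ENNReal.ofReal ((1 / 2 : ℝ) ^ x) := ⟨_, rfl⟩
  have hq0 : 0 < q := by omega
  have hk0 : 0 < k := by rw [hk]; positivity
  have hR0 : 0 < R := by rw [hR]; positivity
  have hS0 : 0 < S := by rw [hS]; positivity
  have hM0 : 0 < N * k := by positivity
  have hkM : k ≤ N * k := Nat.le_mul_of_pos_left _ hN
  have hS4 : S ≤ 4 * S * R :=
    (Nat.le_mul_of_pos_left S (by norm_num)).trans (Nat.le_mul_of_pos_right _ hR0)
  have hqk : 36 * q ≤ k := by rw [hk, pow_two]; nlinarith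
  have hS1 : 55296 * q ^ 3 ≤ S := hS ▸ Nat.le_mul_of_pos_right _ hx
  have hS2 : 55296 * q ^ 2 ≤ 55296 * q ^ 3 :=
    Nat.mul_le_mul_left _ (Nat.pow_le_pow_right hq0 (by norm_num))
  have hS3 : 55296 * q ≤ 55296 * q ^ 2 := Nat.mul_le_mul_left _ (by nlinarith)
  have hkz : (36 : ℤ) * q * q = k := by rw [hk]; push_cast; ring
  have hMz : (N : ℤ) * k = (N * k : ℕ) := by push_cast; ring
  have hSz2 : (55296 : ℤ) * q * q = (55296 * q ^ 2 : ℕ) := by push_cast; ring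
  have hSz3 : ((55296 * q ^ 2 : ℕ) : ℤ) * q = (55296 * q ^ 3 : ℕ) := by push_cast; ring
  have hSz : ((55296 * q ^ 3 : ℕ) : ℤ) * x = S := by rw [hS]; push_cast; ring
  have hyq : (y : ℤ) + 1 = q := by rw [hq]; push_cast; ring
  have hdivB : ∀ t < N * k, t / k * B + B ≤ N * B := fun t ht => by
    rw [← Nat.succ_mul]
    exact Nat.mul_le_mul_right B ((Nat.div_lt_iff_lt_mul hk0).2 ht)
  obtain ⟨M, hM⟩ : ∃ M, M = N * k := ⟨_, rfl⟩
  obtain ⟨Z, hZ⟩ : ∃ Z, Z = M * (S * B + B * x) := ⟨_, rfl⟩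
  obtain ⟨S3, hS3'⟩ : ∃ S3, S3 = 55296 * q ^ 3 := ⟨_, rfl⟩
  obtain ⟨S2, hS2'⟩ : ∃ S2, S2 = 55296 * q ^ 2 := ⟨_, rfl⟩
  obtain ⟨Y, hY⟩ : ∃ Y, Y = 4 * S * R := ⟨_, rfl⟩
  have hW' := hW
  rw [← hM, ← hZ, ← hY] at hW'
  rw [← hM] at hMz hM0 hkM hdivB
  rw [← hS3'] at hS1 hS2 hSz3 hSz
  rw [← hS2'] at hS2 hS3 hSz3 hSz2
  rw [← hY] at hS4
  obtain ⟨T, hT⟩ : ∃ T, T = M * 150 + R * (N * (k * (b * 60 + 527) + 60) + 40) +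
      S * (B * (b * 60 + 500) + 230) := ⟨_, rfl⟩
  rw [← hδ, ← hM, ← hT]
  apply ExpLe.asg_seq hw (T := T + 490)
  · simp
    omega
  · simp [h48, hyq]
    omega
  · norm_num
  apply ExpLe.asg_seq hw (T := T + 460)
  · simp
    omega
  · simp [St.setReg_reg, h48, hyq, hkz]
    omega
  · norm_num
  apply ExpLe.asg_seq hw (T := T + 430)
  · simp
    omega
  · simp [St.setReg_reg, h48, hyq, hkz, h46]
    rw [hMz]
    omega
  · norm_num
  apply ExpLe.asg_seq hw (T := T + 380)
  · simp
    omega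
  · simp [St.setReg_reg, h48, hyq, h41]
    rw [hSz2, hSz3, hSz]
    omega
  · norm_num
  apply ExpLe.asg_seq hw (T := T + 350)
  · simp
    omega
  · simp
    omega
  · norm_num
  set s₁ := St.setReg _ 33 _ with hs₁
  have a38 : ∀ r, 38 ≤ r → r ≠ 49 → s₁.reg r = s.reg r := fun r hr h49 => by
    simp [hs₁, St.setReg_reg, h49, show r ≠ 32 by omega, show r ≠ 33 by omega,
      show r ≠ 34 by omega, show r ≠ 35 by omega]
  have a31 : s₁.reg 31 = B := by simp [hs₁, St.setReg_reg, h31]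
  have a32 : s₁.reg 32 = k := by simp [hs₁, St.setReg_reg, h48, hyq, hkz]
  have a33 : s₁.reg 33 = 0 := by simp [hs₁, St.setReg_reg]
  have a34 : s₁.reg 34 = M := by
    simp [hs₁, St.setReg_reg, h48, hyq, hkz, h46]
    exact hMz
  have a35 : s₁.reg 35 = S := by
    simp [hs₁, St.setReg_reg, h48, hyq, h41]
    rw [hSz2, hSz3, hSz]
  have a49 : s₁.reg 49 = q := by simp [hs₁, St.setReg_reg, h48, hyq]
  clear_value s₁
  clear hs₁
  obtain ⟨good, Ψ, hgood, f1, f2, f3⟩ : ∃ (good : (ℕ → ℤ) → (ℕ → ℤ) → Prop)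
      (Ψ : ℕ → (ℕ → ℤ) → (ℕ → ℤ) → ℝ≥0∞),
      (∀ l u, good l u → c₂ = 0 ∨ ∀ D : Finset ℕ,
        (∀ C, ItemChain k l u C → (∀ t ∈ C, t < N * k ∧ l t ≤ u t) →
          Disjoint C D → R * C.card ≤ N * k) →
        4 * x * (N * k * B) + 2 * (4 * S * R * τ) ≤
          S * ∑ t ∈ D, blockLis (fun x => entry A x) B (t / k) (l t) (u t)) ∧
      (∀ t l u, (∑ p ∈ Finset.range B, (∑ p' ∈ Finset.range B,
        Ψ (t + 1) (Function.update l t (entry A (t / k * B + p : ℕ)))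
          (Function.update u t (entry A (t / k * B + p' : ℕ)))) / (B : ℝ≥0∞)) / (B : ℝ≥0∞) ≤
          Ψ t l u) ∧
      (∀ l u, Ψ 0 l u ≤ δ) ∧ ∀ l u, ¬good l u → 1 ≤ Ψ M l u := by
    rcases hlow with h | ⟨g1, g2, g3, g4, g5⟩
    · exact ⟨fun _ _ => True, fun _ _ _ => 0, fun _ _ _ => .inl h, by simp, by simp, by simp⟩
    · rw [hL] at g2 g3
      obtain ⟨I, h, hit, i1, i2, i3⟩ := exists_hits (fun x => entry A x) g1 hNB g2 g3
      rw [← hL] at g2 g3 i3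
      rw [← hk] at i2
      obtain ⟨Ψ, j1, j2, j3⟩ := i2.exists_potential (x := x) i1 hk0 hB (by
        have : 4 * (8 * x * B) ≤ 4 * ∑ i ∈ I, h i := by
          refine le_trans (le_of_eq ?_) (g4.trans i3)
          ring
        -- The potential needs weight `8 * x * B` in the chosen blocks, a quarter of the `32 * x *
        -- B` assumed of `L`.
        omega)
      rw [← hδ] at j2
      rw [← hM] at j3
      refine ⟨fun l u => ∑ i ∈ I, h i ≤
        8 * ∑ i ∈ I with ∃ t < M, t / k = i ∧ hit i (l t) (u t), h i, Ψ, ?_, j1, j2,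
        fun l u hlu => j3 l u (not_le.1 hlu)⟩
      intro l u hlu
      right
      intro D hD
      have := i2.mul_sum_le hD
      rw [← hM] at this
      refine extracted_score_bound hk hR hS rfl hq0 g2 hNB i3 hlu ?_ g5
      rw [← hM]
      exact this
  have key := fill_expLe (A := A) (s := s₁) (B := B) (k := k) (M := M) hw a31 a32 a34 hB
    (by omega) (fun t ht => by have := hdivB t ht; omega)
    (fun t l u => c₀ + c₁ * δ + c₂ * δ + c₂ * Ψ t l u) (fun t _ l u => by
      simp only [avg_add_mul hB]
      gcongr
      exact f1 t l u)
    (G := fun s' => if (∀ r, 31 ≤ r → s'.reg r = s₁.reg r) ∧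
      (∀ t < M, s'.arr 2 t = if s'.arr 1 t < s'.arr 0 t then 1 else 0) then
      c₀ + c₁ * δ + c₂ * δ + c₂ * Ψ M (s'.arr 0) (s'.arr 1) else ⊤) (fun s' h1 _ h2 => by
        rw [if_pos ⟨h1, h2⟩])
  refine ExpLe.weaken (ExpLe.seq (q := estimate) (T' := R * (N * (k * (b * 60 + 527) + 60) + 40) +
      S * (B * (b * 60 + 500) + 230) + 200) (G := G) key fun s₂ => ?_) (by omega)
    (fun _ => .inl le_rfl) ?_
  · split_ifs with hc
    swap
    · exact ExpLe.top
    obtain ⟨b1, b2⟩ := hc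
    have hG' : ∀ s' (z : ℤ), (∀ r, 38 ≤ r → r ≠ 45 → s'.reg r = s₂.reg r) →
      s'.reg 31 = (B : ℤ) → s'.reg 45 = max (s₂.reg 45) z →
      G s' ≤ c₀ + (if (L : ℤ) < z then c₁ else 0) + (if z < τ then c₂ else 0) := by
      intro s' z h1 h2 h3
      refine hG s' z (fun r hr h45 h49 => ?_) h2 ?_
      · rw [h1 r hr h45, b1 r (by omega), a38 r hr h49]
      · rw [h3, b1 _ (by norm_num), a38 _ (by norm_num) (by norm_num)]
    have run := fun (c₀ c₂ : ℝ≥0∞) hlow hG => estimate_expLe (A := A) (s := s₂) (B := B) (N := N)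
      (k := k) (q := q) (x := x) (S := S) (R := R) (b := b) (τ := τ) (L := L) hw
      (by rw [b1 _ (by norm_num), a31]) (by rw [b1 _ (by norm_num), a32])
      (by rw [b1 _ (by norm_num), a33]) (by rw [b1 _ (by norm_num), a34, hM])
      (by rw [b1 _ (by norm_num), a35])
      (by rw [b1 _ (by norm_num), a38 _ (by norm_num) (by norm_num), h41])
      (by rw [b1 _ (by norm_num), a38 _ (by norm_num) (by norm_num), h46])
      (by rw [b1 _ (by norm_num), a49]) hR hN hk0 hq0 hB hS0 hNB hL (by rw [← hM]; exact b2)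
      hbN hbB hW (G := G) (c₀ := c₀) (c₁ := c₁) (c₂ := c₂) hlow hG
    rw [← hδ] at run
    by_cases hg : good (s₂.arr 0) (s₂.arr 1)
    · refine (run c₀ c₂ (hgood _ _ hg) hG').weaken le_rfl (fun _ => .inl le_rfl) ?_
      exact le_self_add
    · refine (run (c₀ + c₂) 0 (.inl rfl) fun s' z h1 h2 h3 => (hG' s' z h1 h2 h3).trans ?_).weaken
        le_rfl (fun _ => .inl le_rfl) ?_
      · have : (if z < (τ : ℤ) then c₂ else 0) ≤ c₂ := by
          split_ifs
          · exact le_rfl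
          · exact zero_le
        calc _ ≤ c₀ + (if (L : ℤ) < z then c₁ else 0) + c₂ := by gcongr
          _ = c₀ + c₂ + (if (L : ℤ) < z then c₁ else 0) := add_right_comm _ _ _
          _ ≤ _ := le_self_add
      · have := f3 _ _ hg
        calc c₀ + c₂ + c₁ * δ + 0 * δ = c₀ + c₁ * δ + c₂ * 1 := by rw [zero_mul, mul_one]; ring
          _ ≤ c₀ + c₁ * δ + c₂ * Ψ M (s₂.arr 0) (s₂.arr 1) := by gcongr
          _ ≤ _ := add_le_add le_self_add le_rfl
  · rw [add_assoc (c₀ + c₁ * δ), two_mul]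
    gcongr
    exact f2 _ _

/-! ### Thinning the array -/

theorem lisOn_sample_le {a v : ℕ → ℤ} {g G n : ℕ} (hG : G * g ≤ n)
    (hv : ∀ t < G, ∃ z < g, v t = a (t * g + z)) :
    lisOn v (Finset.range G) ≤ lisOn a (Finset.range n) := by
  classical
  obtain ⟨T, hT, hm, hc⟩ := exists_lisOn v (Finset.range G)
  have hex : ∀ t, ∃ z, t < G → z < g ∧ v t = a (t * g + z) := fun t => by
    by_cases ht : t < G
    · obtain ⟨z, hz⟩ := hv t ht
      exact ⟨z, fun _ => hz⟩
    · exact ⟨0, fun h => absurd h ht⟩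
  choose z hz using hex
  have hTG : ∀ t ∈ T, t < G := fun t ht => by simpa using hT ht
  have hmono : ∀ t ∈ T, ∀ t', t < t' → t * g + z t < t' * g + z t' := fun t ht t' htt => by
    have := Nat.mul_le_mul_right g (Nat.succ_le_of_lt htt)
    rw [Nat.succ_mul] at this
    have := (hz t (hTG t ht)).1
    omega
  have hinj : Set.InjOn (fun t => t * g + z t) T := fun t ht t' ht' he => by
    rcases lt_trichotomy t t' with h | h | h
    · exact absurd he (hmono t ht t' h).ne
    · exact h
    · exact absurd he (hmono t' ht' t h).ne'
  rw [← hc, ← Finset.card_image_of_injOn hinj]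
  apply le_lisOn
  · intro y hy
    obtain ⟨t, ht, rfl⟩ := Finset.mem_image.1 hy
    have := Nat.mul_le_mul_right g (Nat.succ_le_of_lt (hTG t ht))
    rw [Nat.succ_mul] at this
    have := (hz t (hTG t ht)).1
    simp only [Finset.mem_range]
    omega
  · intro y hy y' hy' hyy
    obtain ⟨t, ht, rfl⟩ := Finset.mem_image.1 hy
    obtain ⟨t', ht', rfl⟩ := Finset.mem_image.1 hy'
    have htt : t < t' := by
      by_contra h
      rcases (not_lt.1 h).lt_or_eq with h | h
      · exact lt_asymm (hmono t' ht' t h) hyy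
      · rw [h] at hyy
        exact lt_irrefl _ hyy
    rw [← (hz t (hTG t ht)).2, ← (hz t' (hTG t' ht')).2]
    exact hm ht ht' htt

theorem one_le_lisOn {a : ℕ → ℤ} {m : ℕ} (hm : 0 < m) : 1 ≤ lisOn a (Finset.range m) := by
  have := le_lisOn (a := a) (S := Finset.range m) (T := {0}) (by simpa using hm) (by simp)
  simpa using this

open Classical in
-- Let `H t` be the part of an optimal subsequence in block `t`, and let `d` count the blocks whose
-- sampled value occurs on `H t`. These values increase, so the sample has an increasing subsequence
-- of length `d`. The potential is 2^(θ-d) times the product of 1 - |H t|/(2g) over the blocks to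
-- come, as a draw halves 2^(-d) with probability at least |H t|/g. By `hθ` the product is at most
-- 2^(-(θ+x)) at the start.
theorem exists_thin_potential {a : ℕ → ℤ} {n g G x θ : ℕ} (hg : 0 < g) (hn : n ≤ G * g + g)
    (hθ : 2 * g * (θ + x) + g ≤ lisOn a (Finset.range n)) :
    ∃ Ψ : ℕ → (ℕ → ℤ) → ℝ≥0∞,
      (∀ t < G, ∀ v, (∑ z ∈ Finset.range g, Ψ (t + 1) (Function.update v t (a (t * g + z)))) /
        (g : ℝ≥0∞) ≤ Ψ t v) ∧
      (∀ v, Ψ 0 v ≤ ENNReal.ofReal ((1 / 2) ^ x)) ∧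
      ∀ v, lisOn v (Finset.range G) < θ → 1 ≤ Ψ G v := by
  obtain ⟨O, hO, hm, hc⟩ := exists_lisOn a (Finset.range n)
  rw [← hc] at hθ
  have hg' : (0 : ℝ) < g := by exact_mod_cast hg
  let H : ℕ → Finset ℕ := fun t => (Finset.range g).filter fun z => t * g + z ∈ O
  have hH : ∀ t z, z ∈ H t ↔ z < g ∧ t * g + z ∈ O := fun t z => by simp [H]
  have hHg : ∀ t, (H t).card ≤ g := fun t => by
    simpa using Finset.card_filter_le (Finset.range g) fun z => t * g + z ∈ O
  let hit : ℕ → ℤ → Prop := fun t y => ∃ z ∈ H t, y = a (t * g + z)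
  let d : ℕ → (ℕ → ℤ) → ℕ := fun t v => ((Finset.range t).filter fun t' => hit t' (v t')).card
  have hd : ∀ t v y, d (t + 1) (Function.update v t y) = d t v + if hit t y then 1 else 0 := by
    intro t v y
    simp only [d]
    rw [Finset.range_add_one, Finset.filter_insert, Function.update_self]
    have : (Finset.range t).filter (fun t' => hit t' (Function.update v t y t')) =
        (Finset.range t).filter fun t' => hit t' (v t') := by
      refine Finset.filter_congr fun t' ht' => ?_
      rw [Function.update_of_ne (Finset.mem_range.1 ht').ne]
    rw [this]
    split_ifs
    · rw [Finset.card_insert_of_notMem (by simp)]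
    · rfl
  have hp0 : ∀ t, 0 ≤ 1 - (H t).card / (2 * g : ℝ) := fun t => by
    rw [sub_nonneg, div_le_one (by positivity)]
    have : ((H t).card : ℝ) ≤ g := by exact_mod_cast hHg t
    linarith
  let P : ℕ → ℝ := fun t => ∏ t' ∈ Finset.Ico t G, (1 - (H t').card / (2 * g : ℝ))
  have hP0 : ∀ t, 0 ≤ P t := fun t => Finset.prod_nonneg fun t' _ => hp0 t'
  refine ⟨fun t v => ENNReal.ofReal (2 ^ θ * ((1 / 2) ^ d t v * P t)), fun t ht v => ?_,
    fun v => ?_, fun v hv => ?_⟩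
  · rw [← ENNReal.ofReal_sum_of_nonneg fun _ _ => mul_nonneg (by positivity)
      (mul_nonneg (by positivity) (hP0 _)), ← ENNReal.ofReal_natCast, ← ENNReal.ofReal_div_of_pos hg']
    refine ENNReal.ofReal_le_ofReal ?_
    rw [div_le_iff₀ hg', ← Finset.mul_sum, ← Finset.sum_mul, mul_assoc, mul_assoc]
    refine mul_le_mul_of_nonneg_left ?_ (by positivity)
    have e1 : P t = (1 - (H t).card / (2 * g : ℝ)) * P (t + 1) :=
      Finset.prod_eq_prod_Ico_succ_bot ht _
    rw [e1]
    have e2 : ∑ z ∈ Finset.range g, (1 / 2 : ℝ) ^ d (t + 1) (Function.update v t (a (t * g + z))) ≤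
        (1 / 2) ^ d t v * (g - (H t).card / 2) := by
      have e3 : ∀ z ∈ Finset.range g,
          (1 / 2 : ℝ) ^ d (t + 1) (Function.update v t (a (t * g + z))) ≤
          (1 / 2) ^ d t v * (1 - if z ∈ H t then 1 / 2 else 0) := fun z _ => by
        rw [hd, pow_add]
        refine mul_le_mul_of_nonneg_left ?_ (by positivity)
        by_cases hz : z ∈ H t
        · rw [if_pos hz, if_pos ⟨z, hz, rfl⟩]
          norm_num
        · rw [if_neg hz, sub_zero]
          exact pow_le_one₀ (by norm_num) (by norm_num)
      refine (Finset.sum_le_sum e3).trans (le_of_eq ?_)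
      rw [← Finset.mul_sum, Finset.sum_sub_distrib, Finset.sum_ite_mem,
        Finset.inter_eq_right.2 (Finset.filter_subset _ _), Finset.sum_const, Finset.sum_const,
        Finset.card_range, nsmul_eq_mul, nsmul_eq_mul]
      ring
    refine (mul_le_mul_of_nonneg_right e2 (hP0 _)).trans (le_of_eq ?_)
    field_simp
  · refine ENNReal.ofReal_le_ofReal ?_
    have e1 : P 0 ≤ (1 / 2 : ℝ) ^ (θ + x) := by
      have h1 : P 0 ≤ Real.exp (-(∑ t ∈ Finset.range G, (H t).card / (2 * g : ℝ))) := by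
        rw [← Finset.sum_neg_distrib, Real.exp_sum]
        simp only [P, Nat.Ico_zero_eq_range]
        refine Finset.prod_le_prod (fun t _ => hp0 t) fun t _ => ?_
        have := Real.add_one_le_exp (-((H t).card / (2 * g : ℝ)))
        linarith
      have h2 : O.card ≤ ∑ t ∈ Finset.range G, (H t).card + g := by
        have h2 : O ⊆ ((Finset.range G).biUnion fun i => (H i).image (i * g + ·)) ∪
            Finset.Ico (G * g) n := by
          intro z hz
          have hzn := Finset.mem_range.1 (hO hz)
          simp only [Finset.mem_union, Finset.mem_biUnion, Finset.mem_image, Finset.mem_Ico,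
            Finset.mem_range]
          by_cases h : z < G * g
          · left
            have h3 := Nat.div_add_mod' z g
            refine ⟨z / g, (Nat.div_lt_iff_lt_mul hg).2 h, z % g, (hH _ _).2 ⟨Nat.mod_lt _ hg, ?_⟩, h3⟩
            rwa [h3]
          · exact .inr ⟨by omega, hzn⟩
        refine (Finset.card_le_card h2).trans ((Finset.card_union_le _ _).trans (add_le_add ?_ ?_))
        · exact Finset.card_biUnion_le.trans (Finset.sum_le_sum fun i _ => Finset.card_image_le)
        · rw [Nat.card_Ico]
          omega
      have h3 : ((θ + x : ℕ) : ℝ) ≤ ∑ t ∈ Finset.range G, (H t).card / (2 * g : ℝ) := by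
        rw [← Finset.sum_div, le_div_iff₀ (by positivity), ← Nat.cast_sum]
        have : (θ + x) * (2 * g) ≤ ∑ t ∈ Finset.range G, (H t).card := by
          rw [mul_comm]
          omega
        exact_mod_cast this
      refine h1.trans ?_
      rw [← Real.rpow_natCast, Real.rpow_def_of_pos (by norm_num), Real.exp_le_exp, one_div,
        Real.log_inv]
      have := Real.log_two_lt_d9
      have h5 : (0 : ℝ) ≤ ((θ + x : ℕ) : ℝ) := by positivity
      nlinarith
    have e2 : d 0 v = 0 := by simp [d]
    rw [e2, pow_zero, one_mul]
    refine (mul_le_mul_of_nonneg_left e1 (by positivity)).trans (le_of_eq ?_)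
    rw [pow_add, ← mul_assoc, ← mul_pow]
    norm_num
  · rw [ENNReal.one_le_ofReal]
    have h1 : d G v ≤ lisOn v (Finset.range G) := by
      refine le_lisOn (Finset.filter_subset _ _) fun t ht t' ht' htt => ?_
      obtain ⟨z, hz, e⟩ := (Finset.mem_filter.1 ht).2
      obtain ⟨z', hz', e'⟩ := (Finset.mem_filter.1 ht').2
      rw [e, e']
      refine hm ((hH _ _).1 hz).2 ((hH _ _).1 hz').2 ?_
      have := Nat.mul_le_mul_right g (Nat.succ_le_of_lt htt)
      rw [Nat.succ_mul] at this
      have := ((hH _ _).1 hz).1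
      omega
    have h2 : P G = 1 := by simp [P]
    rw [h2, mul_one]
    have h3 : (1 / 2 : ℝ) ^ θ ≤ (1 / 2) ^ d G v :=
      pow_le_pow_of_le_one (by norm_num) (by norm_num) (by omega)
    have h4 : (2 : ℝ) ^ θ * (1 / 2) ^ θ = 1 := by rw [← mul_pow]; norm_num
    exact h4.symm.le.trans (mul_le_mul_of_nonneg_left h3 (by positivity))

/-- Take the length of a longest increasing subsequence of a sample with one entry from each block
of length register `31` as first estimate. -/
def thinBest : Prog :=
  asg 20 (rg 40 / rg 31) ;; thin ;; asg 21 (ct 1) ;; patience 8 ;; asg 45 (rg 10)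

variable {w n : ℕ} {A : Fin n → ℤ}

/-- `1 ≤ z ≤ L`, and `z = L` for `g = 1`, hold for all random choices. The lower bound 1 disposes of
thresholds `τ ≤ 1`, and the case `g = 1` makes short inputs exact. -/
theorem thinBest_expLe (hw : 1 ≤ w) {s : St} {g x θ b L : ℕ} (h31 : s.reg 31 = g)
    (h40 : s.reg 40 = n) (hg : 0 < g) (hgn : g ≤ n) (h98 : s.arr 9 = s.arr 8)
    (hL : L = lisOn (fun x => entry A x) (Finset.range n)) (hb : n < 2 ^ b)
    (hW : ((16 * n + 200 : ℕ) : ℤ) < wmax w) {G : St → ℝ≥0∞} {c₀ c₁ : ℝ≥0∞}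
    (hlow : c₁ = 0 ∨ 2 * g * (θ + x) + g ≤ L)
    (hG : ∀ s' (z : ℕ), (∀ r, 31 ≤ r → r ≠ 45 → s'.reg r = s.reg r) → s'.reg 45 = (z : ℤ) → 1 ≤ z →
      z ≤ L → (g = 1 → z = L) → G s' ≤ c₀ + (if z < θ then c₁ else 0)) :
    ExpLe w A thinBest s (n / g * (b * 60 + 500) + 100) G
      (c₀ + c₁ * ENNReal.ofReal ((1 / 2) ^ x)) := by
  classical
  obtain ⟨M, hM⟩ : ∃ M, M = n / g := ⟨_, rfl⟩
  have hMz : (n : ℤ) / g = M := by rw [hM]; push_cast; rfl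
  have hMg : M * g ≤ n := hM ▸ Nat.div_mul_le_self n g
  have hMg' : n ≤ M * g + g := by
    have := Nat.lt_div_mul_add hg (a := n)
    rw [← hM] at this
    omega
  have hMn : M ≤ n := hM ▸ Nat.div_le_self n g
  have hM0 : 0 < M := hM ▸ Nat.div_pos hgn hg
  obtain ⟨Ψ, f1, f2, f3⟩ : ∃ Ψ : ℕ → (ℕ → ℤ) → ℝ≥0∞,
      (∀ t < M, ∀ v, (∑ z ∈ Finset.range g,
        Ψ (t + 1) (Function.update v t (entry A (t * g + z : ℕ)))) / (g : ℝ≥0∞) ≤ Ψ t v) ∧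
      (∀ v, Ψ 0 v ≤ ENNReal.ofReal ((1 / 2) ^ x)) ∧
      (c₁ = 0 ∨ ∀ v, lisOn v (Finset.range M) < θ → 1 ≤ Ψ M v) := by
    rcases hlow with h | h
    · exact ⟨fun _ _ => 0, by simp, by simp, .inl h⟩
    · rw [hL] at h
      obtain ⟨Ψ, h1, h2, h3⟩ := exists_thin_potential hg hMg' h
      exact ⟨Ψ, h1, h2, .inr h3⟩
  rw [← hM]
  obtain ⟨T, hT⟩ : ∃ T, T = M * (b * 60 + 500) := ⟨_, rfl⟩
  have hT1 : M * 150 + M * (1 * (b * 60 + 318) + 30) ≤ T := by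
    rw [hT, ← mul_add]
    exact Nat.mul_le_mul_left M (by omega)
  rw [← hT]
  apply ExpLe.asg_seq hw (T := T + 90)
  · simp
    omega
  · simp [h31, h40, hMz]
    omega
  · norm_num
  set s₁ := s.setReg 20 ((rg 40 / rg 31).eval s) with hs₁
  have a20 : s₁.reg 20 = M := by simp [hs₁, St.setReg_reg, h31, h40, hMz]
  have a31 : ∀ r, 31 ≤ r → s₁.reg r = s.reg r := fun r hr => by
    simp [hs₁, St.setReg_reg, show r ≠ 20 by omega]
  have aarr : s₁.arr = s.arr := rfl
  clear_value s₁
  clear hs₁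
  have key := thin_expLe (A := A) (s := s₁) (g := g) (N := M) hw (by rw [a31 _ le_rfl, h31]) a20 hg
    (by omega) (by omega) (fun t v => c₀ + c₁ * Ψ t v) (fun t ht v => by
      simp only [avg_add_mul hg]
      gcongr
      exact f1 t ht v)
    (G := fun s' => if (∀ r, r = 20 ∨ 31 ≤ r → s'.reg r = s₁.reg r) ∧ s'.arr 9 = s'.arr 8 ∧
      (∀ t < M, s'.arr 10 t = 0 ∧ ∃ a < g, s'.arr 8 t = entry A (t * g + a : ℕ)) then
      c₀ + c₁ * Ψ M (s'.arr 8) else ⊤) (fun s' h1 h2 h3 => by rw [if_pos ⟨h1, h2, h3⟩])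
    (by rw [aarr, h98])
  refine ExpLe.weaken (ExpLe.seq (q := asg 21 (ct 1) ;; patience 8 ;; asg 45 (rg 10))
    (T' := M * (1 * (b * 60 + 318) + 30) + 30) (G := G) key fun s₂ => ?_) (by omega)
    (fun _ => .inl le_rfl) (by gcongr; exact f2 _)
  split_ifs with hc
  swap
  · exact ExpLe.top
  obtain ⟨b1, b2, b3⟩ := hc
  refine Run.expLe (Q := fun s' => G s' ≤ c₀ + c₁ * Ψ M (s₂.arr 8)) ?_ fun _ => id
  apply Run.time
  · apply Run.seq
    refine Run.asg hw (by simp; omega) (by norm_num) ?_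
    apply Run.seq
    refine (patience_run hw (o := 8) (by norm_num) (N := M) (k := 1) (b := b)
      (by rw [St.setReg_reg, if_neg (by norm_num), b1 _ (.inl rfl), a20])
      (by simp [St.setReg_reg]) one_pos (by omega) (by omega) (fun t _ _ => by
        rw [St.setReg_arr]
        exact (congrFun b2 t).ge)).post ?_
    rintro s₃ ⟨d1, d2, z, r, d3, d4, -, d5, d6⟩
    simp only [Nat.reduceAdd, mul_one] at d2 d5 d6
    rw [St.setReg_arr, b2] at d5 d6
    have hz : z = lisOn (s₂.arr 8) (Finset.range M) := by
      rw [Ends.eq_lisOn d5 d6 fun _ _ _ => rfl]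
      congr 1
      refine Finset.filter_true_of_mem fun t ht => ?_
      rw [(b3 t (by simpa using ht)).1]
      exact lt_irrefl _
    refine Run.asg hw (by simp) (by norm_num) ?_
    refine (hG _ z (fun r hr h45 => ?_) ?_ ?_ ?_ ?_).trans ?_
    · rw [St.setReg_reg, if_neg h45, d1 _ (by omega), St.setReg_reg, if_neg (by omega),
        b1 _ (.inr hr), a31 _ hr]
    · simp [St.setReg_reg, d3]
    · rw [hz]
      exact one_le_lisOn hM0
    · rw [hz, hL]
      exact lisOn_sample_le hMg fun t ht => (b3 t ht).2
    · intro hg1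
      subst hg1
      have hMn : M = n := by rw [hM, Nat.div_one]
      rw [hz, hL, hMn]
      refine lisOn_congr fun t ht => ?_
      obtain ⟨z, hz, e⟩ := (b3 t (by rw [hMn]; simpa using ht)).2
      obtain rfl : z = 0 := by omega
      rw [e]
      simp
    · gcongr
      rcases f3 with h | h
      · simp [h]
      · split_ifs with hlt
        · rw [hz] at hlt
          exact le_mul_of_one_le_right' (h _ hlt)
        · exact zero_le
  · simp
    omega

/-! ### All guesses together -/

/-- Try all orders of magnitude of the ratio of the length of the input to the length of a longest
increasing subsequence, with blocks of length register `31` whose number is in register `46`. -/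
def phases : Prog := forL 48 41 phase

variable {w n : ℕ} {A : Fin n → ℤ}

/-- The guess `q` of the ratio is so good that the estimate is at least `τ`. -/
def GoodGuess (n N B L x τ q : ℕ) : Prop :=
  n ≤ N * B + N ∧ n ≤ q * L ∧ 4 * N ≤ L ∧ 32 * x * B ≤ L ∧ 7077888 * q ^ 3 * τ ≤ L

/-- The time of a phase for the largest guess `q = x`: filling, rounds of extraction, scoring. -/
def phaseTime (N B b x : ℕ) : ℕ :=
  N * (36 * x ^ 2) * 150 + 2304 * x ^ 3 * (N * (36 * x ^ 2 * (b * 60 + 527) + 60) + 40) +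
    55296 * x ^ 4 * (B * (b * 60 + 500) + 230) + 500

open Classical in
-- `u j` is the price, before phase `j`, of a best estimate that is still below `τ`. The best
-- estimate never decreases, so every phase may pass the price on; a phase with a good guess makes
-- it smaller by a factor `2 * δ`. Every phase adds `δ` for the risk of an overestimate.
theorem phases_expLe (hw : 1 ≤ w) {s : St} {B N x b τ L : ℕ} (h31 : s.reg 31 = B)
    (h41 : s.reg 41 = x) (h46 : s.reg 46 = N) (hN : 0 < N) (hB : 0 < B) (hx : 0 < x)
    (hNB : N * B ≤ n) (hL : L = lisOn (fun x => entry A x) (Finset.range n))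
    (hbN : N * (36 * x ^ 2) < 2 ^ b) (hbB : B < 2 ^ b)
    (hW : ((N * (36 * x ^ 2) * (55296 * x ^ 4 * B + B * x) + 4 * (55296 * x ^ 4) * (2304 * x ^ 3) +
      16 * (N * (36 * x ^ 2)) + 16 * B + N * B + 200 : ℕ) : ℤ) < wmax w)
    (u : ℕ → ℝ≥0∞) (hu : ∀ j < x, u (j + 1) ≤ u j ∨
      2 * (u (j + 1) * ENNReal.ofReal ((1 / 2) ^ x)) ≤ u j ∧ GoodGuess n N B L x τ (j + 1))
    {G : St → ℝ≥0∞}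
    (hG : ∀ s', G s' ≤ (if (L : ℤ) < s'.reg 45 then 1 else 0) + (if s'.reg 45 < τ then u x else 0)) :
    ExpLe w A phases s (x * (phaseTime N B b x + 9) + 5) G
      ((if (L : ℤ) < s.reg 45 then 1 else 0) + x * ENNReal.ofReal ((1 / 2) ^ x) +
        (if s.reg 45 < τ then u 0 else 0)) := by
  obtain ⟨δ, hδ⟩ : ∃ δ, δ = ENNReal.ofReal ((1 / 2 : ℝ) ^ x) := ⟨_, rfl⟩
  rw [← hδ] at hu ⊢
  have hxw : x ≤ N * (36 * x ^ 2) := by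
    calc x ≤ x ^ 2 := by nlinarith
      _ ≤ N * 36 * x ^ 2 := Nat.le_mul_of_pos_left _ (by positivity)
      _ = _ := by ring
  have h := ExpLe.forL (w := w) (A := A) hw (i := 48) (b := 41) (p := phase) (by norm_num)
    (by norm_num) x (phaseTime N B b x) (by omega) (fun j s' =>
      if s'.reg 31 = B ∧ s'.reg 46 = N then
        (if (L : ℤ) < s'.reg 45 then 1 else 0) + ((x - j : ℕ) : ℝ≥0∞) * δ +
          (if s'.reg 45 < τ then u j else 0) else ⊤) ?_ s h41 (by norm_num)
  · refine h.weaken le_rfl (fun s' => .inl ?_) ?_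
    · by_cases hc : s'.reg 31 = B ∧ s'.reg 46 = N
      · rw [if_pos hc]
        refine (hG s').trans ?_
        rw [Nat.sub_self, Nat.cast_zero, zero_mul, add_zero]
      · rw [if_neg hc]
        exact le_top
    · rw [if_pos (by simp [St.setReg_reg, h31, h46])]
      simp [St.setReg_reg]
  intro j hj s' hs' h48 h41'
  by_cases hc : s'.reg 31 = B ∧ s'.reg 46 = N
  swap
  · rw [if_neg hc] at hs'
    exact absurd rfl hs'
  rw [if_pos hc]
  have hq1 : j + 1 ≤ x := hj
  have hk : 36 * (j + 1) ^ 2 ≤ 36 * x ^ 2 := Nat.mul_le_mul_left _ (Nat.pow_le_pow_left hq1 2)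
  have hR : 64 * (36 * (j + 1) ^ 2) * (j + 1) ≤ 2304 * x ^ 3 := by
    calc 64 * (36 * (j + 1) ^ 2) * (j + 1) = 2304 * (j + 1) ^ 3 := by ring
      _ ≤ _ := Nat.mul_le_mul_left _ (Nat.pow_le_pow_left hq1 3)
  have hS : 55296 * (j + 1) ^ 3 * x ≤ 55296 * x ^ 4 := by
    calc 55296 * (j + 1) ^ 3 * x ≤ 55296 * x ^ 3 * x :=
        Nat.mul_le_mul_right _ (Nat.mul_le_mul_left _ (Nat.pow_le_pow_left hq1 3))
      _ = _ := by ring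
  have hNk : N * (36 * (j + 1) ^ 2) ≤ N * (36 * x ^ 2) := Nat.mul_le_mul_left N hk
  have hW' : ((N * (36 * (j + 1) ^ 2) * (55296 * (j + 1) ^ 3 * x * B + B * x) +
      4 * (55296 * (j + 1) ^ 3 * x) * (64 * (36 * (j + 1) ^ 2) * (j + 1)) +
      16 * (N * (36 * (j + 1) ^ 2)) + 16 * B + N * B + 200 : ℕ) : ℤ) < wmax w := by
    refine lt_of_le_of_lt ?_ hW
    have : N * (36 * (j + 1) ^ 2) * (55296 * (j + 1) ^ 3 * x * B + B * x) +
      4 * (55296 * (j + 1) ^ 3 * x) * (64 * (36 * (j + 1) ^ 2) * (j + 1)) +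
      16 * (N * (36 * (j + 1) ^ 2)) + 16 * B + N * B + 200 ≤
      N * (36 * x ^ 2) * (55296 * x ^ 4 * B + B * x) + 4 * (55296 * x ^ 4) * (2304 * x ^ 3) +
      16 * (N * (36 * x ^ 2)) + 16 * B + N * B + 200 := by gcongr
    exact_mod_cast this
  have hT : N * (36 * (j + 1) ^ 2) * 150 + 64 * (36 * (j + 1) ^ 2) * (j + 1) *
      (N * (36 * (j + 1) ^ 2 * (b * 60 + 527) + 60) + 40) +
      55296 * (j + 1) ^ 3 * x * (B * (b * 60 + 500) + 230) + 500 ≤ phaseTime N B b x := by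
    unfold phaseTime
    gcongr
  have run := fun (c₀ c₂ : ℝ≥0∞) hlow hG => phase_expLe (A := A) (s := s') (B := B) (N := N) (y := j)
    (q := j + 1) (x := x) (b := b) (τ := τ) (L := L) hw hc.1 h41' hc.2 h48 rfl rfl rfl rfl hN hB hx
    hNB hL (hNk.trans_lt hbN) hbB hW' (c₀ := c₀) (c₁ := 1) (c₂ := c₂) (G := fun s'' =>
      if s''.reg 48 = j ∧ s''.reg 41 = x then
        if (s''.setReg 48 (j + 1 : ℕ)).reg 31 = B ∧ (s''.setReg 48 (j + 1 : ℕ)).reg 46 = N then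
          (if (L : ℤ) < (s''.setReg 48 (j + 1 : ℕ)).reg 45 then 1 else 0) +
            ((x - (j + 1) : ℕ) : ℝ≥0∞) * δ +
            (if (s''.setReg 48 (j + 1 : ℕ)).reg 45 < τ then u (j + 1) else 0) else ⊤ else ⊤) hlow hG
  rw [← hδ] at run
  have hxj : ((x - j : ℕ) : ℝ≥0∞) = ((x - (j + 1) : ℕ) : ℝ≥0∞) + 1 := by
    rw [← Nat.cast_succ]
    congr 1
    omega
  have hif : ∀ z : ℤ, (if (L : ℤ) < max (s'.reg 45) z then (1 : ℝ≥0∞) else 0) ≤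
      (if (L : ℤ) < s'.reg 45 then 1 else 0) + if (L : ℤ) < z then 1 else 0 := by
    intro z
    by_cases h1 : (L : ℤ) < s'.reg 45
    · rw [if_pos h1]
      refine le_trans ?_ le_self_add
      split_ifs <;> simp
    · by_cases h2 : (L : ℤ) < z
      · rw [if_pos h2]
        refine le_trans ?_ le_add_self
        split_ifs <;> simp
      · rw [if_neg (by simp only [lt_max_iff, h1, h2, or_self, not_false_eq_true])]
        exact zero_le
  rcases hu j hj with h1 | ⟨h1, h2⟩
  · refine (run ((if (L : ℤ) < s'.reg 45 then 1 else 0) + ((x - (j + 1) : ℕ) : ℝ≥0∞) * δ +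
      if s'.reg 45 < τ then u (j + 1) else 0) 0 (.inl rfl) ?_).weaken hT (fun _ => .inl le_rfl) ?_
    · intro s'' z a1 a2 a3
      rw [if_pos ⟨by rw [a1 _ (by norm_num) (by norm_num) (by norm_num), h48],
        by rw [a1 _ (by norm_num) (by norm_num) (by norm_num), h41']⟩]
      simp only [St.setReg_reg, Nat.reduceEqDiff, if_false]
      rw [if_pos ⟨a2, by rw [a1 _ (by norm_num) (by norm_num) (by norm_num), hc.2]⟩, a3]
      have : (if max (s'.reg 45) z < τ then u (j + 1) else 0) ≤
          if s'.reg 45 < τ then u (j + 1) else 0 := by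
        by_cases h3 : s'.reg 45 < τ
        · rw [if_pos h3]
          split_ifs <;> simp
        · rw [if_neg (by rw [max_lt_iff]; exact fun h => h3 h.1)]
          exact zero_le
      calc _ ≤ ((if (L : ℤ) < s'.reg 45 then 1 else 0) + if (L : ℤ) < z then 1 else 0) +
            ((x - (j + 1) : ℕ) : ℝ≥0∞) * δ + if s'.reg 45 < τ then u (j + 1) else 0 := by
              gcongr
              exact hif z
        _ = _ := by simp only [ite_self, add_zero]; ring
    · rw [hxj]
      have : (if s'.reg 45 < τ then u (j + 1) else 0) ≤ if s'.reg 45 < τ then u j else 0 := by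
        split_ifs
        · exact h1
        · exact le_rfl
      calc _ = (if (L : ℤ) < s'.reg 45 then 1 else 0) + (((x - (j + 1) : ℕ) : ℝ≥0∞) + 1) * δ +
            if s'.reg 45 < τ then u (j + 1) else 0 := by ring
        _ ≤ _ := by gcongr
  · refine (run ((if (L : ℤ) < s'.reg 45 then 1 else 0) + ((x - (j + 1) : ℕ) : ℝ≥0∞) * δ)
      (if s'.reg 45 < τ then u (j + 1) else 0) (.inr h2) ?_).weaken hT (fun _ => .inl le_rfl) ?_
    · intro s'' z a1 a2 a3
      rw [if_pos ⟨by rw [a1 _ (by norm_num) (by norm_num) (by norm_num), h48],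
        by rw [a1 _ (by norm_num) (by norm_num) (by norm_num), h41']⟩]
      simp only [St.setReg_reg, Nat.reduceEqDiff, if_false]
      rw [if_pos ⟨a2, by rw [a1 _ (by norm_num) (by norm_num) (by norm_num), hc.2]⟩, a3]
      have : (if max (s'.reg 45) z < τ then u (j + 1) else 0) ≤
          if z < τ then (if s'.reg 45 < τ then u (j + 1) else 0) else 0 := by
        by_cases h3 : s'.reg 45 < τ
        · by_cases h4 : z < τ
          · rw [if_pos h3, if_pos h4, if_pos (max_lt h3 h4)]
          · rw [if_neg (by rw [max_lt_iff]; exact fun h => h4 h.2)]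
            exact zero_le
        · rw [if_neg (by rw [max_lt_iff]; exact fun h => h3 h.1)]
          exact zero_le
      calc _ ≤ ((if (L : ℤ) < s'.reg 45 then 1 else 0) + if (L : ℤ) < z then 1 else 0) +
            ((x - (j + 1) : ℕ) : ℝ≥0∞) * δ +
              if z < τ then (if s'.reg 45 < τ then u (j + 1) else 0) else 0 := by
              gcongr
              exact hif z
        _ = _ := by ring
    · rw [hxj]
      have : 2 * ((if s'.reg 45 < τ then u (j + 1) else 0) * δ) ≤
          if s'.reg 45 < τ then u j else 0 := by
        split_ifs
        · exact h1
        · simp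
      calc _ = (if (L : ℤ) < s'.reg 45 then 1 else 0) + (((x - (j + 1) : ℕ) : ℝ≥0∞) + 1) * δ +
            2 * ((if s'.reg 45 < τ then u (j + 1) else 0) * δ) := by ring
        _ ≤ _ := by gcongr

/-! ### The complete algorithm -/

/-- Set register `42` to the twentieth power of the successor of register `41`. -/
def nextPow : Prog :=
  asg 44 (rg 41 + ct 1) ;; asg 42 (rg 44 * rg 44) ;; asg 42 (rg 42 * rg 42) ;;
  asg 42 (rg 42 * rg 44) ;; asg 42 (rg 42 * rg 42) ;; asg 42 (rg 42 * rg 42)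

/-- Set register `41` to the twentieth root of the length of the input, rounded down. -/
def findRoot : Prog :=
  asg 40 (rg 0) ;; asg 41 (ct 1) ;; asg 43 (rg 40 + ct 1) ;; nextPow ;;
  .whileLt 42 43 (asg 41 (rg 41 + ct 1) ;; nextPow)

/-- Improve the first estimate by those obtained from `x ^ 10` blocks, for `x` in register `41`. -/
def improve : Prog :=
  asg 46 (rg 41 * rg 41) ;; asg 46 (rg 46 * rg 46) ;; asg 46 (rg 46 * rg 41) ;;
  asg 46 (rg 46 * rg 46) ;; asg 31 (rg 40 / rg 46) ;; phases

/-- Estimate the length of a longest increasing subsequence, with random choices only for inputs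
of length at least `x₀ ^ 20`. -/
def estimateLis (x₀ : ℕ) : Prog :=
  findRoot ;; ifL (rg 41) (ct x₀) (asg 31 (ct 1)) (asg 31 (rg 41 * rg 41 * rg 41)) ;; thinBest ;;
  ifL (rg 41) (ct x₀) skip improve ;; asg 0 (rg 45)

variable {w n : ℕ} {A : Fin n → ℤ}

theorem nextPow_run (hw : 1 ≤ w) {s : St} {y : ℕ} (h41 : s.reg 41 = y)
    (hy : (((y + 1) ^ 20 : ℕ) : ℤ) < wmax w) :
    Run w A nextPow s 60 fun s' => (∀ r, r ≠ 42 → r ≠ 44 → s'.reg r = s.reg r) ∧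
      s'.arr = s.arr ∧ s'.reg 42 = ((y + 1) ^ 20 : ℕ) := by
  obtain ⟨z, hz⟩ : ∃ z, z = y + 1 := ⟨_, rfl⟩
  have hyz : (y : ℤ) + 1 = z := by rw [hz]; push_cast; rfl
  rw [← hz] at hy ⊢
  have hz0 : 0 < z := by omega
  have hp : ∀ i, i ≤ 20 → (z ^ i : ℕ) ≤ z ^ 20 := fun i hi => Nat.pow_le_pow_right hz0 hi
  have h1 := hp 1 (by norm_num)
  have h2 := hp 2 (by norm_num)
  have h4 := hp 4 (by norm_num)
  have h5 := hp 5 (by norm_num)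
  have h10 := hp 10 (by norm_num)
  have e2 : (z : ℤ) * z = (z ^ 2 : ℕ) := by push_cast; ring
  have e4 : ((z ^ 2 : ℕ) : ℤ) * (z ^ 2 : ℕ) = (z ^ 4 : ℕ) := by push_cast; ring
  have e5 : ((z ^ 4 : ℕ) : ℤ) * z = (z ^ 5 : ℕ) := by push_cast; ring
  have e10 : ((z ^ 5 : ℕ) : ℤ) * (z ^ 5 : ℕ) = (z ^ 10 : ℕ) := by push_cast; ring
  have e20 : ((z ^ 10 : ℕ) : ℤ) * (z ^ 10 : ℕ) = (z ^ 20 : ℕ) := by push_cast; ring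
  rw [pow_one] at h1
  clear hp
  generalize z ^ 2 = z2 at *
  generalize z ^ 4 = z4 at *
  generalize z ^ 5 = z5 at *
  generalize z ^ 10 = z10 at *
  generalize z ^ 20 = z20 at *
  apply Run.time
  · apply Run.seq
    refine Run.asg hw (by simp [h41]; omega) (by norm_num) ?_
    apply Run.seq
    refine Run.asg hw (by simp [St.setReg_reg, h41, hyz, e2]; omega) (by norm_num) ?_
    apply Run.seq
    refine Run.asg hw (by simp [St.setReg_reg, h41, hyz, e2, e4]; omega) (by norm_num) ?_
    apply Run.seq
    refine Run.asg hw (by simp [St.setReg_reg, h41, hyz, e2, e4, e5]; omega) (by norm_num) ?_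
    apply Run.seq
    refine Run.asg hw (by simp [St.setReg_reg, h41, hyz, e2, e4, e5, e10]; omega) (by norm_num) ?_
    refine Run.asg hw (by simp [St.setReg_reg, h41, hyz, e2, e4, e5, e10, e20]; omega)
      (by norm_num) ⟨fun r h h' => by simp [St.setReg_reg, h, h'], rfl, ?_⟩
    simp [St.setReg_reg, h41, hyz, e2, e4, e5, e10, e20]
  · simp

theorem findRoot_run (hw : 1 ≤ w) {s : St} {x : ℕ} (h0 : s.reg 0 = n) (hx : 0 < x) (hxn : x ^ 20 ≤ n)
    (hnx : n < (x + 1) ^ 20) (hW : (((x + 1) ^ 20 : ℕ) : ℤ) < wmax w) :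
    Run w A findRoot s (x * 80 + 100) fun s' => s'.reg 40 = n ∧ s'.reg 41 = x ∧ s'.arr = s.arr := by
  have hxw : x ≤ (x + 1) ^ 20 := (Nat.le_succ x).trans (Nat.le_self_pow (by norm_num) _)
  apply Run.time
  · apply Run.seq
    refine Run.asg hw (by simp) (by norm_num) ?_
    apply Run.seq
    refine Run.asg hw (by simp; omega) (by norm_num) ?_
    apply Run.seq
    refine Run.asg hw (by simp [St.setReg_reg, h0]; omega) (by norm_num) ?_
    apply Run.seq
    refine (nextPow_run hw (y := 1) (by simp [St.setReg_reg]) ?_).post ?_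
    · refine lt_of_le_of_lt ?_ hW
      exact_mod_cast Nat.pow_le_pow_left (by omega : 1 + 1 ≤ x + 1) 20
    rintro s₁ ⟨a1, a2, a3⟩
    -- After `j` iterations the root considered is `j + 1` and register `42` holds the next
    -- twentieth power. Register `43` is `n + 1`, so the strict comparison means that this power is
    -- at most `n`.
    refine (Run.whileLt (by norm_num) (by norm_num) (x - 1) 70 (fun j s' =>
      s'.reg 40 = n ∧ s'.reg 41 = (j + 1 : ℕ) ∧ s'.reg 42 = ((j + 2) ^ 20 : ℕ) ∧
      s'.reg 43 = (n + 1 : ℕ) ∧ s'.arr = s.arr) ?_ ?_ ?_).post ?_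
    · rintro j hj s₂ ⟨b1, b2, b3, b4, b5⟩
      constructor
      · rw [b3, b4]
        have : (j + 2) ^ 20 ≤ x ^ 20 := Nat.pow_le_pow_left (by omega) 20
        exact_mod_cast Nat.lt_succ_of_le (this.trans hxn)
      · have e : ((j + 1 : ℕ) : ℤ) + 1 = (j + 2 : ℕ) := by push_cast; ring
        apply Run.time
        · apply Run.seq
          refine Run.asg hw (by simp only [ok_add, ok_rg, ok_ct, eval_rg, eval_ct, b2]; omega)
            (by norm_num) ?_
          refine (nextPow_run hw (y := j + 2) ?_ ?_).post ?_
          · simp only [eval_add, eval_rg, eval_ct, b2, St.setReg_reg, if_true, e]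
          · refine lt_of_le_of_lt ?_ hW
            exact_mod_cast Nat.pow_le_pow_left (by omega : j + 2 + 1 ≤ x + 1) 20
          · rintro s₃ ⟨c1, c2, c3⟩
            refine ⟨?_, ?_, c3, ?_, by rw [c2]; exact b5⟩
            · rw [c1 _ (by norm_num) (by norm_num), St.setReg_reg, if_neg (by norm_num), b1]
            · rw [c1 _ (by norm_num) (by norm_num), St.setReg_reg, if_pos rfl, eval_add, eval_rg,
                eval_ct, b2, e]
            · rw [c1 _ (by norm_num) (by norm_num), St.setReg_reg, if_neg (by norm_num), b4]
        · simp
    · rintro s₂ ⟨-, -, b3, b4, -⟩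
      rw [b3, b4, show x - 1 + 2 = x + 1 by omega]
      exact_mod_cast hnx
    · refine ⟨?_, ?_, a3, ?_, a2⟩
      · rw [a1 _ (by norm_num) (by norm_num)]
        simp [St.setReg_reg, h0]
      · rw [a1 _ (by norm_num) (by norm_num)]
        simp [St.setReg_reg]
      · rw [a1 _ (by norm_num) (by norm_num)]
        simp [St.setReg_reg, h0]
    · rintro s₂ ⟨b1, b2, -, -, b5⟩
      refine ⟨b1, ?_, b5⟩
      rw [b2, show x - 1 + 1 = x by omega]
  · simp
    omega

/-- One product of number and length of blocks is at most `n`, and all other powers of `x` that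
occur are at most `x ^ 20 ≤ n`. So a quadratic bound holds, and words of logarithmic length suffice.
-/
theorem phases_word_bound {x : ℕ} (hx : 0 < x) (hxn : x ^ 20 ≤ n) :
    x ^ 10 * (36 * x ^ 2) * (55296 * x ^ 4 * (n / x ^ 10) + n / x ^ 10 * x) +
      4 * (55296 * x ^ 4) * (2304 * x ^ 3) + 16 * (x ^ 10 * (36 * x ^ 2)) + 16 * (n / x ^ 10) +
      x ^ 10 * (n / x ^ 10) + 200 ≤ 2 ^ 40 * n ^ 2 := by
  have hp : ∀ i, i ≤ 20 → x ^ i ≤ n := fun i hi => (Nat.pow_le_pow_right hx hi).trans hxn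
  obtain ⟨B, hB⟩ : ∃ B, B = n / x ^ 10 := ⟨_, rfl⟩
  have hNB : x ^ 10 * B ≤ n := hB ▸ Nat.mul_div_le n _
  have hBn : B ≤ n := hB ▸ Nat.div_le_self n _
  have hn : 0 < n := lt_of_lt_of_le (by positivity) hxn
  have hnn : n ≤ n ^ 2 := Nat.le_self_pow (by norm_num) n
  rw [← hB]
  have h1 : x ^ 10 * (36 * x ^ 2) * (55296 * x ^ 4 * B + B * x) ≤ 2000000 * n ^ 2 := by
    calc x ^ 10 * (36 * x ^ 2) * (55296 * x ^ 4 * B + B * x) =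
        x ^ 10 * B * (1990656 * x ^ 6 + 36 * x ^ 3) := by ring
      _ ≤ n * (1990656 * n + 36 * n) :=
        Nat.mul_le_mul hNB (add_le_add (Nat.mul_le_mul_left _ (hp 6 (by norm_num)))
          (Nat.mul_le_mul_left _ (hp 3 (by norm_num))))
      _ ≤ 2000000 * n ^ 2 := by nlinarith
  have h2 : 4 * (55296 * x ^ 4) * (2304 * x ^ 3) ≤ 509607936 * n := by
    calc 4 * (55296 * x ^ 4) * (2304 * x ^ 3) = 509607936 * x ^ 7 := by ring
      _ ≤ _ := Nat.mul_le_mul_left _ (hp 7 (by norm_num))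
  have h3 : 16 * (x ^ 10 * (36 * x ^ 2)) ≤ 576 * n := by
    calc 16 * (x ^ 10 * (36 * x ^ 2)) = 576 * x ^ 12 := by ring
      _ ≤ _ := Nat.mul_le_mul_left _ (hp 12 (by norm_num))
  norm_num
  omega

open Classical in
theorem improve_expLe (hw : 1 ≤ w) {s : St} {x b τ L : ℕ} (h40 : s.reg 40 = n) (h41 : s.reg 41 = x)
    (hx : 0 < x) (hxn : x ^ 20 ≤ n) (hL : L = lisOn (fun x => entry A x) (Finset.range n))
    (hb : 64 * n ≤ 2 ^ b) (hW : ((2 ^ 40 * n ^ 2 : ℕ) : ℤ) < wmax w) (u : ℕ → ℝ≥0∞)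
    (hu : ∀ j < x, u (j + 1) ≤ u j ∨ 2 * (u (j + 1) * ENNReal.ofReal ((1 / 2) ^ x)) ≤ u j ∧
      GoodGuess n (x ^ 10) (n / x ^ 10) L x τ (j + 1)) {G : St → ℝ≥0∞}
    (hG : ∀ s', G s' ≤ (if (L : ℤ) < s'.reg 45 then 1 else 0) + (if s'.reg 45 < τ then u x else 0)) :
    ExpLe w A improve s (x * (phaseTime (x ^ 10) (n / x ^ 10) b x + 9) + 105) G
      ((if (L : ℤ) < s.reg 45 then 1 else 0) + x * ENNReal.ofReal ((1 / 2) ^ x) +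
        (if s.reg 45 < τ then u 0 else 0)) := by
  have hp : ∀ i, i ≤ 20 → x ^ i ≤ n := fun i hi => (Nat.pow_le_pow_right hx hi).trans hxn
  have hn : 0 < n := lt_of_lt_of_le (by positivity) hxn
  have hnn : n ≤ 2 ^ 40 * n ^ 2 :=
    (Nat.le_self_pow (by norm_num) n).trans (Nat.le_mul_of_pos_left _ (by norm_num))
  have hnw : (n : ℤ) < wmax w := lt_of_le_of_lt (by exact_mod_cast hnn) hW
  have h2 := hp 2 (by norm_num)
  have h4 := hp 4 (by norm_num)
  have h5 := hp 5 (by norm_num)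
  have h10 := hp 10 (by norm_num)
  have hW' := lt_of_le_of_lt (Int.ofNat_le.2 (phases_word_bound hx hxn)) hW
  have hb1 : x ^ 10 * (36 * x ^ 2) < 2 ^ b := by
    calc x ^ 10 * (36 * x ^ 2) = 36 * x ^ 12 := by ring
      _ ≤ 36 * n := Nat.mul_le_mul_left _ (hp 12 (by norm_num))
      _ < 64 * n := by omega
      _ ≤ 2 ^ b := hb
  have hB : 0 < n / x ^ 10 := Nat.div_pos h10 (by positivity)
  have hBn : n / x ^ 10 ≤ n := Nat.div_le_self n _
  have hNB : x ^ 10 * (n / x ^ 10) ≤ n := Nat.mul_div_le n _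
  have hN : 0 < x ^ 10 := by positivity
  have e2 : (x : ℤ) * x = (x ^ 2 : ℕ) := by push_cast; ring
  have e4 : ((x ^ 2 : ℕ) : ℤ) * (x ^ 2 : ℕ) = (x ^ 4 : ℕ) := by push_cast; ring
  have e5 : ((x ^ 4 : ℕ) : ℤ) * x = (x ^ 5 : ℕ) := by push_cast; ring
  have e10 : ((x ^ 5 : ℕ) : ℤ) * (x ^ 5 : ℕ) = (x ^ 10 : ℕ) := by push_cast; ring
  have eB : (n : ℤ) / (x ^ 10 : ℕ) = (n / x ^ 10 : ℕ) := by push_cast; rfl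
  have main := fun s' (h31 : s'.reg 31 = ((n / x ^ 10 : ℕ) : ℤ)) h41 (h46 : s'.reg 46 = ((x ^ 10 : ℕ) : ℤ)) =>
    phases_expLe (A := A) (s := s') (b := b) hw h31 h41 h46 hN hB hx hNB hL hb1 (by omega) hW' u hu hG
  clear hW' hW hb1 hu hG
  generalize n / x ^ 10 = B at *
  generalize x ^ 10 = x10 at *
  generalize x ^ 5 = x5 at *
  generalize x ^ 4 = x4 at *
  generalize x ^ 2 = x2 at *
  obtain ⟨T, hT⟩ : ∃ T, T = x * (phaseTime x10 B b x + 9) := ⟨_, rfl⟩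
  rw [← hT] at main ⊢
  apply ExpLe.asg_seq hw (T := T + 90)
  · simp
    omega
  · simp [h41, e2]
    omega
  · norm_num
  apply ExpLe.asg_seq hw (T := T + 70)
  · simp
    omega
  · simp [St.setReg_reg, h41, e2, e4]
    omega
  · norm_num
  apply ExpLe.asg_seq hw (T := T + 50)
  · simp
    omega
  · simp [St.setReg_reg, h41, e2, e4, e5]
    omega
  · norm_num
  apply ExpLe.asg_seq hw (T := T + 30)
  · simp
    omega
  · simp [St.setReg_reg, h41, e2, e4, e5, e10]
    omega
  · norm_num
  apply ExpLe.asg_seq hw (T := T + 5)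
  · simp
    omega
  · simp [St.setReg_reg, h41, h40, e2, e4, e5, e10, eB]
    omega
  · norm_num
  refine (main _ ?_ ?_ ?_).weaken le_rfl (fun _ => .inl le_rfl) ?_
  · simp [St.setReg_reg, h41, h40, e2, e4, e5, e10, eB]
  · simp [St.setReg_reg, h41]
  · simp [St.setReg_reg, h41, e2, e4, e5, e10]
  · simp [St.setReg_reg]

variable {w n : ℕ} {A : Fin n → ℤ}

/-- A bound for the running time of `estimateLis` if the first estimate is obtained from blocks of
length `g`. -/
def estimateTime (n b x g : ℕ) : ℕ :=
  x * 80 + n / g * (b * 60 + 500) + x * (phaseTime (x ^ 10) (n / x ^ 10) b x + 9) + 400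

theorem succ_pow_twenty_le {x : ℕ} (hx : 0 < x) (hxn : x ^ 20 ≤ n) :
    (x + 1) ^ 20 ≤ 2 ^ 20 * n := by
  calc (x + 1) ^ 20 ≤ (2 * x) ^ 20 := Nat.pow_le_pow_left (by omega) 20
    _ = 2 ^ 20 * x ^ 20 := mul_pow _ _ _
    _ ≤ _ := Nat.mul_le_mul_left _ hxn

theorem estimateLis_expLe_of_thin (hw : 1 ≤ w) {s : St} {x x₀ b L g T : ℕ} (h0 : s.reg 0 = n)
    (h98 : s.arr 9 = s.arr 8) (hx : 0 < x) (hxn : x ^ 20 ≤ n) (hnx : n < (x + 1) ^ 20)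
    (hL : L = lisOn (fun x => entry A x) (Finset.range n)) (hb : 64 * n ≤ 2 ^ b)
    (hW : ((2 ^ 40 * n ^ 2 + x₀ : ℕ) : ℤ) < wmax w) (hg : g = if x < x₀ then 1 else x ^ 3)
    {θ : ℕ} {G : St → ℝ≥0∞} {c₀ c₁ : ℝ≥0∞} (hlow : c₁ = 0 ∨ 2 * g * (θ + x) + g ≤ L)
    (hG : ∀ s' (z : ℕ), s'.reg 40 = (n : ℤ) → s'.reg 41 = (x : ℤ) →
      s'.reg 45 = (z : ℤ) → 1 ≤ z → z ≤ L →
      (g = 1 → z = L) → ExpLe w A (ifL (rg 41) (ct x₀) skip improve ;; asg 0 (rg 45)) s' T G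
        (c₀ + (if z < θ then c₁ else 0))) :
    ExpLe w A (estimateLis x₀) s (x * 80 + n / g * (b * 60 + 500) + T + 250) G
      (c₀ + c₁ * ENNReal.ofReal ((1 / 2) ^ x)) := by
  have hn : 0 < n := lt_of_lt_of_le (by positivity) hxn
  have hnn : n ≤ n ^ 2 := Nat.le_self_pow (by norm_num) n
  have h20 := succ_pow_twenty_le hx hxn
  have hg0 : 0 < g := by rw [hg]; split_ifs <;> positivity
  have h3n : x ^ 3 ≤ n := (Nat.pow_le_pow_right hx (by norm_num)).trans hxn
  have hgn : g ≤ n := by rw [hg]; split_ifs <;> omega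
  have h2 : x ^ 2 ≤ n := (Nat.pow_le_pow_right hx (by norm_num)).trans hxn
  have h1 : x ≤ n := (Nat.le_self_pow (by norm_num) x).trans hxn
  have hWn : ((2 ^ 40 * n + x₀ : ℕ) : ℤ) < wmax w :=
    lt_of_le_of_lt (by exact_mod_cast Nat.add_le_add_right (Nat.mul_le_mul_left _ hnn) _) hW
  have e2 : (x : ℤ) * x = (x ^ 2 : ℕ) := by push_cast; ring
  have e3 : ((x ^ 2 : ℕ) : ℤ) * x = (x ^ 3 : ℕ) := by push_cast; ring
  generalize x ^ 2 = x2 at *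
  generalize x ^ 3 = x3 at *
  have key : Run w A findRoot s (x * 80 + 100) fun s' =>
      ExpLe w A (ifL (rg 41) (ct x₀) (asg 31 (ct 1)) (asg 31 (rg 41 * rg 41 * rg 41)) ;; thinBest ;;
        ifL (rg 41) (ct x₀) skip improve ;; asg 0 (rg 45)) s'
        (n / g * (b * 60 + 500) + T + 140) G (c₀ + c₁ * ENNReal.ofReal ((1 / 2) ^ x)) := by
    refine (findRoot_run hw h0 hx hxn hnx (lt_of_le_of_lt (Int.ofNat_le.2 (by omega)) hWn)).post ?_
    rintro s₁ ⟨a40, a41, aarr⟩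
    have step2 : Run w A (ifL (rg 41) (ct x₀) (asg 31 (ct 1)) (asg 31 (rg 41 * rg 41 * rg 41))) s₁
        30 fun s' => s'.reg 40 = n ∧ s'.reg 41 = x ∧ s'.arr = s.arr ∧ s'.reg 31 = g := by
      apply Run.time
      · refine Run.ifL hw (T := 3) (T' := 13) (by simp) (by simp; omega) (fun hlt => ?_) fun hge => ?_
        · rw [eval_rg, eval_ct, a41] at hlt
          refine (Run.asg hw (d := 31) (e := ct 1) ?_ ?_ ⟨?_, ?_, aarr, ?_⟩).time ?_
          · simp
            omega
          · norm_num
          · simp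
          · simp [St.setReg_reg, a40]
          · simp [St.setReg_reg, a41]
          · simp [St.setReg_reg, hg, show x < x₀ by omega]
        · rw [eval_rg, eval_ct, a41] at hge
          refine (Run.asg hw (d := 31) (e := rg 41 * rg 41 * rg 41) ?_ ?_ ⟨?_, ?_, aarr, ?_⟩).time ?_
          · simp [a41, e2, e3]
            omega
          · norm_num
          · simp
          · simp [St.setReg_reg, a40]
          · simp [St.setReg_reg, a41]
          · simp only [St.setReg_reg, if_true, eval_mul, eval_rg, a41, e2, e3, hg,
              if_neg (show ¬ x < x₀ by omega)]
      · simp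
    refine ExpLe.weaken (ExpLe.run_seq (T := 30) (T' := n / g * (b * 60 + 500) + T + 101)
      (step2.post ?_)) (by omega) (fun _ => .inl le_rfl) le_rfl
    rintro s₂ ⟨b40, b41, barr, b31⟩
    classical
    refine ExpLe.weaken (ExpLe.seq (thinBest_expLe hw (θ := θ) (x := x) (b := b) b31 b40 hg0 hgn
      (by rw [barr]; exact h98) hL (by omega) (by push_cast at hWn ⊢; omega) hlow
      (G := fun s' => if s'.reg 40 = n ∧ s'.reg 41 = x ∧ ∃ z : ℕ, s'.reg 45 = z ∧ 1 ≤ z ∧ z ≤ L ∧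
        (g = 1 → z = L) then c₀ + (if s'.reg 45 < θ then c₁ else 0) else ⊤) ?_) (T' := T)
      (G := G) fun s' => ?_) (by omega) (fun _ => .inl le_rfl) le_rfl
    · intro s' z d1 d2 d3 d4 d5
      rw [if_pos ⟨by rw [d1 _ (by norm_num) (by norm_num), b40],
        by rw [d1 _ (by norm_num) (by norm_num), b41], z, d2, d3, d4, d5⟩, d2]
      simp
    · split_ifs with h h'
      · obtain ⟨d1, d2, z, d3, d4, d5, d6⟩ := h
        have := hG s' z d1 d2 d3 d4 d5 d6
        rwa [if_pos (by rw [d3] at h'; exact_mod_cast h')] at this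
      · obtain ⟨d1, d2, z, d3, d4, d5, d6⟩ := h
        have := hG s' z d1 d2 d3 d4 d5 d6
        rwa [if_neg (by rw [d3] at h'; exact_mod_cast h')] at this
      · exact ExpLe.top
  exact ExpLe.weaken (ExpLe.run_seq key) (by omega) (fun _ => .inl le_rfl) le_rfl

theorem estimateLis_expLe_of_lt (hw : 1 ≤ w) {s : St} {x x₀ b L : ℕ} (h0 : s.reg 0 = n)
    (h98 : s.arr 9 = s.arr 8) (hx : 0 < x) (hxn : x ^ 20 ≤ n) (hnx : n < (x + 1) ^ 20)
    (hL : L = lisOn (fun x => entry A x) (Finset.range n)) (hb : 64 * n ≤ 2 ^ b)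
    (hW : ((2 ^ 40 * n ^ 2 + x₀ : ℕ) : ℤ) < wmax w) (hlt : x < x₀) :
    ExpLe w A (estimateLis x₀) s (estimateTime n b x 1)
      (fun s' => if s'.reg 0 = L then 0 else 1) 0 := by
  have h1 : x ≤ n := (Nat.le_self_pow (by norm_num) x).trans hxn
  refine (estimateLis_expLe_of_thin hw h0 h98 hx hxn hnx hL hb hW (g := 1) (by rw [if_pos hlt])
    (θ := 0) (T := 20) (c₀ := 0) (c₁ := 0) (.inl rfl) ?_).weaken ?_ (fun _ => .inl le_rfl) (by simp)
  · intro s' z a40 a41 a45 _ _ hz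
    simp only [ite_self, add_zero]
    refine Run.expLe (Q := fun s' => s'.reg 0 = L) ?_ fun s'' h => by rw [if_pos h]
    apply Run.time
    · apply Run.seq
      refine Run.ifL hw (T := 1) (T' := 0) (by simp) ?_ (fun _ => Run.skip ?_) fun h => ?_
      · simp
        push_cast at hW
        have := sq_nonneg (n : ℤ)
        omega
      · refine Run.asg hw (by simp) (by norm_num) ?_
        simp [St.setReg_reg, a45, hz rfl]
      · rw [eval_rg, eval_ct, a41] at h
        omega
    · simp
  · unfold estimateTime
    omega

theorem estimateLis_expLe_of_le (hw : 1 ≤ w) {s : St} {x x₀ b L τ : ℕ} (h0 : s.reg 0 = n)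
    (h98 : s.arr 9 = s.arr 8) (hx : 0 < x) (hxn : x ^ 20 ≤ n) (hnx : n < (x + 1) ^ 20)
    (hL : L = lisOn (fun x => entry A x) (Finset.range n)) (hb : 64 * n ≤ 2 ^ b)
    (hW : ((2 ^ 40 * n ^ 2 + x₀ : ℕ) : ℤ) < wmax w) (hle : x₀ ≤ x)
    (hlow : τ ≤ 1 ∨ 2 * x ^ 3 * (τ + x) + x ^ 3 ≤ L ∨
      ∃ q, 1 ≤ q ∧ q ≤ x ∧ GoodGuess n (x ^ 10) (n / x ^ 10) L x τ q) :
    ExpLe w A (estimateLis x₀) s (estimateTime n b x (x ^ 3))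
      (fun s' => if (τ : ℤ) ≤ s'.reg 0 ∧ s'.reg 0 ≤ L then 0 else 1)
      ((x + 2 : ℕ) * ENNReal.ofReal ((1 / 2) ^ x)) := by
  obtain ⟨δ, hδ⟩ : ∃ δ, δ = ENNReal.ofReal ((1 / 2) ^ x) := ⟨_, rfl⟩
  have hW' : ((2 ^ 40 * n ^ 2 : ℕ) : ℤ) < wmax w := by push_cast at hW ⊢; omega
  obtain ⟨u, c₀, c₁, hu, hux, hc₁, hc, hz⟩ : ∃ (u : ℕ → ℝ≥0∞) (c₀ c₁ : ℝ≥0∞),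
      (∀ j < x, u (j + 1) ≤ u j ∨ 2 * (u (j + 1) * δ) ≤ u j ∧
        GoodGuess n (x ^ 10) (n / x ^ 10) L x τ (j + 1)) ∧ u x = 1 ∧
      (c₁ = 0 ∨ 2 * x ^ 3 * (τ + x) + x ^ 3 ≤ L) ∧ c₀ + c₁ * δ ≤ 2 * δ ∧
      ∀ z : ℕ, 1 ≤ z → (if z < τ then u 0 else 0) ≤ c₀ + (if z < τ then c₁ else 0) := by
    rcases hlow with h | h | ⟨q, hq, hqx, h⟩
    · refine ⟨fun _ => 1, 0, 0, by simp, rfl, .inl rfl, by simp, fun z hz => ?_⟩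
      rw [if_neg (by omega)]
      exact zero_le
    · refine ⟨fun _ => 1, 0, 1, by simp, rfl, .inr h, ?_, fun z hz => by simp⟩
      rw [zero_add, two_mul, one_mul]
      exact le_self_add
    -- Phase `q - 1` tries the guess `q`. Up to it the price is `2 * δ`, afterwards it is 1, and
    -- only that phase needs a good guess.
    · refine ⟨fun j => if j < q then 2 * δ else 1, 2 * δ, 0, fun j hj => ?_, if_neg (by omega),
        .inl rfl, by simp, fun z hz => ?_⟩
      · dsimp only
        rcases lt_trichotomy (j + 1) q with h1 | h1 | h1
        · left
          rw [if_pos h1, if_pos (by omega)]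
        · right
          rw [if_neg (by omega), if_pos (by omega), one_mul, h1]
          exact ⟨le_rfl, h⟩
        · left
          rw [if_neg (by omega), if_neg (by omega)]
      · dsimp only
        rw [if_pos (show 0 < q by omega)]
        split_ifs <;> simp
  refine (estimateLis_expLe_of_thin hw h0 h98 hx hxn hnx hL hb hW (g := x ^ 3)
    (by rw [if_neg (by omega)]) (θ := τ)
    (T := x * (phaseTime (x ^ 10) (n / x ^ 10) b x + 9) + 120) (c₀ := x * δ + c₀) (c₁ := c₁)
    hc₁ ?_).weaken ?_ (fun _ => .inl le_rfl) ?_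
  · intro s' z a40 a41 a45 hz1 hzL _
    have h := improve_expLe hw a40 a41 hx hxn hL hb hW' u (hδ ▸ hu) (G := fun s' =>
      (if (L : ℤ) < s'.reg 45 then 1 else 0) + (if s'.reg 45 < τ then u x else 0)) fun _ => le_rfl
    refine ExpLe.weaken (ExpLe.seq (T' := 3) (ExpLe.ifL hw (T := 0)
      (T' := x * (phaseTime (x ^ 10) (n / x ^ 10) b x + 9) + 105) (by simp) ?_ (fun hlt => ?_)
      fun _ => h) fun s'' => ?_) (by simp; omega) (fun _ => .inl le_rfl) ?_
    · simp
      push_cast at hW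
      have := sq_nonneg (n : ℤ)
      omega
    · rw [eval_rg, eval_ct, a41] at hlt
      omega
    · refine Run.expLe (Q := fun s' => s'.reg 0 = s''.reg 45) ?_ fun s₃ h3 => ?_
      · exact Run.asg hw (by simp) (by norm_num) (by simp [St.setReg_reg])
      · rw [h3, hux]
        by_cases h1 : (L : ℤ) < s''.reg 45
        · rw [if_pos h1]
          refine le_trans ?_ le_self_add
          split_ifs <;> simp
        · by_cases h2 : s''.reg 45 < τ
          · rw [if_pos h2]
            refine le_trans ?_ le_add_self
            split_ifs <;> simp
          · rw [if_pos ⟨not_lt.1 h2, not_lt.1 h1⟩]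
            exact zero_le
    · rw [a45, if_neg (by omega), zero_add, ← hδ, add_assoc]
      gcongr
      simpa using hz z hz1
  · unfold estimateTime
    omega
  · rw [← hδ, add_assoc]
    push_cast
    rw [add_mul]
    gcongr

/-! ### Thresholds, parameters and running time -/

/-- From `x ^ 20 ≤ n ≤ x * L` the length is at least x^19, far above 4x^10. Also x times the block
length is at most x^2 L/x^10, and `32 ≤ x ^ 8`. -/
theorem GoodGuess.of_le {n x L q τ : ℕ} (hx : 2 ≤ x) (hxn : x ^ 20 ≤ n) (hL : n ≤ x * L)
    (hq : n ≤ q * L) (hτ : 7077888 * q ^ 3 * τ ≤ L) :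
    GoodGuess n (x ^ 10) (n / x ^ 10) L x τ q := by
  have hx0 : 0 < x := by omega
  have h8 : 32 ≤ x ^ 8 := by
    calc 32 ≤ 2 ^ 8 := by norm_num
      _ ≤ x ^ 8 := Nat.pow_le_pow_left hx 8
  refine ⟨?_, hq, ?_, ?_, hτ⟩
  · have := Nat.lt_div_mul_add (a := n) (b := x ^ 10) (by positivity)
    rw [mul_comm]
    exact this.le
  · refine le_of_mul_le_mul_left (?_ : x * (4 * x ^ 10) ≤ x * L) hx0
    calc x * (4 * x ^ 10) = 4 * x ^ 11 := by ring
      _ ≤ x ^ 9 * x ^ 11 := Nat.mul_le_mul_right _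
        (le_trans (by omega) (Nat.pow_le_pow_right hx0 (by norm_num : 8 ≤ 9)))
      _ = x ^ 20 := by ring
      _ ≤ x * L := hxn.trans hL
  · refine le_of_mul_le_mul_left (?_ : x ^ 10 * (32 * x * (n / x ^ 10)) ≤ x ^ 10 * L)
      (by positivity)
    calc x ^ 10 * (32 * x * (n / x ^ 10)) = 32 * x * (x ^ 10 * (n / x ^ 10)) := by ring
      _ ≤ 32 * x * (x * L) := Nat.mul_le_mul_left _ ((Nat.mul_div_le n _).trans hL)
      _ = 32 * x ^ 2 * L := by ring
      _ ≤ x ^ 8 * x ^ 2 * L := by gcongr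
      _ = _ := by ring

/-- The estimate reaches a threshold that is proportional to `L ^ 4 / n ^ 3`. -/
theorem exists_threshold {n x L : ℕ} (hx : 2 ≤ x) (hxn : x ^ 20 ≤ n) (hL0 : 0 < L) (hLn : L ≤ n) :
    ∃ τ, L ^ 4 ≤ 113246208 * n ^ 3 * τ ∧ (τ ≤ 1 ∨ 2 * x ^ 3 * (τ + x) + x ^ 3 ≤ L ∨
      ∃ q, 1 ≤ q ∧ q ≤ x ∧ GoodGuess n (x ^ 10) (n / x ^ 10) L x τ q) := by
  have hx0 : 0 < x := by omega
  have hn : 0 < n := by omega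
  rcases le_or_gt n (x * L) with h | h
  -- The ratio `n / L` rounded up, so `n ≤ q * L ≤ 2 * n`; the cube of this 2 is the factor 8 in
  -- 56623104 = 8·7077888.
  · obtain ⟨q, hq⟩ : ∃ q, q = (n - 1) / L + 1 := ⟨_, rfl⟩
    have hq1 : n ≤ q * L := by
      have := Nat.lt_div_mul_add (a := n - 1) hL0
      rw [hq, add_mul, one_mul]
      omega
    have hq2 : q * L ≤ 2 * n := by
      have := Nat.div_mul_le_self (n - 1) L
      rw [hq, add_mul, one_mul]
      omega
    have hqx : q ≤ x := by
      have : (n - 1) / L < x := Nat.div_lt_of_lt_mul (by rw [mul_comm]; omega)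
      omega
    have hq3 : q ^ 3 * L ^ 3 ≤ 8 * n ^ 3 := by
      calc q ^ 3 * L ^ 3 = (q * L) ^ 3 := by ring
        _ ≤ (2 * n) ^ 3 := Nat.pow_le_pow_left hq2 3
        _ = _ := by ring
    obtain ⟨t, ht⟩ : ∃ t, t = L / (7077888 * q ^ 3) := ⟨_, rfl⟩
    have h1 : L ≤ 7077888 * q ^ 3 * (t + 1) := by
      have := Nat.lt_mul_div_succ L (b := 7077888 * q ^ 3) (by rw [hq]; positivity)
      rw [← ht] at this
      exact this.le
    have h2 : 7077888 * q ^ 3 * t ≤ L := ht ▸ Nat.mul_div_le L _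
    have h3 : L ^ 4 ≤ 56623104 * n ^ 3 * (t + 1) := by
      calc L ^ 4 = L * L ^ 3 := by ring
        _ ≤ 7077888 * q ^ 3 * (t + 1) * L ^ 3 := Nat.mul_le_mul_right _ h1
        _ = 7077888 * (t + 1) * (q ^ 3 * L ^ 3) := by ring
        _ ≤ 7077888 * (t + 1) * (8 * n ^ 3) := Nat.mul_le_mul_left _ hq3
        _ = _ := by ring
    -- For `t = 0` the threshold 1 is attained by any nonempty sample. Otherwise `t + 1 ≤ 2 * t`
    -- explains the constant 113246208 = 16·7077888.
    rcases Nat.eq_zero_or_pos t with rfl | ht0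
    · exact ⟨1, h3.trans (by gcongr; norm_num), .inl le_rfl⟩
    · refine ⟨t, h3.trans ?_, .inr (.inr ⟨q, hq ▸ Nat.succ_pos _, hqx, .of_le hx hxn h hq1 h2⟩)⟩
      calc 56623104 * n ^ 3 * (t + 1) ≤ 56623104 * n ^ 3 * (2 * t) :=
            Nat.mul_le_mul_left _ (by omega)
        _ = _ := by ring
  · obtain ⟨t, ht⟩ : ∃ t, t = L ^ 4 / (113246208 * n ^ 3) := ⟨_, rfl⟩
    have h1 : L ^ 4 ≤ 113246208 * n ^ 3 * (t + 1) := by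
      have := Nat.lt_mul_div_succ (L ^ 4) (b := 113246208 * n ^ 3) (by positivity)
      rw [← ht] at this
      exact this.le
    have h2 : 113246208 * n ^ 3 * t ≤ L ^ 4 := ht ▸ Nat.mul_div_le _ _
    refine ⟨t + 1, h1, ?_⟩
    rcases Nat.eq_zero_or_pos t with rfl | ht0
    · exact .inl le_rfl
    refine .inr (.inl ?_)
    have h3 : 113246208 * x ^ 3 * t ≤ L := by
      refine le_of_mul_le_mul_left (?_ : n ^ 3 * (113246208 * x ^ 3 * t) ≤ n ^ 3 * L) (by positivity)
      calc n ^ 3 * (113246208 * x ^ 3 * t) = x ^ 3 * (113246208 * n ^ 3 * t) := by ring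
        _ ≤ x ^ 3 * L ^ 4 := Nat.mul_le_mul_left _ h2
        _ = (x * L) ^ 3 * L := by ring
        _ ≤ n ^ 3 * L := Nat.mul_le_mul_right _ (Nat.pow_le_pow_left h.le 3)
    -- As `t` is positive, L^4 is at least n^3 ≥ x^60. This makes the lower order terms `3 * x ^ 3 +
    -- 2 * x ^ 4` harmless.
    have h4 : x ^ 15 ≤ L := by
      refine le_of_not_gt fun hlt => ?_
      have h5 : L ^ 4 < n ^ 3 := by
        calc L ^ 4 < (x ^ 15) ^ 4 := Nat.pow_lt_pow_left hlt (by norm_num)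
          _ = (x ^ 20) ^ 3 := by ring
          _ ≤ n ^ 3 := Nat.pow_le_pow_left hxn 3
      have : n ^ 3 * 1 ≤ n ^ 3 * t := Nat.mul_le_mul_left _ ht0
      linarith
    have h5 : 10 * x ^ 4 ≤ L := by
      calc 10 * x ^ 4 ≤ 2 ^ 11 * x ^ 4 := Nat.mul_le_mul_right _ (by norm_num)
        _ ≤ x ^ 11 * x ^ 4 := Nat.mul_le_mul_right _ (Nat.pow_le_pow_left hx 11)
        _ = x ^ 15 := by ring
        _ ≤ L := h4
    have h6 : x ^ 3 ≤ x ^ 4 := Nat.pow_le_pow_right hx0 (by norm_num)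
    calc 2 * x ^ 3 * (t + 1 + x) + x ^ 3 = 2 * (x ^ 3 * t) + 3 * x ^ 3 + 2 * x ^ 4 := by ring
      _ ≤ L := by
        rw [mul_assoc] at h3
        omega

/-- Chooses `x₀`. As `n < (x + 1) ^ 20`, the failure probability (x+2)2^(-x) is at most n^(-c) from
there on. -/
theorem exists_pow_le_two_pow (c : ℕ) :
    ∃ x₀, 2 ≤ x₀ ∧ ∀ x, x₀ ≤ x → (x + 2) * ((x + 1) ^ 20) ^ c ≤ 2 ^ x := by
  have h := tendsto_pow_const_div_const_pow_of_one_lt (20 * c + 1) (r := (2 : ℝ)) (by norm_num)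
  obtain ⟨m, hm⟩ := Filter.eventually_atTop.1
    (h.eventually (gt_mem_nhds (show (0 : ℝ) < 1 / 4 by norm_num)))
  refine ⟨m + 2, by omega, fun x hx => ?_⟩
  have h1 := hm (x + 1) (by omega)
  rw [div_lt_iff₀ (by positivity), pow_succ (2 : ℝ)] at h1
  have h2 : (2 : ℝ) * (x + 1 : ℕ) ^ (20 * c + 1) ≤ 2 ^ x := by linarith
  have h3 : 2 * (x + 1) ^ (20 * c + 1) ≤ 2 ^ x := by exact_mod_cast h2
  refine le_trans ?_ h3
  rw [← pow_mul, pow_succ]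
  calc (x + 2) * (x + 1) ^ (20 * c) ≤ (2 * (x + 1)) * (x + 1) ^ (20 * c) :=
        Nat.mul_le_mul_right _ (by omega)
    _ = _ := by ring

/-- Blocks have length at most 2^20 x^10 because n < (2x)^20. The leading term comes from the
extraction, x^3 rounds over 36x^12 items, so one power of `x` is to spare. -/
theorem phaseTime_le {n x b : ℕ} (hx : 0 < x) (hnx : n < (x + 1) ^ 20) (hb : 0 < b) :
    phaseTime (x ^ 10) (n / x ^ 10) b x ≤ 2 ^ 45 * (x ^ 16 * b) := by
  have hB : n / x ^ 10 ≤ 2 ^ 20 * x ^ 10 := by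
    refine Nat.div_le_of_le_mul (hnx.le.trans ?_)
    calc (x + 1) ^ 20 ≤ (2 * x) ^ 20 := Nat.pow_le_pow_left (by omega) 20
      _ = _ := by ring
  have hp : ∀ i, i ≤ 16 → x ^ i ≤ x ^ 16 * b := fun i hi =>
    (Nat.pow_le_pow_right hx hi).trans (Nat.le_mul_of_pos_right _ hb)
  have hpb : ∀ i, i ≤ 16 → x ^ i * b ≤ x ^ 16 * b := fun i hi =>
    Nat.mul_le_mul_right _ (Nat.pow_le_pow_right hx hi)
  unfold phaseTime
  calc _ ≤ x ^ 10 * (36 * x ^ 2) * 150 +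
        2304 * x ^ 3 * (x ^ 10 * (36 * x ^ 2 * (b * 60 + 527) + 60) + 40) +
        55296 * x ^ 4 * (2 ^ 20 * x ^ 10 * (b * 60 + 500) + 230) + 500 := by gcongr
    _ = 5400 * x ^ 12 + 4976640 * (x ^ 15 * b) + 43711488 * x ^ 15 + 138240 * x ^ 13 +
        92160 * x ^ 3 + 3478923509760 * (x ^ 14 * b) + 28991029248000 * x ^ 14 +
        12718080 * x ^ 4 + 500 * x ^ 0 := by ring
    _ ≤ _ := by
      have h1 := hp 12 (by norm_num)
      have h2 := hpb 15 (by norm_num)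
      have h3 := hp 15 (by norm_num)
      have h4 := hp 13 (by norm_num)
      have h5 := hp 3 (by norm_num)
      have h6 := hpb 14 (by norm_num)
      have h7 := hp 14 (by norm_num)
      have h8 := hp 4 (by norm_num)
      have h9 := hp 0 (by norm_num)
      omega

theorem estimateTime_le {n x b g D : ℕ} (hx : 0 < x) (hnx : n < (x + 1) ^ 20) (hb : 0 < b)
    (hg : n / g ≤ D * x ^ 17) :
    estimateTime n b x g ≤ (2 ^ 46 + 560 * D) * (x ^ 17 * b) := by
  have h1 : x ≤ x ^ 17 * b :=
    (Nat.le_self_pow (by norm_num) x).trans (Nat.le_mul_of_pos_right _ hb)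
  have h2 : n / g * (b * 60 + 500) ≤ 560 * D * (x ^ 17 * b) := by
    calc n / g * (b * 60 + 500) ≤ D * x ^ 17 * (b * 560) := Nat.mul_le_mul hg (by omega)
      _ = _ := by ring
  have h3 : x * phaseTime (x ^ 10) (n / x ^ 10) b x ≤ 2 ^ 45 * (x ^ 17 * b) := by
    calc x * phaseTime (x ^ 10) (n / x ^ 10) b x ≤ x * (2 ^ 45 * (x ^ 16 * b)) :=
          Nat.mul_le_mul_left _ (phaseTime_le hx hnx hb)
      _ = _ := by ring
  unfold estimateTime
  rw [mul_add x, add_mul (2 ^ 46)]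
  omega

/-- For short inputs the sample is the whole array, and the surplus factor `x ^ 3` is bounded by the
constant `x₀ ^ 3`. -/
theorem div_block_le {n x x₀ : ℕ} (hx : 0 < x) (hnx : n < (x + 1) ^ 20) :
    n / (if x < x₀ then 1 else x ^ 3) ≤ 2 ^ 20 * (x₀ ^ 3 + 1) * x ^ 17 := by
  have hn : n ≤ 2 ^ 20 * (x ^ 3 * x ^ 17) := by
    refine hnx.le.trans ?_
    calc (x + 1) ^ 20 ≤ (2 * x) ^ 20 := Nat.pow_le_pow_left (by omega) 20
      _ = _ := by ring
  split_ifs with h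
  · rw [Nat.div_one]
    refine hn.trans ?_
    rw [mul_assoc]
    gcongr
    exact (Nat.pow_le_pow_left h.le 3).trans (Nat.le_succ _)
  · refine Nat.div_le_of_le_mul (hn.trans ?_)
    calc 2 ^ 20 * (x ^ 3 * x ^ 17) = x ^ 3 * (2 ^ 20 * 1 * x ^ 17) := by ring
      _ ≤ x ^ 3 * (2 ^ 20 * (x₀ ^ 3 + 1) * x ^ 17) := by gcongr; omega

theorem log_two_add_le {n : ℕ} (hn : 1 ≤ n) :
    ((Nat.log 2 n + 7 : ℕ) : ℝ) ≤ 9 * Real.log (n + 2) := by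
  have hn' : (1 : ℝ) ≤ n := by exact_mod_cast hn
  have h1 : 1 ≤ Real.log (n + 2) := by
    rw [Real.le_log_iff_exp_le (by linarith)]
    linarith [Real.exp_one_lt_d9]
  have h2 : Nat.log 2 n * Real.log 2 ≤ Real.log (n + 2) := by
    rw [← Real.log_pow]
    refine Real.log_le_log (by positivity) ?_
    have : ((2 ^ Nat.log 2 n : ℕ) : ℝ) ≤ n := by
      exact_mod_cast Nat.pow_log_le_self 2 (by omega)
    push_cast at this
    linarith
  have h3 := Real.log_two_gt_d9
  have h4 : (0 : ℝ) ≤ Nat.log 2 n := by positivity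
  push_cast
  nlinarith

theorem pow_le_rpow_of_pow_le {n x : ℕ} (h : x ^ 20 ≤ n) :
    (x : ℝ) ^ 17 ≤ (n : ℝ) ^ ((17 : ℝ) / 20) := by
  have h' : (x : ℝ) ^ 20 ≤ n := by exact_mod_cast h
  calc (x : ℝ) ^ 17 = ((x : ℝ) ^ 20) ^ ((17 : ℝ) / 20) := by
        rw [← Real.rpow_natCast, ← Real.rpow_natCast, ← Real.rpow_mul (by positivity)]
        norm_num
    _ ≤ _ := Real.rpow_le_rpow (by positivity) h' (by norm_num)

/-- Twice the logarithm and 42 more bits hold `2 ^ 40 * n ^ 2`; the summand `x₀` in the factor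
leaves room for the constant `x₀` of the program. -/
theorem word_bound {n w x₀ : ℕ} (hw : (50 + x₀) * (Nat.log 2 n + 1) ≤ w) :
    1 ≤ w ∧ ((2 ^ 40 * n ^ 2 + x₀ : ℕ) : ℤ) < wmax w := by
  obtain ⟨l, hl⟩ : ∃ l, l = Nat.log 2 n := ⟨_, rfl⟩
  have hn : n < 2 ^ (l + 1) := hl ▸ Nat.lt_pow_succ_log_self (by norm_num) n
  rw [← hl] at hw
  have h1 : 2 * l + 43 + x₀ + 1 ≤ w := by nlinarith [Nat.zero_le (x₀ * l)]
  refine ⟨by omega, ?_⟩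
  have h2 : 2 ^ 40 * n ^ 2 ≤ 2 ^ (2 * l + 42 + x₀) := by
    calc 2 ^ 40 * n ^ 2 ≤ 2 ^ 40 * (2 ^ (l + 1)) ^ 2 :=
          Nat.mul_le_mul_left _ (Nat.pow_le_pow_left hn.le 2)
      _ = 2 ^ (2 * l + 42) := by rw [← pow_mul, ← pow_add]; congr 1; ring
      _ ≤ _ := Nat.pow_le_pow_right (by norm_num) (by omega)
  have h3 : x₀ < 2 ^ (2 * l + 42 + x₀) :=
    Nat.lt_two_pow_self.trans_le (Nat.pow_le_pow_right (by norm_num) (by omega))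
  have h4 : 2 ^ 40 * n ^ 2 + x₀ < 2 ^ (w - 1) := by
    calc 2 ^ 40 * n ^ 2 + x₀ < 2 ^ (2 * l + 42 + x₀) + 2 ^ (2 * l + 42 + x₀) :=
          Nat.add_lt_add_of_le_of_lt h2 h3
      _ = 2 ^ (2 * l + 43 + x₀) := by ring
      _ ≤ _ := Nat.pow_le_pow_right (by norm_num) (by omega)
  unfold wmax
  exact_mod_cast h4

theorem exists_root {n : ℕ} (hn : 1 ≤ n) : ∃ x, 0 < x ∧ x ^ 20 ≤ n ∧ n < (x + 1) ^ 20 := by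
  have h : ∃ m, n < m ^ 20 := ⟨n + 1, (Nat.lt_succ_self n).trans_le (Nat.le_self_pow (by norm_num) _)⟩
  classical
  obtain ⟨m, hm⟩ : ∃ m, m = Nat.find h := ⟨_, rfl⟩
  have h1 : n < m ^ 20 := hm ▸ Nat.find_spec h
  have h2 : 2 ≤ m := by
    by_contra hlt
    have : m ^ 20 ≤ 1 ^ 20 := Nat.pow_le_pow_left (by omega) 20
    omega
  refine ⟨m - 1, by omega, ?_, by rwa [show m - 1 + 1 = m by omega]⟩
  exact not_lt.1 (Nat.find_min h (by omega))

/-! ### Conclusion -/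

variable {w n : ℕ} {A : Fin n → ℤ}

theorem lis_eq_lisOn (A : Fin n → ℤ) :
    lis A = lisOn (fun x => entry A x) (Finset.range n) := by
  classical
  have he : ∀ i : Fin n, entry A ((i : ℕ) : ℤ) = A i := fun i => by simp [entry]
  apply le_antisymm
  · refine Finset.sup_le fun s hs => ?_
    have hs' := (Finset.mem_filter.1 hs).2
    rw [← Finset.card_image_of_injective s Fin.val_injective]
    refine le_lisOn (fun x hx => ?_) fun x hx y hy hxy => ?_
    · obtain ⟨i, -, rfl⟩ := Finset.mem_image.1 hx
      exact Finset.mem_range.2 i.2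
    · obtain ⟨i, hi, rfl⟩ := Finset.mem_image.1 hx
      obtain ⟨j, hj, rfl⟩ := Finset.mem_image.1 hy
      simp only [he]
      exact hs' hi hj hxy
  · obtain ⟨T, hT, hm, hc⟩ := exists_lisOn (fun x : ℕ => entry A x) (Finset.range n)
    rw [← hc]
    have h : T = (Finset.univ.filter fun i : Fin n => (i : ℕ) ∈ T).image Fin.val := by
      ext x
      simp only [Finset.mem_image, Finset.mem_filter, Finset.mem_univ, true_and]
      exact ⟨fun hx => ⟨⟨x, Finset.mem_range.1 (hT hx)⟩, hx, rfl⟩, by rintro ⟨i, hi, rfl⟩; exact hi⟩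
    rw [h, Finset.card_image_of_injective _ Fin.val_injective]
    refine Finset.le_sup (f := Finset.card) (Finset.mem_filter.2 ⟨Finset.mem_univ _, ?_⟩)
    intro i hi j hj hij
    have := hm (Finset.mem_filter.1 hi).2 (Finset.mem_filter.1 hj).2 hij
    simpa only [he] using this

/-- A bound for the expectation of a penalty for bad results bounds the probability of those. -/
theorem ExpLe.halts_outputProb {p : Prog} {T : ℕ} {S : Set ℤ} {G : St → ℝ≥0∞} {δ : ℝ≥0∞}
    (h : ExpLe w A p (view (initial p n).store) T G δ) (hδ : δ ≠ ⊤)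
    (hG : ∀ s, s.reg 0 ∉ S → 1 ≤ G s) :
    HaltsWithin p w A T ∧ 1 - δ ≤ outputProb p w A T S := by
  have h1 := h _ rfl [] 0 (fun σ => G (view σ)) fun σ => (expect_halted w A 0 σ _).le
  exact ⟨halted_of_expect_ne_top w A T _ _ (ne_top_of_le_ne_top hδ h1),
    outputProb_ge w A p T S _ δ (fun σ hσ => hG _ (by rwa [view_reg (by norm_num)])) h1⟩

theorem estimateTime_le_rpow {x x₀ D : ℕ} (hn : 1 ≤ n) (hx : 0 < x) (hxn : x ^ 20 ≤ n)
    (hnx : n < (x + 1) ^ 20) (hD : 2 ^ 46 + 560 * (2 ^ 20 * (x₀ ^ 3 + 1)) ≤ D) :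
    (estimateTime n (Nat.log 2 n + 7) x (if x < x₀ then 1 else x ^ 3) : ℝ) ≤
      D * 9 * (n : ℝ) ^ ((17 : ℝ) / 20) * Real.log (n + 2) := by
  have h1 := (estimateTime_le hx hnx (b := Nat.log 2 n + 7) (by omega)
    (div_block_le (x₀ := x₀) hx hnx)).trans (Nat.mul_le_mul_right _ hD)
  refine (Nat.cast_le.2 h1).trans ?_
  rw [Nat.cast_mul, Nat.cast_mul, Nat.cast_pow, mul_assoc, mul_assoc]
  refine mul_le_mul_of_nonneg_left ?_ (Nat.cast_nonneg D)
  calc (x : ℝ) ^ 17 * (Nat.log 2 n + 7 : ℕ) ≤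
      (n : ℝ) ^ ((17 : ℝ) / 20) * (9 * Real.log (n + 2)) :=
        mul_le_mul (pow_le_rpow_of_pow_le hxn) (log_two_add_le hn) (Nat.cast_nonneg _)
          (Real.rpow_nonneg (Nat.cast_nonneg n) _)
    _ = _ := by ring

/-- With `lis A = n * lam` the lower bound becomes a comparison of `lis A ^ 4` with `n ^ 3 * est`,
free of division and of the unknown ratio. -/
theorem estimateLis_spec {c x₀ D : ℕ} (hx₀ : 2 ≤ x₀)
    (hD : D = 2 ^ 46 + 560 * (2 ^ 20 * (x₀ ^ 3 + 1)))
    (hfail : ∀ x, x₀ ≤ x → (x + 2) * ((x + 1) ^ 20) ^ c ≤ 2 ^ x) (hn : 1 ≤ n)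
    (hw : (50 + x₀) * (Nat.log 2 n + 1) ≤ w) (A : Fin n → ℤ) :
    ∃ t : ℕ, (t : ℝ) ≤ D * 9 * (n : ℝ) ^ ((17 : ℝ) / 20) * Real.log (n + 2) ∧ HaltsWithin (estimateLis x₀) w A t ∧
      ENNReal.ofReal (1 - 1 / (n : ℝ) ^ c) ≤ outputProb (estimateLis x₀) w A t
        {est : ℤ | (lis A : ℤ) ^ 4 ≤ 113246208 * n ^ 3 * est ∧ est ≤ lis A} := by
  obtain ⟨hw1, hW⟩ := word_bound hw
  obtain ⟨x, hx, hxn, hnx⟩ := exists_root hn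
  obtain ⟨L, hL⟩ : ∃ L, L = lis A := ⟨_, rfl⟩
  have hL' := hL.trans (lis_eq_lisOn A)
  have hL0 : 0 < L := hL' ▸ one_le_lisOn hn
  have hLn : L ≤ n := by
    rw [hL']
    simpa using lisOn_le_card (fun x : ℕ => entry A x) (Finset.range n)
  -- The number of search steps must also suffice for the up to 36x^12 ≤ 36n items of a phase.
  have hb : 64 * n ≤ 2 ^ (Nat.log 2 n + 7) := by
    have := Nat.lt_pow_succ_log_self (b := 2) (by norm_num) n
    calc 64 * n ≤ 64 * 2 ^ (Nat.log 2 n + 1) := Nat.mul_le_mul_left _ this.le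
      _ = _ := by ring
  have h0 : (view (initial (estimateLis x₀) n).store).reg 0 = n := by
    rw [view_reg (by norm_num)]
    simp [initial]
  have h98 : (view (initial (estimateLis x₀) n).store).arr 9 =
      (view (initial (estimateLis x₀) n).store).arr 8 := by
    funext t
    simp [view, initial]
  refine ⟨estimateTime n (Nat.log 2 n + 7) x (if x < x₀ then 1 else x ^ 3), ?_, ?_⟩
  · exact estimateTime_le_rpow hn hx hxn hnx (hD ▸ le_rfl)
  rw [← hL]
  by_cases hlt : x < x₀
  · rw [if_pos hlt]
    obtain ⟨h1, h2⟩ := (estimateLis_expLe_of_lt hw1 h0 h98 hx hxn hnx hL' hb hW hlt).halts_outputProb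
      (S := {est : ℤ | (L : ℤ) ^ 4 ≤ 113246208 * n ^ 3 * est ∧ est ≤ L}) (by simp) fun s hs => by
        rw [if_neg]
        intro h
        apply hs
        rw [h]
        refine ⟨?_, le_rfl⟩
        have h3 : L ^ 4 ≤ 113246208 * n ^ 3 * L := by
          calc L ^ 4 = 1 * L ^ 3 * L := by ring
            _ ≤ 113246208 * n ^ 3 * L := by gcongr; norm_num
        exact_mod_cast h3
    refine ⟨h1, le_trans ?_ h2⟩
    rw [tsub_zero, ENNReal.ofReal_le_one]
    have : (0 : ℝ) ≤ 1 / (n : ℝ) ^ c := by positivity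
    linarith
  · rw [if_neg hlt]
    obtain ⟨τ, hτ, hlow⟩ := exists_threshold (x := x) (by omega) hxn hL0 hLn
    obtain ⟨h1, h2⟩ := (estimateLis_expLe_of_le hw1 h0 h98 hx hxn hnx hL' hb hW (not_lt.1 hlt)
      hlow).halts_outputProb
      (S := {est : ℤ | (L : ℤ) ^ 4 ≤ 113246208 * n ^ 3 * est ∧ est ≤ L}) (by finiteness)
      fun s hs => by
        rw [if_neg]
        rintro ⟨h3, h4⟩
        refine hs ⟨?_, h4⟩
        calc (L : ℤ) ^ 4 ≤ 113246208 * n ^ 3 * τ := by exact_mod_cast hτ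
          _ ≤ _ := by gcongr
    refine ⟨h1, le_trans ?_ h2⟩
    rw [ENNReal.ofReal_sub _ (by positivity), ENNReal.ofReal_one, ← ENNReal.ofReal_natCast,
      ← ENNReal.ofReal_mul (by positivity)]
    refine tsub_le_tsub_left (ENNReal.ofReal_le_ofReal ?_) _
    have hn' : (0 : ℝ) < n := by exact_mod_cast hn
    rw [le_div_iff₀ (by positivity), one_div, inv_pow, mul_assoc, mul_comm, mul_assoc, inv_mul_le_iff₀
      (by positivity), mul_one, mul_comm]
    have h3 : (x + 2) * n ^ c ≤ 2 ^ x :=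
      (Nat.mul_le_mul_left _ (Nat.pow_le_pow_left hnx.le c)).trans (hfail x (not_lt.1 hlt))
    exact_mod_cast h3

end WordRAM

theorem mainTheorem5 :
    ∃ α : ℝ, 0 < α ∧ ∀ c : ℕ,
      ∃ (p : WordRAM.Prog) (K k : ℕ) (C : ℝ),
        ∀ (n w : ℕ), 1 ≤ n → K * (Nat.log 2 n + 1) ≤ w →
        ∀ A : Fin n → ℤ, (∀ i, WordRAM.IsWord w (A i)) →
        ∀ lam : ℝ, (lis A : ℝ) = n * lam →
          ∃ t : ℕ, (t : ℝ) ≤ C * (n : ℝ) ^ ((17 : ℝ) / 20) * Real.log (n + 2) ^ k ∧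
            WordRAM.HaltsWithin p w A t ∧
            ENNReal.ofReal (1 - 1 / (n : ℝ) ^ c) ≤
              WordRAM.outputProb p w A t
                {est : ℤ | α * lam ^ 3 * (lis A : ℝ) ≤ (est : ℝ) ∧ (est : ℝ) ≤ (lis A : ℝ)} := by
  refine ⟨1 / 113246208, by norm_num, fun c => ?_⟩
  obtain ⟨x₀, hx₀, hfail⟩ := WordRAM.exists_pow_le_two_pow c
  obtain ⟨D, hD⟩ : ∃ D, D = 2 ^ 46 + 560 * (2 ^ 20 * (x₀ ^ 3 + 1)) := ⟨_, rfl⟩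
  refine ⟨WordRAM.estimateLis x₀, 50 + x₀, 1, D * 9, fun n w hn hw A _ lam hlam => ?_⟩
  obtain ⟨t, h1, h2, h3⟩ := WordRAM.estimateLis_spec hx₀ hD hfail hn hw A
  refine ⟨t, by rw [pow_one]; exact h1, h2, h3.trans ?_⟩
  refine MeasureTheory.measure_mono fun d hd => ⟨hd.1, ?_⟩
  obtain ⟨h4, h5⟩ := hd.2
  refine ⟨?_, by exact_mod_cast h5⟩
  have h4' : (lis A : ℝ) ^ 4 ≤ 113246208 * (n : ℝ) ^ 3 * d.output := by exact_mod_cast h4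
  have hn' : (0 : ℝ) < n := by exact_mod_cast hn
  refine le_of_mul_le_mul_left ?_ (show (0 : ℝ) < 113246208 * (n : ℝ) ^ 3 by positivity)
  calc 113246208 * (n : ℝ) ^ 3 * (1 / 113246208 * lam ^ 3 * (lis A : ℝ)) =
      (n * lam) ^ 3 * lis A := by ring
    _ = (lis A : ℝ) ^ 4 := by rw [← hlam]; ring
    _ ≤ _ := h4'
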